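/- Let $d\in\mathbb N$, $\beta,L,M_1,M_2,T>0$, and let $\lfloor\beta\rfloor$ denote the largest integer strictly smaller than $\beta$. Let $b^\circ=-\nabla V:\mathbb R^d\to\mathbb R^d$ with $V\in C^2(\mathbb R^d)$ satisfy, for all $x,y\in\mathbb R^d$, $$|b^\circ(x)|\le M_1(1+|x|),\qquad (b^\circ(x)-b^\circ(y))^T(x-y)\le -M_2|x-y|^2,$$ and suppose that every component $b^\circ_i$ is of class $C^{\lfloor\beta\rfloor}$ with $|D^\alpha b^\circ_i(x)-D^\alpha b^\circ_i(y)|\le L|x-y|^{\beta-\lfloor\beta\rfloor}$ for all multi-indices $|\alpha|=\lfloor\beta\rfloor$. Put $\mu(x)=e^{-2V(x)}/\int_{\mathbb R^d}e^{-2V(u)}\,du$. Let $W$ be a $d$-dimensional Brownian motion on a filtered probability space and let $X$ be a continuous adapted solution on $[0,T]$ of $$dX_t=b^\circ(X_t)\,dt+dW_t,$$ where $X_0$ is measurable with respect to the initial $\sigma$-field (hence independent of $W$) and has Lebesgue density $\mu$. Let $A=[-a,a)^d$ with $a>0$, let $h>0$ with $a/h\in\mathbb N$, let $(a_m)_m$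 be the points of $(h\mathbb Z^d)\cap A$ and $\mathbf C_m=\prod_{i=1}^d[a_{mi},a_{mi}+h)$. Let $K$ be the number of multi-indices $\alpha\in\mathbb N^d$ with $|\alpha|\le\lfloor\beta\rfloor$, and let $\mathbf v(x)=(x^\alpha/\alpha!)_{|\alpha|\le\lfloor\beta\rfloor}\in\mathbb R^K$. For $t\in[0,T]$ and $j=1,\dots,d$ set $$\mathcal J_m=\int_{\mathbf C_m}\mathbf v(x-a_m)\mathbf v(x-a_m)^T\mu(x)\,dx,\qquad \hat{\mathcal J}_m(t)=\int_0^t\mathbf 1_{\mathbf C_m}(X_s)\mathbf v(X_s-a_m)\mathbf v(X_s-a_m)^T\,ds,$$ $$\hat\eta_{mj}(t)=\int_0^t\mathbf 1_{\mathbf C_m}(X_s)\mathbf v(X_s-a_m)\,dW_{s,j}$$ (the Itô integral with continuous paths), and $$\tau_m=\inf\{t\in[0,T]:\|\mathcal J_m^{-1/2}\hat{\mathcal J}_m(t)\mathcal J_m^{-1/2}\|\ge T\}\wedge T,$$ where $\|\cdot\|$ is the Euclidean operator norm. Let $(\varepsilon_{mj})_{m,j}$ be independent standard normal random vectors in $\mathbb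 R^K$ on the same probability space such that the family $(\varepsilon_{mj})_{m,j}$ is independent of $(X_t)_{t\in[0,T]}$, and set $$\eta_{mj}=T^{-1/2}\,\hat\eta_{mj}(\tau_m)+\big(\mathcal J_m-T^{-1}\hat{\mathcal J}_m(\tau_m)\big)^{1/2}\varepsilon_{mj}.$$ Then the random vectors $(\eta_{mj})_{m,j}$ are independent, and each $\eta_{mj}$ is centred Gaussian with covariance matrix $\mathcal J_m$. -/

import Mathlib

open MeasureTheory ProbabilityTheory Filter Topology
open scoped NNReal ENNReal MatrixOrder

noncomputable section

/-! ### Drift functions, Hölder classes and the invariant density -/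

/-- `⌊β⌋`, the largest integer strictly smaller than `β` (for `β > 0`). -/
def strictFloor (β : ℝ) : ℕ := ⌈β⌉₊ - 1

/-- The Hölder class `H(β, L)`: `f` is of class `C^⌊β⌋`, and all its partial derivatives
`∂^⌊β⌋ f / ∂x_{ι 1} ⋯ ∂x_{ι ⌊β⌋}` of order `⌊β⌋` are Hölder of exponent `β - ⌊β⌋` with
constant `L`. -/
structure MemHolderClass {d : ℕ} (β L : ℝ) (f : EuclideanSpace ℝ (Fin d) → ℝ) : Prop where
  contDiff : ContDiff ℝ (strictFloor β : ℕ) f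
  holder : ∀ (ι : Fin (strictFloor β) → Fin d) (x y : EuclideanSpace ℝ (Fin d)),
    |iteratedFDeriv ℝ (strictFloor β) f x (fun k => EuclideanSpace.single (ι k) (1 : ℝ))
      - iteratedFDeriv ℝ (strictFloor β) f y (fun k => EuclideanSpace.single (ι k) (1 : ℝ))|
      ≤ L * ‖x - y‖ ^ (β - strictFloor β)

/-- `b = -∇V` belongs to the class `Σ_β(L, M₁, M₂)`, with potential `V`. -/
structure MemDriftClass {d : ℕ} (β L M₁ M₂ : ℝ) (V : EuclideanSpace ℝ (Fin d) → ℝ)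
    (b : EuclideanSpace ℝ (Fin d) → EuclideanSpace ℝ (Fin d)) : Prop where
  contDiff_potential : ContDiff ℝ 2 V
  eq_neg_gradient : ∀ x, b x = -gradient V x
  growth : ∀ x, ‖b x‖ ≤ M₁ * (1 + ‖x‖)
  monotone : ∀ x y, inner ℝ (b x - b y) (x - y) ≤ -M₂ * ‖x - y‖ ^ 2
  holder : ∀ i, MemHolderClass β L (fun x => b x i)

/-- The invariant density `μ_b(x) = exp(-2 V(x)) / ∫ exp(-2 V(u)) du` for `b = -∇V`. -/
def invariantDensity {d : ℕ} (V : EuclideanSpace ℝ (Fin d) → ℝ)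
    (x : EuclideanSpace ℝ (Fin d)) : ℝ :=
  (∫ u, Real.exp (-2 * V u))⁻¹ * Real.exp (-2 * V x)

/-! ### Brownian motion and the stationary diffusion -/

/-- `W` is a standard `d`-dimensional Brownian motion with respect to the filtration `𝓕`. -/
structure IsFilteredBrownian {Ω : Type*} {mΩ : MeasurableSpace Ω} {d : ℕ}
    (𝓕 : Filtration ℝ≥0 mΩ) (P : Measure Ω)
    (W : ℝ≥0 → Ω → EuclideanSpace ℝ (Fin d)) : Prop where
  adapted : ∀ t, Measurable[𝓕 t] (W t)
  isBrownian : ∀ i, IsBrownianReal (fun t ω => W t ω i) P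
  indep_components : iIndepFun (fun i ω (t : ℝ≥0) => W t ω i) P
  indep_increments : ∀ s t, s ≤ t →
    Indep (MeasurableSpace.comap (fun ω => W t ω - W s ω) inferInstance) (𝓕 s) P

/-- `X` is a solution on `[0, T]` of `dX_t = b(X_t) dt + dW_t` (on a filtered probability space),
with continuous paths, whose initial value has the law with Lebesgue density `μ`.
The initial value is `𝓕 0`-measurable, hence independent of the `𝓕`-Brownian motion `W`. -/
structure IsDiffusion {Ω : Type*} {mΩ : MeasurableSpace Ω} {d : ℕ}
    (𝓕 : Filtration ℝ≥0 mΩ) (P : Measure Ω) (T : ℝ≥0)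
    (b : EuclideanSpace ℝ (Fin d) → EuclideanSpace ℝ (Fin d))
    (μ : EuclideanSpace ℝ (Fin d) → ℝ)
    (W X : ℝ≥0 → Ω → EuclideanSpace ℝ (Fin d)) : Prop where
  brownian : IsFilteredBrownian 𝓕 P W
  adapted : ∀ t, t ≤ T → Measurable[𝓕 t] (X t)
  continuous_paths : ∀ ω, ContinuousOn (fun t => X t ω) (Set.Icc 0 T)
  equation : ∀ᵐ ω ∂P, ∀ t, t ≤ T →
    X t ω = X 0 ω + (∫ s in (0 : ℝ)..t, b (X s.toNNReal ω)) + W t ω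
  initial_law : HasLaw (X 0) (volume.withDensity (fun x => ENNReal.ofReal (μ x))) P

/-! ### The Itô integral -/

/-- An elementary process `∑ i, ξ_i 1_{(s_i, t_i]}` with `ξ_i` bounded and `𝓕 s_i`-measurable. -/
structure ElementaryProcess {Ω : Type*} {mΩ : MeasurableSpace Ω} (𝓕 : Filtration ℝ≥0 mΩ) where
  n : ℕ
  left : Fin n → ℝ≥0
  right : Fin n → ℝ≥0
  left_le_right : ∀ i, left i ≤ right i
  coeff : Fin n → Ω → ℝ
  measurable_coeff : ∀ i, Measurable[𝓕 (left i)] (coeff i)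
  bounded_coeff : ∃ C : ℝ, ∀ i ω, |coeff i ω| ≤ C

/-- The value at time `t` of an elementary process. -/
def ElementaryProcess.value {Ω : Type*} {mΩ : MeasurableSpace Ω} {𝓕 : Filtration ℝ≥0 mΩ}
    (S : ElementaryProcess 𝓕) (t : ℝ≥0) (ω : Ω) : ℝ :=
  ∑ i, (Set.Ioc (S.left i) (S.right i)).indicator (fun _ => S.coeff i ω) t

/-- The elementary stochastic integral `∫_0^t S dB`. -/
def ElementaryProcess.integral {Ω : Type*} {mΩ : MeasurableSpace Ω} {𝓕 : Filtration ℝ≥0 mΩ}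
    (S : ElementaryProcess 𝓕) (B : ℝ≥0 → Ω → ℝ) (t : ℝ≥0) (ω : Ω) : ℝ :=
  ∑ i, S.coeff i ω * (B (min (S.right i) t) ω - B (min (S.left i) t) ω)

/-- `I` is a version, with almost surely continuous paths on `[0, T]`, of the Itô integral process
`t ↦ ∫_0^t H dB`, `t ∈ [0, T]`: some elementary processes converge to `H` in `L²(dt ⊗ P)`, and
their integrals up to `t` converge to `I t` in `L²(P)`. -/
structure IsItoIntegral {Ω : Type*} {mΩ : MeasurableSpace Ω} (𝓕 : Filtration ℝ≥0 mΩ)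
    (P : Measure Ω) (B : ℝ≥0 → Ω → ℝ) (T : ℝ≥0) (H I : ℝ≥0 → Ω → ℝ) : Prop where
  continuous_paths : ∀ᵐ ω ∂P, ContinuousOn (fun t => I t ω) (Set.Icc 0 T)
  memLp : ∀ t, t ≤ T → MemLp (I t) 2 P
  approx : ∃ S : ℕ → ElementaryProcess 𝓕,
    Tendsto (fun n => ∫⁻ ω, (∫⁻ s in Set.Icc (0 : ℝ) T,
      ‖(S n).value s.toNNReal ω - H s.toNNReal ω‖ₑ ^ 2) ∂P) atTop (𝓝 0) ∧
    ∀ t, t ≤ T →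
      Tendsto (fun n => eLpNorm (fun ω => (S n).integral B t ω - I t ω) 2 P) atTop (𝓝 0)

open scoped Classical in
/-- The Itô integral process `t ↦ ∫_0^t H dB` on `[0, T]` (it is determined up to
indistinguishability; the value is `0` when no such process exists). -/
def itoIntegral {Ω : Type*} {mΩ : MeasurableSpace Ω} (𝓕 : Filtration ℝ≥0 mΩ)
    (P : Measure Ω) (B : ℝ≥0 → Ω → ℝ) (T : ℝ≥0) (H : ℝ≥0 → Ω → ℝ) : ℝ≥0 → Ω → ℝ :=
  if h : ∃ I, IsItoIntegral 𝓕 P B T H I then h.choose else 0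

/-! ### Space discretisation -/

/-- The grid `(h ℤ^d) ∩ [-a, a)^d`. -/
def gridPoints (d : ℕ) (a h : ℝ) : Set (EuclideanSpace ℝ (Fin d)) :=
  {x | ∀ i, (∃ z : ℤ, x i = h * z) ∧ -a ≤ x i ∧ x i < a}

/-- The cube `∏ i, [p_i, p_i + h)`. -/
def subcube {d : ℕ} (h : ℝ) (p : EuclideanSpace ℝ (Fin d)) : Set (EuclideanSpace ℝ (Fin d)) :=
  {x | ∀ i, p i ≤ x i ∧ x i < p i + h}

/-- The multi-indices `α ∈ ℕ^d` with `|α| ≤ s`. -/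
abbrev MultiIndex (d s : ℕ) : Type := {α : Fin d → Fin (s + 1) // ∑ i, (α i : ℕ) ≤ s}

/-- The monomials `𝐯_α(x) = x^α / α!`. -/
def monomialVec {d s : ℕ} (α : MultiIndex d s) (x : EuclideanSpace ℝ (Fin d)) : ℝ :=
  ∏ i, x i ^ (α.1 i : ℕ) / ((α.1 i : ℕ).factorial : ℝ)

/-- `x ↦ 1_{C}(x) 𝐯_α(x - p)`, where `C` is the subcube with corner `p`. -/
def localMonomial {d s : ℕ} (h : ℝ) (p : EuclideanSpace ℝ (Fin d)) (α : MultiIndex d s)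
    (x : EuclideanSpace ℝ (Fin d)) : ℝ :=
  (subcube h p).indicator (fun x => monomialVec α (x - p)) x

/-- The matrix `𝓙 = ∫_C 𝐯(x - p) 𝐯(x - p)ᵀ μ(x) dx`, where `C` is the subcube with corner `p`. -/
def infoMatrix {d : ℕ} (s : ℕ) (h : ℝ) (μ : EuclideanSpace ℝ (Fin d) → ℝ)
    (p : EuclideanSpace ℝ (Fin d)) : Matrix (MultiIndex d s) (MultiIndex d s) ℝ :=
  Matrix.of fun k l => ∫ x in subcube h p, monomialVec k (x - p) * monomialVec l (x - p) * μ x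

/-- The random matrix `∫_0^t 1_C(X_u) 𝐯(X_u - p) 𝐯(X_u - p)ᵀ du`. -/
def empInfoMatrix {Ω : Type*} {d : ℕ} (s : ℕ) (h : ℝ)
    (X : ℝ≥0 → Ω → EuclideanSpace ℝ (Fin d)) (p : EuclideanSpace ℝ (Fin d)) (t : ℝ≥0) (ω : Ω) :
    Matrix (MultiIndex d s) (MultiIndex d s) ℝ :=
  Matrix.of fun k l => ∫ u in (0 : ℝ)..t, (subcube h p).indicator
    (fun x => monomialVec k (x - p) * monomialVec l (x - p)) (X u.toNNReal ω)

/-- The operator norm `sup |A x| / |x|` of a square matrix with respect to Euclidean norms. -/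
def matrixOpNorm {ι : Type*} [Fintype ι] [DecidableEq ι] (A : Matrix ι ι ℝ) : ℝ :=
  ‖Matrix.toEuclideanCLM (𝕜 := ℝ) A‖

/-- The stopping time `inf {t ∈ [0, T] : ‖J^{-1/2} Ĵ(t) J^{-1/2}‖ ≥ T} ∧ T`. -/
def infoTime {Ω : Type*} {ι : Type*} [Fintype ι] [DecidableEq ι] (T : ℝ≥0)
    (J : Matrix ι ι ℝ) (Jhat : ℝ≥0 → Ω → Matrix ι ι ℝ) : Ω → ℝ≥0 :=
  hittingBtwn (fun t ω => matrixOpNorm ((CFC.sqrt J)⁻¹ * Jhat t ω * (CFC.sqrt J)⁻¹))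
    (Set.Ici (T : ℝ)) 0 T

/-- The random vector process `η̂(t) = ∫_0^t 1_C(X_u) 𝐯(X_u - p) dB_u` on `[0, T]`. -/
def scoreProcess {Ω : Type*} {mΩ : MeasurableSpace Ω} {d : ℕ} (𝓕 : Filtration ℝ≥0 mΩ)
    (P : Measure Ω) (T : ℝ≥0) (s : ℕ) (h : ℝ) (B : ℝ≥0 → Ω → ℝ)
    (X : ℝ≥0 → Ω → EuclideanSpace ℝ (Fin d)) (p : EuclideanSpace ℝ (Fin d)) (t : ℝ≥0) (ω : Ω) :
    EuclideanSpace ℝ (MultiIndex d s) :=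
  WithLp.toLp 2 fun k => itoIntegral 𝓕 P B T (fun u ω' => localMonomial h p k (X u ω')) t ω

/-- The random vectors
`η_{mj} = T^{-1/2} η̂_{mj}(τ_m) + (𝓙_m - T^{-1} 𝓙̂_m(τ_m))^{1/2} ε_{mj}`, indexed by the grid
points `m` and the coordinates `j`; `μ` is the density that defines `𝓙_m`. -/
def modifiedScore {Ω : Type*} {mΩ : MeasurableSpace Ω} {d : ℕ} (𝓕 : Filtration ℝ≥0 mΩ)
    (P : Measure Ω) (T : ℝ≥0) (s : ℕ) (a h : ℝ) (μ : EuclideanSpace ℝ (Fin d) → ℝ)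
    (W X : ℝ≥0 → Ω → EuclideanSpace ℝ (Fin d))
    (ε : gridPoints d a h × Fin d → Ω → EuclideanSpace ℝ (MultiIndex d s))
    (q : gridPoints d a h × Fin d) (ω : Ω) : EuclideanSpace ℝ (MultiIndex d s) :=
  let J := infoMatrix s h μ q.1
  let Jhat := empInfoMatrix s h X q.1
  let τ := infoTime T J Jhat
  (Real.sqrt T)⁻¹ • scoreProcess 𝓕 P T s h (fun t ω' => W t ω' q.2) X q.1 (τ ω) ω
    + Matrix.toEuclideanCLM (𝕜 := ℝ) (CFC.sqrt (J - (T : ℝ)⁻¹ • Jhat (τ ω) ω)) (ε q ω)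

end

/-! It suffices to compute the joint characteristic function of the whole finite family of vectors
`η_q` and to find that it is the product of those of the laws `N(0, J_m)`; independence and
Gaussianity then follow together (`iIndepFun_and_hasLaw_of_integral_exp`).

Fix test vectors `y`. The exponent is `N + ⟨D, v⟩`. Here `N` is a linear combination of Itô
integrals stopped at the times `τ_m`, `D` is the vector of all `ε`, and `v` has the blocks `(J_m -
T⁻¹ Ĵ_m(τ_m))^{1/2} y_{mj}`. Let `Q` be the bracket of `N`. Three facts give the result.

(1) `E exp(iN + Q/2) = 1`, the exponential martingale identity. It is proved for step integrands on
a time grid by conditioning on one cell at a time, and passes to the limit because the brackets are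
bounded.

(2) `D` is standard Gaussian and independent of `σ(X)`. Since `W_t = X_t - X_0 - ∫ b(X)` almost
surely, `N` is an almost sure limit of versions of `σ(X)`-measurable variables, so integrating `D`
out replaces `exp(i⟨D, v⟩)` by `exp(-‖v‖²/2)`.

(3) `Q + ‖v‖²` is a constant `c`. Cross brackets vanish, between different `j` because the
components of `W` are independent and between different cubes because the cubes are disjoint. What
remains of `Q` is `T⁻¹ ∑ yᵀ Ĵ_m(τ_m) y`, and `‖v‖²` completes it to `∑ yᵀ J_m y`. This needs `J_m -
T⁻¹ Ĵ_m(τ_m)` to be positive semidefinite, which is what the stopping rule ensures: by continuity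
the normalised norm is at most `T` at time `τ_m`.

Hence `E exp(iN + i⟨D, v⟩) = E exp(iN - ‖v‖²/2) = exp(-c/2) E exp(iN + Q/2) = exp(-c/2)`.

The remaining work concerns `itoIntegral`, which is defined by choice and evaluated at random times.
The Itô isometry and Doob's inequality show that elementary integrals of integrands converging at
rate `8^{-r}` converge uniformly on `[0, T]`, almost surely, to any version
(`tendstoUniformlyOn_itoIntegral`). One null set then serves all times, so random times can be
inserted. -/

/-- A real Brownian motion relative to a filtration. -/
structure IsFilteredBrownianReal {Ω : Type*} {mΩ : MeasurableSpace Ω} (𝓕 : Filtration ℝ≥0 mΩ)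
    (P : Measure Ω) (B : ℝ≥0 → Ω → ℝ) : Prop where
  adapted : ∀ t, Measurable[𝓕 t] (B t)
  isBrownian : IsBrownianReal B P
  indep_increments : ∀ s t, s ≤ t →
    Indep (MeasurableSpace.comap (fun ω => B t ω - B s ω) inferInstance) (𝓕 s) P

/-! ### Moments of Brownian increments weighted by the past. -/

namespace IsFilteredBrownianReal

variable {Ω : Type*} {mΩ : MeasurableSpace Ω} {𝓕 : Filtration ℝ≥0 mΩ} {P : Measure Ω}
  {B : ℝ≥0 → Ω → ℝ}

lemma measurable (hB : IsFilteredBrownianReal 𝓕 P B) (t : ℝ≥0) : Measurable (B t) :=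
  (hB.adapted t).mono (𝓕.le t) le_rfl

lemma measurable_sub (hB : IsFilteredBrownianReal 𝓕 P B) (s t : ℝ≥0) :
    Measurable (fun ω => B t ω - B s ω) := (hB.measurable t).sub (hB.measurable s)

lemma hasLaw_sub (hB : IsFilteredBrownianReal 𝓕 P B) (s t : ℝ≥0) :
    HasLaw (fun ω => B t ω - B s ω) (gaussianReal 0 (nndist t.1 s.1)) P :=
  hB.isBrownian.toIsPreBrownianReal.hasLaw_sub t s

lemma memLp_sub (hB : IsFilteredBrownianReal 𝓕 P B) (s t : ℝ≥0) :
    MemLp (fun ω => B t ω - B s ω) 2 P :=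
  (hB.hasLaw_sub s t).hasGaussianLaw.memLp_two

lemma integral_sub (hB : IsFilteredBrownianReal 𝓕 P B) (s t : ℝ≥0) :
    ∫ ω, (B t ω - B s ω) ∂P = 0 := by
  rw [(hB.hasLaw_sub s t).integral_eq]; simp

lemma integral_sub_sq [IsProbabilityMeasure P] (hB : IsFilteredBrownianReal 𝓕 P B) {s t : ℝ≥0}
    (hst : s ≤ t) :
    ∫ ω, (B t ω - B s ω) ^ 2 ∂P = t - s := by
  have h := (hB.hasLaw_sub s t).variance_eq
  rw [variance_id_gaussianReal, variance_of_integral_eq_zero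
    (hB.measurable_sub s t).aemeasurable (hB.integral_sub s t)] at h
  rw [h]
  have : (s : ℝ) ≤ t := by exact_mod_cast hst
  simp [Real.dist_eq, abs_of_nonneg (sub_nonneg.2 this)]

lemma indepFun_sub {β : Type*} [MeasurableSpace β] (hB : IsFilteredBrownianReal 𝓕 P B)
    {s t : ℝ≥0} (hst : s ≤ t) {Z : Ω → β} (hZ : Measurable[𝓕 s] Z) :
    IndepFun Z (fun ω => B t ω - B s ω) P := by
  rw [IndepFun_iff_Indep]
  exact indep_of_indep_of_le_left (hB.indep_increments s t hst).symm hZ.comap_le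

lemma integral_mul_sub (hB : IsFilteredBrownianReal 𝓕 P B) {s t : ℝ≥0} (hst : s ≤ t)
    {Z : Ω → ℝ} (hZ : Measurable[𝓕 s] Z) : ∫ ω, Z ω * (B t ω - B s ω) ∂P = 0 := by
  rw [(hB.indepFun_sub hst hZ).integral_fun_mul_eq_mul_integral
    (hZ.mono (𝓕.le s) le_rfl).aestronglyMeasurable (hB.measurable_sub s t).aestronglyMeasurable,
    hB.integral_sub, mul_zero]

lemma integral_mul_sub_sq [IsProbabilityMeasure P] (hB : IsFilteredBrownianReal 𝓕 P B) {s t : ℝ≥0}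
    (hst : s ≤ t) {Z : Ω → ℝ} (hZ : Measurable[𝓕 s] Z) :
    ∫ ω, Z ω * (B t ω - B s ω) ^ 2 ∂P = (∫ ω, Z ω ∂P) * (t - s) := by
  have h := (hB.indepFun_sub hst hZ).comp measurable_id (measurable_id.pow_const 2)
  have h2 := h.integral_fun_mul_eq_mul_integral
    (hZ.mono (𝓕.le s) le_rfl).aestronglyMeasurable
    ((hB.measurable_sub s t).pow_const 2).aestronglyMeasurable
  simp only [Function.comp_def, id] at h2
  rw [h2, hB.integral_sub_sq hst]

lemma integrable_mul_sub_mul_sub (hB : IsFilteredBrownianReal 𝓕 P B)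
    {Z : Ω → ℝ} (hZ : Measurable Z) {C : ℝ} (hC : ∀ ω, |Z ω| ≤ C) (s t u v : ℝ≥0) :
    Integrable (fun ω => Z ω * ((B t ω - B s ω) * (B v ω - B u ω))) P :=
  ((hB.memLp_sub s t).integrable_mul (hB.memLp_sub u v)).bdd_mul hZ.aestronglyMeasurable
    (ae_of_all _ hC)

/-- The longer increment is cut at the end of the shorter one. The overhang is centred and
independent of everything before it, so only the square over the common interval contributes. -/
lemma integral_mul_sub_mul_sub_of_common [IsProbabilityMeasure P]
    (hB : IsFilteredBrownianReal 𝓕 P B) {u r r' : ℝ≥0} (hr : u ≤ r) (hr' : u ≤ r')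
    {Z : Ω → ℝ} (hZ : Measurable[𝓕 u] Z) {C : ℝ} (hC : ∀ ω, |Z ω| ≤ C) :
    ∫ ω, Z ω * ((B r ω - B u ω) * (B r' ω - B u ω)) ∂P
      = (∫ ω, Z ω ∂P) * (min (r : ℝ) r' - u) := by
  wlog h : r ≤ r' generalizing r r'
  · rw [min_comm, ← this hr' hr (le_of_not_ge h)]
    simp_rw [mul_comm (B r _ - _)]
  have hZ' := hZ.mono (𝓕.le u) le_rfl
  have e : ∀ ω, Z ω * ((B r ω - B u ω) * (B r' ω - B u ω))
      = Z ω * ((B r ω - B u ω) * (B r ω - B u ω))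
        + Z ω * ((B r ω - B u ω) * (B r' ω - B r ω)) := fun ω => by ring
  simp_rw [e]
  rw [MeasureTheory.integral_add (hB.integrable_mul_sub_mul_sub hZ' hC _ _ _ _)
    (hB.integrable_mul_sub_mul_sub hZ' hC _ _ _ _)]
  simp_rw [← mul_assoc (Z _) (B r _ - B u _) (B r' _ - B r _)]
  rw [hB.integral_mul_sub h (Z := fun ω => Z ω * (B r ω - B u ω))
    ((hZ.mono (𝓕.mono hr) le_rfl).mul ((hB.adapted r).sub ((hB.adapted u).mono (𝓕.mono hr) le_rfl))),
    add_zero, min_eq_left (by exact_mod_cast h), ← hB.integral_mul_sub_sq hr hZ]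
  simp_rw [sq]

/-- Covariance of two elementary increments. -/
lemma integral_mul_sub_mul_mul_sub [IsProbabilityMeasure P]
    (hB : IsFilteredBrownianReal 𝓕 P B) {l r l' r' : ℝ≥0} (hr : l ≤ r) (hr' : l' ≤ r')
    {Z Z' : Ω → ℝ} (hZ : Measurable[𝓕 l] Z) (hZ' : Measurable[𝓕 l'] Z')
    {C C' : ℝ} (hC : ∀ ω, |Z ω| ≤ C) (hC' : ∀ ω, |Z' ω| ≤ C') :
    ∫ ω, (Z ω * (B r ω - B l ω)) * (Z' ω * (B r' ω - B l' ω)) ∂P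
      = (∫ ω, Z ω * Z' ω ∂P) * max 0 (min (r : ℝ) r' - max (l : ℝ) l') := by
  wlog h : l ≤ l' generalizing l r l' r' Z Z' C C'
  · have := this hr' hr hZ' hZ hC' hC (le_of_not_ge h)
    rw [min_comm, max_comm (l : ℝ)]
    simp_rw [mul_comm (Z _ * (_ - _)), mul_comm (Z _) (Z' _)]
    exact this
  have mZ : Measurable[𝓕 l'] Z := hZ.mono (𝓕.mono h) le_rfl
  have mZZ : Measurable[𝓕 l'] (fun ω => Z ω * Z' ω) := mZ.mul hZ'
  have bZZ : ∀ ω, |Z ω * Z' ω| ≤ C * C' := fun ω => by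
    rw [abs_mul]; exact mul_le_mul (hC ω) (hC' ω) (abs_nonneg _) ((abs_nonneg _).trans (hC ω))
  have mZZ' := mZZ.mono (𝓕.le l') le_rfl
  have hl : (l : ℝ) ≤ l' := by exact_mod_cast h
  rw [max_eq_right hl]
  rcases le_total r l' with h1 | h1
  · have : max 0 (min (r : ℝ) r' - l') = 0 := by
      have : (r : ℝ) ≤ l' := by exact_mod_cast h1
      exact max_eq_left (by linarith [min_le_left (r : ℝ) r'])
    rw [this, mul_zero, ← hB.integral_mul_sub hr'
      (Z := fun ω => Z ω * Z' ω * (B r ω - B l ω))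
      (mZZ.mul (((hB.adapted r).mono (𝓕.mono h1) le_rfl).sub
        ((hB.adapted l).mono (𝓕.mono h) le_rfl)))]
    congr 1; ext ω; ring
  -- The first increment is cut at `l'`: its part before `l'` belongs to the past of the second
  -- increment and contributes zero, and its part after `l'` starts at the common point `l'`.
  · have e : ∀ ω, (Z ω * (B r ω - B l ω)) * (Z' ω * (B r' ω - B l' ω))
        = Z ω * Z' ω * ((B l' ω - B l ω) * (B r' ω - B l' ω))
        + Z ω * Z' ω * ((B r ω - B l' ω) * (B r' ω - B l' ω)) := fun ω => by ring
    simp_rw [e]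
    rw [MeasureTheory.integral_add (hB.integrable_mul_sub_mul_sub mZZ' bZZ _ _ _ _)
      (hB.integrable_mul_sub_mul_sub mZZ' bZZ _ _ _ _),
      hB.integral_mul_sub_mul_sub_of_common h1 hr' mZZ bZZ]
    simp_rw [← mul_assoc (Z _ * Z' _) (B l' _ - B l _)]
    rw [hB.integral_mul_sub hr' (Z := fun ω => Z ω * Z' ω * (B l' ω - B l ω))
      (mZZ.mul ((hB.adapted l').sub ((hB.adapted l).mono (𝓕.mono h) le_rfl))), zero_add,
      max_eq_right]
    have h1' : (l' : ℝ) ≤ r := by exact_mod_cast h1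
    have h2' : (l' : ℝ) ≤ r' := by exact_mod_cast hr'
    linarith [le_min h1' h2']

end IsFilteredBrownianReal

/-! ### Elementary stochastic integrals. -/

noncomputable section

/-- The measure `dt` on `[0, T]`. -/
abbrev timeMeasure (T : ℝ≥0) : Measure ℝ := volume.restrict (Set.Icc (0 : ℝ) T)

lemma MeasureTheory.MemLp.bounded_mul {α : Type*} {mα : MeasurableSpace α} {μ : Measure α}
    {f g : α → ℝ} {p : ℝ≥0∞} (hf : MemLp f p μ) (hg : AEStronglyMeasurable g μ) {C : ℝ}
    (hC : ∀ x, |g x| ≤ C) : MemLp (fun x => g x * f x) p μ :=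
  hf.mul' (memLp_top_of_bound hg C (ae_of_all _ hC))

namespace ElementaryProcess

variable {Ω : Type*} {mΩ : MeasurableSpace Ω} {𝓕 : Filtration ℝ≥0 mΩ} {P : Measure Ω}
  {B : ℝ≥0 → Ω → ℝ}

/-- The difference of two elementary processes. -/
def sub (S S' : ElementaryProcess 𝓕) : ElementaryProcess 𝓕 where
  n := S.n + S'.n
  left := Fin.append S.left S'.left
  right := Fin.append S.right S'.right
  left_le_right i := by
    induction i using Fin.addCases with
    | left i => simpa using S.left_le_right i
    | right i => simpa using S'.left_le_right i
  coeff := Fin.append S.coeff (fun i ω => -S'.coeff i ω)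
  measurable_coeff i := by
    induction i using Fin.addCases with
    | left i => rw [Fin.append_left, Fin.append_left]; exact S.measurable_coeff i
    | right i => rw [Fin.append_right, Fin.append_right]; exact (S'.measurable_coeff i).neg
  bounded_coeff := by
    obtain ⟨C, hC⟩ := S.bounded_coeff
    obtain ⟨C', hC'⟩ := S'.bounded_coeff
    refine ⟨max C C', fun i ω => ?_⟩
    induction i using Fin.addCases with
    | left i => simpa using Or.inl (hC i ω)
    | right i => simpa using Or.inr (hC' i ω)

lemma value_sub (S S' : ElementaryProcess 𝓕) (t : ℝ≥0) (ω : Ω) :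
    (S.sub S').value t ω = S.value t ω - S'.value t ω := by
  have h : ∀ (s : Set ℝ≥0) (c : ℝ), s.indicator (fun _ => -c) t = -s.indicator (fun _ => c) t :=
    fun s c => congrFun (Set.indicator_neg s (fun _ => c)) t
  refine (Fin.sum_univ_add _).trans ?_
  simp [value, sub, sub_eq_add_neg, h]

lemma integral_sub (S S' : ElementaryProcess 𝓕) (t : ℝ≥0) (ω : Ω) :
    (S.sub S').integral B t ω = S.integral B t ω - S'.integral B t ω := by
  refine (Fin.sum_univ_add _).trans ?_
  simp [integral, sub, sub_eq_add_neg]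

lemma measurable_value (S : ElementaryProcess 𝓕) :
    Measurable (fun z : Ω × ℝ => S.value z.2.toNNReal z.1) := by
  unfold value
  refine Finset.measurable_sum _ fun i _ => ?_
  have : (fun z : Ω × ℝ => (Set.Ioc (S.left i) (S.right i)).indicator
      (fun _ => S.coeff i z.1) z.2.toNNReal)
      = ((fun z : Ω × ℝ => z.2.toNNReal) ⁻¹' (Set.Ioc (S.left i) (S.right i))).indicator
        (fun z => S.coeff i z.1) := by
    ext z; simp [Set.indicator]
  rw [this]
  exact (((S.measurable_coeff i).mono (𝓕.le _) le_rfl).comp measurable_fst).indicator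
    ((measurable_real_toNNReal.comp measurable_snd) measurableSet_Ioc)

lemma measurable_integral (S : ElementaryProcess 𝓕) (hB : IsFilteredBrownianReal 𝓕 P B)
    (t : ℝ≥0) : Measurable[𝓕 t] (S.integral B t) := by
  unfold integral
  refine Finset.measurable_sum _ fun i _ => ?_
  rcases le_total (S.left i) t with h | h
  · exact ((S.measurable_coeff i).mono (𝓕.mono h) le_rfl).mul
      (((hB.adapted _).mono (𝓕.mono (min_le_right _ _)) le_rfl).sub
        ((hB.adapted _).mono (𝓕.mono (min_le_right _ _)) le_rfl))
  · have : (fun ω => S.coeff i ω * (B (min (S.right i) t) ω - B (min (S.left i) t) ω))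
        = fun _ => 0 := by
      ext ω; rw [min_eq_right h, min_eq_right (h.trans (S.left_le_right i))]; simp
    rw [this]; exact measurable_const

lemma memLp_integral (S : ElementaryProcess 𝓕) (hB : IsFilteredBrownianReal 𝓕 P B)
    (t : ℝ≥0) : MemLp (S.integral B t) 2 P := by
  obtain ⟨C, hC⟩ := S.bounded_coeff
  have : S.integral B t = ∑ i, fun ω => S.coeff i ω *
      (B (min (S.right i) t) ω - B (min (S.left i) t) ω) := by
    ext ω; simp [integral]
  rw [this]
  refine memLp_finsetSum' _ fun i _ => ?_
  exact (hB.memLp_sub _ _).bounded_mul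
    ((S.measurable_coeff i).mono (𝓕.le _) le_rfl).aestronglyMeasurable (hC i)

lemma ae_continuous_integral (S : ElementaryProcess 𝓕) (hB : IsFilteredBrownianReal 𝓕 P B) :
    ∀ᵐ ω ∂P, Continuous (fun t => S.integral B t ω) := by
  filter_upwards [hB.isBrownian.cont] with ω hω
  unfold integral
  fun_prop

/-- The elementary integral is a martingale. -/
lemma integral_mul_integral_sub [IsProbabilityMeasure P] (S : ElementaryProcess 𝓕)
    (hB : IsFilteredBrownianReal 𝓕 P B)
    {s t : ℝ≥0} (hst : s ≤ t) {Z : Ω → ℝ} (hZ : Measurable[𝓕 s] Z) (hZ2 : MemLp Z 2 P) :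
    ∫ ω, Z ω * (S.integral B t ω - S.integral B s ω) ∂P = 0 := by
  obtain ⟨C, hC⟩ := S.bounded_coeff
  -- Restricting the integral to `(s, t]` clamps the end points of every cell to `[s, t]`. Each
  -- clamped cell starts no earlier than `s` and, unless it is empty, no earlier than `left i`, so
  -- `Z * coeff i` is known at its start.
  have e : ∀ ω, Z ω * (S.integral B t ω - S.integral B s ω) = ∑ i, (Z ω * S.coeff i ω) *
      (B (min (max (S.right i) s) t) ω - B (min (max (S.left i) s) t) ω) := by
    intro ω
    simp only [integral, ← Finset.sum_sub_distrib, Finset.mul_sum]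
    refine Finset.sum_congr rfl fun i _ => ?_
    have h := S.left_le_right i
    rcases le_total (S.right i) s with h1 | h1
    · have h2 := h.trans h1
      simp [h1, h2, h1.trans hst, h2.trans hst, hst]
    · rcases le_total (S.left i) s with h2 | h2
      · simp [h1, h2, hst, h2.trans hst]; ring
      · simp [h1, h2]; ring
  simp_rw [e]
  have mZ := hZ.mono (𝓕.le s) le_rfl
  have mc := fun i => (S.measurable_coeff i).mono (𝓕.le _) le_rfl
  rw [integral_finsetSum]
  · refine Finset.sum_eq_zero fun i _ => ?_
    rcases le_total (max (S.left i) s) t with h | h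
    · rw [min_eq_left h]
      refine hB.integral_mul_sub ?_ ?_
      · exact le_min (max_le_max_right _ (S.left_le_right i)) h
      · exact (hZ.mono (𝓕.mono (le_max_right _ _)) le_rfl).mul
          ((S.measurable_coeff i).mono (𝓕.mono (le_max_left _ _)) le_rfl)
    · have h2 : t ≤ max (S.right i) s := h.trans (max_le_max_right _ (S.left_le_right i))
      simp [min_eq_right h, min_eq_right h2]
  · intro i _
    refine MemLp.integrable_mul (p := 2) (q := 2) ?_ (hB.memLp_sub _ _)
    simpa only [mul_comm] using hZ2.bounded_mul (mc i).aestronglyMeasurable (hC i)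

end ElementaryProcess

/-! ### The Itô isometry. -/

namespace IsFilteredBrownianReal

variable {Ω : Type*} {mΩ : MeasurableSpace Ω} {𝓕 : Filtration ℝ≥0 mΩ} {P : Measure Ω}
  {B : ℝ≥0 → Ω → ℝ}

/-- The overlap length is the same factor as in `integral_mul_sub_mul_mul_sub`; this coincidence is
the Itô isometry, term by term. -/
lemma integral_indicator_Ioc_mul (l r l' r' : ℝ) (c c' : ℝ) :
    ∫ s : ℝ, (Set.Ioc l r).indicator (fun _ => c) s * (Set.Ioc l' r').indicator (fun _ => c') s
      = c * c' * max 0 (min r r' - max l l') := by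
  have : ∀ s : ℝ, (Set.Ioc l r).indicator (fun _ => c) s * (Set.Ioc l' r').indicator (fun _ => c') s
      = (Set.Ioc (max l l') (min r r')).indicator (fun _ => c * c') s := by
    intro s
    rw [← Set.Ioc_inter_Ioc, Set.inter_indicator_mul]
  simp_rw [this]
  rw [MeasureTheory.integral_indicator measurableSet_Ioc]
  simp [Measure.real, mul_comm, ENNReal.toReal_ofReal', max_comm]

lemma integrable_indicator_Ioc (l r c : ℝ) : Integrable ((Set.Ioc l r).indicator (fun _ => c)) :=
  (integrable_indicator_iff measurableSet_Ioc).2 (integrableOn_const (by simp))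

lemma integrable_indicator_Ioc_mul (l r l' r' : ℝ) (c c' : ℝ) :
    Integrable (fun s : ℝ => (Set.Ioc l r).indicator (fun _ => c) s *
      (Set.Ioc l' r').indicator (fun _ => c') s) := by
  refine (integrable_indicator_Ioc l' r' c').bdd_mul (c := |c|)
    (measurable_const.indicator measurableSet_Ioc).aestronglyMeasurable (ae_of_all _ fun s => ?_)
  by_cases h : s ∈ Set.Ioc l r <;> simp [h]

/-- The Itô isometry for sums of increments, in `lintegral` form. -/
lemma lintegral_sum_sq [IsProbabilityMeasure P] (hB : IsFilteredBrownianReal 𝓕 P B) {n : ℕ}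
    (l r : Fin n → ℝ≥0) (hlr : ∀ i, l i ≤ r i) (ξ : Fin n → Ω → ℝ)
    (hξ : ∀ i, Measurable[𝓕 (l i)] (ξ i)) {C : ℝ} (hC : ∀ i ω, |ξ i ω| ≤ C) :
    ∫⁻ ω, ‖∑ i, ξ i ω * (B (r i) ω - B (l i) ω)‖ₑ ^ 2 ∂P
      = ∫⁻ ω, (∫⁻ s : ℝ, ‖∑ i, (Set.Ioc (l i : ℝ) (r i)).indicator (fun _ => ξ i ω) s‖ₑ ^ 2) ∂P := by
  have e : ∀ x : ℝ, ‖x‖ₑ ^ 2 = ENNReal.ofReal (x * x) := fun x => by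
    rw [← enorm_pow, Real.enorm_eq_ofReal (sq_nonneg x), sq]
  simp_rw [e]
  have mξ := fun i => (hξ i).mono (𝓕.le _) le_rfl
  have hp : ∀ i j, Integrable (fun ω => ξ i ω * (B (r i) ω - B (l i) ω) *
      (ξ j ω * (B (r j) ω - B (l j) ω))) P := fun i j =>
    MemLp.integrable_mul (p := 2) (q := 2)
      ((hB.memLp_sub _ _).bounded_mul (mξ i).aestronglyMeasurable (hC i))
      ((hB.memLp_sub _ _).bounded_mul (mξ j).aestronglyMeasurable (hC j))
  have hq : ∀ i j, Integrable (fun ω => ξ i ω * ξ j ω) P := fun i j =>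
    (Integrable.of_bound (mξ j).aestronglyMeasurable C (ae_of_all _ (hC j))).bdd_mul (c := C)
      (mξ i).aestronglyMeasurable (ae_of_all _ (hC i))
  simp_rw [Finset.sum_mul_sum]
  have inner : ∀ ω, ∫⁻ s : ℝ, ENNReal.ofReal (∑ i, ∑ j,
      (Set.Ioc (l i : ℝ) (r i)).indicator (fun _ => ξ i ω) s *
      (Set.Ioc (l j : ℝ) (r j)).indicator (fun _ => ξ j ω) s)
      = ENNReal.ofReal (∑ i, ∑ j, ξ i ω * ξ j ω *
        max 0 (min (r i : ℝ) (r j) - max (l i : ℝ) (l j))) := by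
    intro ω
    rw [← ofReal_integral_eq_lintegral_ofReal]
    · rw [integral_finsetSum _ fun i _ => integrable_finsetSum _ fun j _ =>
        integrable_indicator_Ioc_mul _ _ _ _ _ _]
      congr 1
      refine Finset.sum_congr rfl fun i _ => ?_
      rw [integral_finsetSum _ fun j _ => integrable_indicator_Ioc_mul _ _ _ _ _ _]
      exact Finset.sum_congr rfl fun j _ => integral_indicator_Ioc_mul _ _ _ _ _ _
    · exact integrable_finsetSum _ fun i _ => integrable_finsetSum _ fun j _ =>
        integrable_indicator_Ioc_mul _ _ _ _ _ _
    · refine ae_of_all _ fun s => ?_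
      simp only [← Finset.sum_mul_sum]
      exact mul_self_nonneg _
  -- Single terms can be negative; the double sum is the time integral of a square. Nonnegativity is
  -- needed to pass from `lintegral` to Bochner integrals.
  have key : ∀ ω, 0 ≤ ∑ i, ∑ j, ξ i ω * ξ j ω *
      max 0 (min (r i : ℝ) (r j) - max (l i : ℝ) (l j)) := by
    intro ω
    have : ∑ i, ∑ j, ξ i ω * ξ j ω * max 0 (min (r i : ℝ) (r j) - max (l i : ℝ) (l j))
        = ∫ s : ℝ, (∑ i, (Set.Ioc (l i : ℝ) (r i)).indicator (fun _ => ξ i ω) s) *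
          (∑ i, (Set.Ioc (l i : ℝ) (r i)).indicator (fun _ => ξ i ω) s) := by
      simp_rw [Finset.sum_mul_sum]
      rw [integral_finsetSum _ fun i _ => integrable_finsetSum _ fun j _ =>
        integrable_indicator_Ioc_mul _ _ _ _ _ _]
      refine Finset.sum_congr rfl fun i _ => ?_
      rw [integral_finsetSum _ fun j _ => integrable_indicator_Ioc_mul _ _ _ _ _ _]
      exact Finset.sum_congr rfl fun j _ => (integral_indicator_Ioc_mul _ _ _ _ _ _).symm
    rw [this]
    exact integral_nonneg fun s => mul_self_nonneg _
  simp_rw [inner]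
  rw [← ofReal_integral_eq_lintegral_ofReal, ← ofReal_integral_eq_lintegral_ofReal]
  · congr 1
    rw [integral_finsetSum _ fun i _ => integrable_finsetSum _ fun j _ => hp i j,
      integral_finsetSum _ fun i _ => integrable_finsetSum _ fun j _ => (hq i j).mul_const _]
    refine Finset.sum_congr rfl fun i _ => ?_
    rw [integral_finsetSum _ fun j _ => hp i j,
      integral_finsetSum _ fun j _ => (hq i j).mul_const _]
    refine Finset.sum_congr rfl fun j _ => ?_
    rw [integral_mul_const]
    exact hB.integral_mul_sub_mul_mul_sub (hlr i) (hlr j) (hξ i) (hξ j) (hC i) (hC j)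
  · exact integrable_finsetSum _ fun i _ => integrable_finsetSum _ fun j _ => (hq i j).mul_const _
  · exact ae_of_all _ key
  · exact integrable_finsetSum _ fun i _ => integrable_finsetSum _ fun j _ => hp i j
  · refine ae_of_all _ fun s => ?_
    simp only [← Finset.sum_mul_sum]
    exact mul_self_nonneg _

end IsFilteredBrownianReal

lemma eLpNorm_two_sq {α : Type*} {mα : MeasurableSpace α} {μ : Measure α} (f : α → ℝ) :
    eLpNorm f 2 μ ^ 2 = ∫⁻ x, ‖f x‖ₑ ^ 2 ∂μ := by
  rw [eLpNorm_eq_lintegral_rpow_enorm_toReal (by simp) (by simp), ← ENNReal.rpow_natCast,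
    ← ENNReal.rpow_mul]
  simp

lemma eLpNorm_two_prod_sq {Ω : Type*} {mΩ : MeasurableSpace Ω} {P : Measure Ω} [SFinite P] {T : ℝ≥0}
    {F : Ω × ℝ → ℝ} (hF : AEMeasurable F (P.prod (timeMeasure T))) :
    eLpNorm F 2 (P.prod (timeMeasure T)) ^ 2
      = ∫⁻ ω, (∫⁻ s in Set.Icc (0 : ℝ) T, ‖F (ω, s)‖ₑ ^ 2) ∂P := by
  rw [eLpNorm_two_sq, lintegral_prod _ (hF.enorm.pow_const 2)]

namespace ElementaryProcess

variable {Ω : Type*} {mΩ : MeasurableSpace Ω} {𝓕 : Filtration ℝ≥0 mΩ} {P : Measure Ω}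
  {B : ℝ≥0 → Ω → ℝ}

/-- The `L²` contraction property of the elementary integral. -/
lemma eLpNorm_integral_le [IsProbabilityMeasure P] (S : ElementaryProcess 𝓕)
    (hB : IsFilteredBrownianReal 𝓕 P B) {t T : ℝ≥0} (ht : t ≤ T) :
    eLpNorm (S.integral B t) 2 P
      ≤ eLpNorm (fun z : Ω × ℝ => S.value z.2.toNNReal z.1) 2 (P.prod (timeMeasure T)) := by
  classical
  rw [← ENNReal.pow_le_pow_left_iff (n := 2) (by norm_num), eLpNorm_two_sq,
    eLpNorm_two_prod_sq S.measurable_value.aemeasurable]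
  obtain ⟨C, hC⟩ := S.bounded_coeff
  -- A cell starting after `t` contributes nothing, but its coefficient need not be measurable at
  -- the clamped left end `min (left i) t`. Replacing it by zero restores the measurability that the
  -- isometry requires.
  have h1 : ∀ ω, S.integral B t ω = ∑ i, (if S.left i ≤ t then S.coeff i ω else 0) *
      (B (min (S.right i) t) ω - B (min (S.left i) t) ω) := by
    intro ω
    refine Finset.sum_congr rfl fun i _ => ?_
    split_ifs with h
    · rfl
    · have h := (not_le.1 h).le
      rw [min_eq_right h, min_eq_right (h.trans (S.left_le_right i))]; simp
  simp_rw [h1]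
  rw [hB.lintegral_sum_sq (fun i => min (S.left i) t) (fun i => min (S.right i) t)
    (fun i => min_le_min_right _ (S.left_le_right i))
    (fun i ω => if S.left i ≤ t then S.coeff i ω else 0) (C := C)]
  · refine lintegral_mono fun ω => ?_
    rw [← lintegral_indicator measurableSet_Icc]
    refine lintegral_mono fun s => ?_
    by_cases hs : 0 < s ∧ s ≤ t
    · have hsT : s ∈ Set.Icc (0 : ℝ) T := ⟨hs.1.le, hs.2.trans (by exact_mod_cast ht)⟩
      rw [Set.indicator_of_mem hsT]
      apply le_of_eq
      congr 2
      refine Finset.sum_congr rfl fun i _ => ?_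
      lift s to ℝ≥0 using hs.1.le
      have hst : s ≤ t := by exact_mod_cast hs.2
      have : ((s : ℝ) ∈ Set.Ioc (((min (S.left i) t : ℝ≥0)) : ℝ) ((min (S.right i) t : ℝ≥0) : ℝ))
          ↔ s ∈ Set.Ioc (S.left i) (S.right i) := by
        simp only [Set.mem_Ioc, NNReal.coe_lt_coe, NNReal.coe_le_coe]
        constructor
        · rintro ⟨ha, hb⟩
          refine ⟨?_, hb.trans (min_le_left _ _)⟩
          by_contra hcon
          exact absurd ha (not_lt.2 (le_min (not_lt.1 hcon) hst))
        · rintro ⟨ha, hb⟩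
          exact ⟨(min_le_left _ _).trans_lt ha, le_min hb hst⟩
      by_cases hm : s ∈ Set.Ioc (S.left i) (S.right i)
      · rw [Set.indicator_of_mem (this.2 hm), Real.toNNReal_coe, Set.indicator_of_mem hm,
          if_pos (hm.1.le.trans hst)]
      · rw [Set.indicator_of_notMem (fun h => hm (this.1 h)), Real.toNNReal_coe,
          Set.indicator_of_notMem hm]
    · have : ∑ i, (Set.Ioc (((min (S.left i) t : ℝ≥0)) : ℝ)
          ((min (S.right i) t : ℝ≥0) : ℝ)).indicator
          (fun _ => if S.left i ≤ t then S.coeff i ω else 0) s = 0 := by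
        refine Finset.sum_eq_zero fun i _ => Set.indicator_of_notMem (fun h => hs ⟨?_, ?_⟩) _
        · exact lt_of_le_of_lt (NNReal.coe_nonneg _) h.1
        · exact h.2.trans (by exact_mod_cast min_le_right _ _)
      simp only [this]
      simp
  · intro i
    split_ifs with h
    · rw [min_eq_left h]; exact S.measurable_coeff i
    · exact measurable_const
  · intro i ω
    split_ifs
    · exact hC i ω
    · simpa using (abs_nonneg _).trans (hC i ω)

lemma eLpNorm_integral_sub_le [IsProbabilityMeasure P] (S S' : ElementaryProcess 𝓕)
    (hB : IsFilteredBrownianReal 𝓕 P B) {t T : ℝ≥0} (ht : t ≤ T) :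
    eLpNorm (fun ω => S.integral B t ω - S'.integral B t ω) 2 P
      ≤ eLpNorm (fun z : Ω × ℝ => S.value z.2.toNNReal z.1 - S'.value z.2.toNNReal z.1) 2
        (P.prod (timeMeasure T)) := by
  have := (S.sub S').eLpNorm_integral_le hB ht
  simp_rw [value_sub] at this
  convert this using 2
  ext ω; exact (integral_sub S S' t ω).symm

end ElementaryProcess

end

/-! ### Uniform time grids and Doob's maximal inequality. -/

noncomputable section

/-- The `i`-th point `T i / n` of the uniform grid with `n` cells on `[0, T]`. -/
def gridTime (T : ℝ≥0) (n i : ℕ) : ℝ≥0 := T * i / n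

lemma gridTime_mono (T : ℝ≥0) (n : ℕ) : Monotone (gridTime T n) := fun i j h => by
  unfold gridTime; gcongr

lemma gridTime_self (T : ℝ≥0) {n : ℕ} (hn : n ≠ 0) : gridTime T n n = T := by
  unfold gridTime; field_simp

lemma gridTime_le (T : ℝ≥0) {n i : ℕ} (hn : n ≠ 0) (hi : i ≤ n) : gridTime T n i ≤ T :=
  (gridTime_mono T n hi).trans_eq (gridTime_self T hn)

lemma gridTime_zero (T : ℝ≥0) (n : ℕ) : gridTime T n 0 = 0 := by simp [gridTime]

lemma gridTime_succ_sub (T : ℝ≥0) (n i : ℕ) :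
    (gridTime T n (i + 1) : ℝ) - gridTime T n i = T / n := by
  simp [gridTime]; ring

lemma exists_mem_Ioc_gridTime {T : ℝ≥0} {n : ℕ} (hn : n ≠ 0) {s : ℝ≥0} (h0 : 0 < s) (hs : s ≤ T) :
    ∃ i : Fin n, s ∈ Set.Ioc (gridTime T n i) (gridTime T n (i + 1)) := by
  have hT : 0 < T := h0.trans_le hs
  have hex : ∃ i : ℕ, s ≤ gridTime T n (i + 1) :=
    ⟨n - 1, by rw [Nat.sub_add_cancel (Nat.one_le_iff_ne_zero.2 hn), gridTime_self T hn]; exact hs⟩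
  classical
  have hspec := Nat.find_spec hex
  have hlt : gridTime T n (Nat.find hex) < s := by
    rcases h : Nat.find hex with _ | k
    · rwa [gridTime_zero]
    · exact not_le.1 (Nat.find_min hex (by omega : k < Nat.find hex))
  refine ⟨⟨Nat.find hex, ?_⟩, hlt, hspec⟩
  by_contra hcon
  have := gridTime_mono T n (not_lt.1 hcon)
  rw [gridTime_self T hn] at this
  exact absurd (hlt.trans_le hs) (not_lt.2 this)

namespace ElementaryProcess

variable {Ω : Type*} {mΩ : MeasurableSpace Ω} {𝓕 : Filtration ℝ≥0 mΩ} {P : Measure Ω}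
  {B : ℝ≥0 → Ω → ℝ}

/-- A filtration sampled at the points of a uniform grid. -/
def gridFiltration (𝓕 : Filtration ℝ≥0 mΩ) (T : ℝ≥0) (n : ℕ) : Filtration ℕ mΩ where
  seq i := 𝓕 (gridTime T n i)
  mono' _ _ h := 𝓕.mono (gridTime_mono T n h)
  le' _ := 𝓕.le _

/-- With `M` the integral process, `M_t² ≥ M_s² + 2 M_s (M_t - M_s)`, and the cross term integrates
to zero over every event known at time `s` by the martingale property applied to `1_A M_s`. -/
lemma submartingale_integral_sq [IsProbabilityMeasure P] (S : ElementaryProcess 𝓕)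
    (hB : IsFilteredBrownianReal 𝓕 P B) (T : ℝ≥0) (n : ℕ) :
    Submartingale (fun i ω => S.integral B (gridTime T n i) ω ^ 2) (gridFiltration 𝓕 T n) P := by
  refine submartingale_of_setIntegral_le_succ ?_ ?_ ?_
  · exact fun i => ((S.measurable_integral hB _).pow_const 2).stronglyMeasurable
  · exact fun i => (S.memLp_integral hB _).integrable_sq
  · intro i A hA
    have hA' : MeasurableSet[mΩ] A := 𝓕.le _ _ hA
    set s := gridTime T n i
    set t := gridTime T n (i + 1)
    have hst : s ≤ t := gridTime_mono T n (Nat.le_succ i)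
    have hs := S.memLp_integral hB s
    have ht := S.memLp_integral hB t
    have hZ : MemLp (A.indicator (S.integral B s)) 2 P := hs.indicator hA'
    have h0 := S.integral_mul_integral_sub hB hst
      ((S.measurable_integral hB s).indicator hA) hZ
    have e : ∀ ω, A.indicator (S.integral B s) ω * (S.integral B t ω - S.integral B s ω)
        = A.indicator (fun ω => S.integral B s ω * (S.integral B t ω - S.integral B s ω)) ω := by
      intro ω; by_cases h : ω ∈ A <;> simp [h]
    simp_rw [e] at h0
    rw [MeasureTheory.integral_indicator hA'] at h0
    have hi : Integrable (fun ω => S.integral B s ω * (S.integral B t ω - S.integral B s ω)) P :=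
      MemLp.integrable_mul (p := 2) (q := 2) hs (ht.sub hs)
    calc ∫ ω in A, S.integral B s ω ^ 2 ∂P
        = ∫ ω in A, (S.integral B s ω ^ 2
          + 2 * (S.integral B s ω * (S.integral B t ω - S.integral B s ω))) ∂P := by
          rw [MeasureTheory.integral_add hs.integrable_sq.integrableOn (hi.const_mul 2).integrableOn,
            integral_const_mul, h0]; simp
      _ ≤ ∫ ω in A, S.integral B t ω ^ 2 ∂P := by
          refine integral_mono (hs.integrable_sq.add (hi.const_mul 2)).integrableOn
            ht.integrable_sq.integrableOn fun ω => ?_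
          simp only
          nlinarith [sq_nonneg (S.integral B t ω - S.integral B s ω)]

/-- Doob's maximal inequality in discrete time for the nonnegative submartingale of squares; the
last grid point is `T`. -/
lemma measure_exists_grid_le [IsProbabilityMeasure P] (S : ElementaryProcess 𝓕)
    (hB : IsFilteredBrownianReal 𝓕 P B) (T : ℝ≥0) {n : ℕ} (hn : n ≠ 0) (ε : ℝ≥0) :
    (ε : ℝ≥0∞) ^ 2 * P {ω | ∃ i ≤ n, (ε : ℝ) ≤ |S.integral B (gridTime T n i) ω|}
      ≤ eLpNorm (S.integral B T) 2 P ^ 2 := by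
  have h := maximal_ineq (S.submartingale_integral_sq hB T n) (fun i ω => sq_nonneg _)
    (ε := ε ^ 2) n
  have hset : {ω | ∃ i ≤ n, (ε : ℝ) ≤ |S.integral B (gridTime T n i) ω|}
      = {ω | ((ε ^ 2 : ℝ≥0) : ℝ) ≤ (Finset.range (n + 1)).sup' Finset.nonempty_range_add_one
        fun k => S.integral B (gridTime T n k) ω ^ 2} := by
    ext ω
    simp only [Set.mem_ofPred_eq, Finset.le_sup'_iff, Finset.mem_range, Nat.lt_succ_iff]
    refine exists_congr fun i => and_congr_right fun _ => ?_
    rw [NNReal.coe_pow, ← sq_abs (S.integral B _ ω)]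
    exact (pow_le_pow_iff_left₀ ε.coe_nonneg (abs_nonneg _) two_ne_zero).symm
  rw [← hset, gridTime_self T hn] at h
  push_cast at h
  refine h.trans ?_
  rw [eLpNorm_two_sq]
  have e : ∀ x : ℝ, ‖x‖ₑ ^ 2 = ENNReal.ofReal (x ^ 2) := fun x => by
    rw [← enorm_pow, Real.enorm_eq_ofReal (sq_nonneg x)]
  simp_rw [e]
  rw [← ofReal_integral_eq_lintegral_ofReal (S.memLp_integral hB T).integrable_sq
    (ae_of_all _ fun ω => sq_nonneg _)]
  exact ENNReal.ofReal_le_ofReal (setIntegral_le_integral (S.memLp_integral hB T).integrable_sq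
    (ae_of_all _ fun ω => sq_nonneg _))

/-- Dyadic grids are nested, so the exceedance events along them increase and their measures pass to
the limit. -/
lemma gridTime_two_pow_refine (T : ℝ≥0) (k l i : ℕ) :
    gridTime T (2 ^ (k + l)) (i * 2 ^ l) = gridTime T (2 ^ k) i := by
  unfold gridTime
  push_cast
  rw [pow_add]
  field_simp

/-- Doob's maximal inequality for the elementary integral. -/
lemma measure_exists_le [IsProbabilityMeasure P] (S : ElementaryProcess 𝓕)
    (hB : IsFilteredBrownianReal 𝓕 P B) (T : ℝ≥0) (ε : ℝ≥0) :
    (ε : ℝ≥0∞) ^ 2 * P {ω | ∃ t ≤ T, (ε : ℝ) < |S.integral B t ω|}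
      ≤ eLpNorm (S.integral B T) 2 P ^ 2 := by
  set A : ℕ → Set Ω := fun k =>
    {ω | ∃ i ≤ 2 ^ k, (ε : ℝ) ≤ |S.integral B (gridTime T (2 ^ k) i) ω|} with hA
  have hmono : Monotone A := by
    intro k m hkm ω ⟨i, hi, h⟩
    obtain ⟨l, rfl⟩ := Nat.exists_eq_add_of_le hkm
    exact ⟨i * 2 ^ l, by rw [pow_add]; gcongr, by rwa [gridTime_two_pow_refine]⟩
  -- On a continuous path the strict exceedance set is open in time, so it contains a dyadic point
  -- near `t`, namely the rounding of `t` down to the `k`-th grid. This is why the inequality is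
  -- strict here and weak on the grids.
  have hsub : P {ω | ∃ t ≤ T, (ε : ℝ) < |S.integral B t ω|} ≤ P (⋃ k, A k) := by
    refine measure_mono_ae ?_
    filter_upwards [S.ae_continuous_integral hB] with ω hω ⟨t, ht, hε⟩
    have hopen : IsOpen {t | (ε : ℝ) < |S.integral B t ω|} :=
      isOpen_lt continuous_const (by fun_prop)
    rcases eq_or_ne T 0 with rfl | hT
    · obtain rfl : t = 0 := le_antisymm ht zero_le
      exact Set.mem_iUnion.2 ⟨0, 0, by simp, by simpa [gridTime] using hε.le⟩
    have hTR : (0 : ℝ) < T := by exact_mod_cast pos_iff_ne_zero.2 hT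
    have htend : Tendsto (fun k : ℕ => gridTime T (2 ^ k) ⌊(t / T : ℝ) * 2 ^ k⌋₊) atTop (𝓝 t) := by
      rw [← NNReal.tendsto_coe]
      have h2 : Tendsto (fun k : ℕ => (2 : ℝ) ^ k) atTop atTop :=
        tendsto_pow_atTop_atTop_of_one_lt (by norm_num)
      have := (tendsto_nat_floor_mul_div_atTop (R := ℝ) (a := (t / T : ℝ)) (by positivity)).comp h2
      have := this.const_mul (T : ℝ)
      have e : (T : ℝ) * (t / T) = t := by field_simp
      rw [e] at this
      refine this.congr fun k => ?_
      simp [gridTime, mul_div_assoc]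
    obtain ⟨k, hk⟩ := (htend.eventually (hopen.mem_nhds hε)).exists
    refine Set.mem_iUnion.2 ⟨k, _, ?_, hk.le⟩
    have : (⌊(t / T : ℝ) * 2 ^ k⌋₊ : ℝ) ≤ 2 ^ k := by
      refine (Nat.floor_le (by positivity)).trans ?_
      have : (t / T : ℝ) ≤ 1 := (div_le_one hTR).2 (by exact_mod_cast ht)
      nlinarith [pow_pos (two_pos : (0 : ℝ) < 2) k]
    exact_mod_cast this
  calc (ε : ℝ≥0∞) ^ 2 * P {ω | ∃ t ≤ T, (ε : ℝ) < |S.integral B t ω|}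
      ≤ (ε : ℝ≥0∞) ^ 2 * P (⋃ k, A k) := by gcongr
    _ = ⨆ k, (ε : ℝ≥0∞) ^ 2 * P (A k) := by rw [hmono.measure_iUnion, ENNReal.mul_iSup]
    _ ≤ _ := iSup_le fun k => S.measure_exists_grid_le hB T (by positivity) ε

end ElementaryProcess

end

/-! ### Existence, uniqueness and uniform approximation of the Itô integral. -/

noncomputable section

section ItoIntegral

variable {Ω : Type*} {mΩ : MeasurableSpace Ω} {𝓕 : Filtration ℝ≥0 mΩ} {P : Measure Ω}
  {B : ℝ≥0 → Ω → ℝ} {T : ℝ≥0} {H : ℝ≥0 → Ω → ℝ}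

/-- At a fixed time two approximating sequences for the same integrand have asymptotically equal
integrals, by the isometry. Path continuity upgrades equality on a countable dense set of times to
equality on `[0, T]`. This frees later arguments from the version chosen in `itoIntegral`. -/
lemma IsItoIntegral.ae_eqOn [IsProbabilityMeasure P] (hB : IsFilteredBrownianReal 𝓕 P B)
    (hH : AEMeasurable (fun z : Ω × ℝ => H z.2.toNNReal z.1) (P.prod (timeMeasure T)))
    {I I' : ℝ≥0 → Ω → ℝ} (hI : IsItoIntegral 𝓕 P B T H I) (hI' : IsItoIntegral 𝓕 P B T H I') :
    ∀ᵐ ω ∂P, Set.EqOn (fun t => I t ω) (fun t => I' t ω) (Set.Icc 0 T) := by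
  have hpt : ∀ t, t ≤ T → ∀ᵐ ω ∂P, I t ω = I' t ω := by
    intro t ht
    obtain ⟨S, hS, hSI⟩ := hI.approx
    obtain ⟨S', hS', hSI'⟩ := hI'.approx
    have hconv : ∀ S : ℕ → ElementaryProcess 𝓕,
        Tendsto (fun n => ∫⁻ ω, (∫⁻ s in Set.Icc (0 : ℝ) T,
          ‖(S n).value s.toNNReal ω - H s.toNNReal ω‖ₑ ^ 2) ∂P) atTop (𝓝 0) →
        Tendsto (fun n => eLpNorm (fun z : Ω × ℝ => (S n).value z.2.toNNReal z.1
          - H z.2.toNNReal z.1) 2 (P.prod (timeMeasure T))) atTop (𝓝 0) := by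
      intro S hS
      have h1 : Tendsto (fun n => (eLpNorm (fun z : Ω × ℝ => (S n).value z.2.toNNReal z.1
          - H z.2.toNNReal z.1) 2 (P.prod (timeMeasure T)) ^ 2) ^ (1 / 2 : ℝ)) atTop
          (𝓝 (0 ^ (1 / 2 : ℝ))) := by
        refine (ENNReal.continuous_rpow_const.tendsto 0).comp (hS.congr fun n => ?_)
        exact (eLpNorm_two_prod_sq ((S n).measurable_value.aemeasurable.sub hH)).symm
      rw [ENNReal.zero_rpow_of_pos (by norm_num)] at h1
      refine h1.congr fun n => ?_
      rw [← ENNReal.rpow_natCast, ← ENNReal.rpow_mul]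
      norm_num
    have mI := (hI.memLp t ht).aestronglyMeasurable
    have mI' := (hI'.memLp t ht).aestronglyMeasurable
    have mS : ∀ S : ElementaryProcess 𝓕, AEStronglyMeasurable (S.integral B t) P := fun S =>
      (S.memLp_integral hB t).aestronglyMeasurable
    have mV : ∀ S : ElementaryProcess 𝓕, AEStronglyMeasurable
        (fun z : Ω × ℝ => S.value z.2.toNNReal z.1 - H z.2.toNNReal z.1)
        (P.prod (timeMeasure T)) := fun S =>
      (S.measurable_value.aemeasurable.sub hH).aestronglyMeasurable
    have hle : ∀ n, eLpNorm (fun ω => I t ω - I' t ω) 2 P ≤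
        eLpNorm (fun ω => (S n).integral B t ω - I t ω) 2 P
        + (eLpNorm (fun z : Ω × ℝ => (S n).value z.2.toNNReal z.1 - H z.2.toNNReal z.1) 2
            (P.prod (timeMeasure T))
          + eLpNorm (fun z : Ω × ℝ => (S' n).value z.2.toNNReal z.1 - H z.2.toNNReal z.1) 2
            (P.prod (timeMeasure T)))
        + eLpNorm (fun ω => (S' n).integral B t ω - I' t ω) 2 P := by
      intro n
      have e1 : (fun ω => I t ω - I' t ω) = (-(fun ω => (S n).integral B t ω - I t ω)
          + fun ω => (S n).integral B t ω - (S' n).integral B t ω)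
          + fun ω => (S' n).integral B t ω - I' t ω := by
        ext ω; simp only [Pi.add_apply, Pi.neg_apply]; ring
      rw [e1]
      refine (eLpNorm_add_le ((((mS _).sub mI).neg).add ((mS _).sub (mS _))) ((mS _).sub mI')
        (by norm_num)).trans ?_
      refine add_le_add ?_ le_rfl
      refine (eLpNorm_add_le (((mS _).sub mI).neg) ((mS _).sub (mS _)) (by norm_num)).trans ?_
      rw [eLpNorm_neg]
      refine add_le_add le_rfl ?_
      refine ((S n).eLpNorm_integral_sub_le (S' n) hB ht).trans ?_
      have e2 : (fun z : Ω × ℝ => (S n).value z.2.toNNReal z.1 - (S' n).value z.2.toNNReal z.1)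
          = (fun z : Ω × ℝ => (S n).value z.2.toNNReal z.1 - H z.2.toNNReal z.1)
            - fun z : Ω × ℝ => (S' n).value z.2.toNNReal z.1 - H z.2.toNNReal z.1 := by
        ext z; simp
      rw [e2]
      exact eLpNorm_sub_le (mV _) (mV _) (by norm_num)
    have hlim := ((hSI t ht).add ((hconv S hS).add (hconv S' hS'))).add (hSI' t ht)
    simp only [add_zero] at hlim
    have h0 : eLpNorm (fun ω => I t ω - I' t ω) 2 P = 0 :=
      le_antisymm (ge_of_tendsto' hlim hle) zero_le
    have := (eLpNorm_eq_zero_iff (mI.sub mI') (by norm_num)).1 h0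
    filter_upwards [this] with ω hω
    exact sub_eq_zero.1 hω
  obtain ⟨D, hDc, hD⟩ := TopologicalSpace.exists_countable_dense (Set.Icc (0 : ℝ≥0) T)
  have hall : ∀ᵐ ω ∂P, ∀ t ∈ D, I t ω = I' t ω :=
    (ae_ball_iff hDc).2 fun t _ => hpt t t.2.2
  filter_upwards [hall, hI.continuous_paths, hI'.continuous_paths] with ω h1 h2 h3
  have := Continuous.ext_on hD h2.domRestrict h3.domRestrict (fun t ht => h1 t ht)
  intro t ht
  exact congrFun this ⟨t, ht⟩

/-- Elementary integrals whose integrands converge geometrically fast converge uniformly, almost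
surely. -/
lemma exists_tendstoUniformlyOn_integral [IsProbabilityMeasure P]
    (hB : IsFilteredBrownianReal 𝓕 P B)
    (hH : AEMeasurable (fun z : Ω × ℝ => H z.2.toNNReal z.1) (P.prod (timeMeasure T)))
    (S : ℕ → ElementaryProcess 𝓕)
    (hS : ∀ r, eLpNorm (fun z : Ω × ℝ => (S r).value z.2.toNNReal z.1 - H z.2.toNNReal z.1) 2
      (P.prod (timeMeasure T)) ≤ (((8⁻¹ : ℝ≥0) ^ r : ℝ≥0) : ℝ≥0∞)) :
    ∃ I : ℝ≥0 → Ω → ℝ, (∀ᵐ ω ∂P, TendstoUniformlyOn (fun r t => (S r).integral B t ω)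
      (fun t => I t ω) atTop (Set.Icc 0 T)) ∧ IsItoIntegral 𝓕 P B T H I := by
  have mV : ∀ S : ElementaryProcess 𝓕, AEStronglyMeasurable
      (fun z : Ω × ℝ => S.value z.2.toNNReal z.1 - H z.2.toNNReal z.1)
      (P.prod (timeMeasure T)) := fun S =>
    (S.measurable_value.aemeasurable.sub hH).aestronglyMeasurable
  have mS : ∀ (S : ElementaryProcess 𝓕) (t : ℝ≥0), AEStronglyMeasurable (S.integral B t) P :=
    fun S t => (S.memLp_integral hB t).aestronglyMeasurable
  have hdiff : ∀ r k t, t ≤ T →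
      eLpNorm (fun ω => (S r).integral B t ω - (S k).integral B t ω) 2 P
        ≤ (((8⁻¹ : ℝ≥0) ^ r + (8⁻¹ : ℝ≥0) ^ k : ℝ≥0) : ℝ≥0∞) := by
    intro r k t ht
    refine ((S r).eLpNorm_integral_sub_le (S k) hB ht).trans ?_
    have e2 : (fun z : Ω × ℝ => (S r).value z.2.toNNReal z.1 - (S k).value z.2.toNNReal z.1)
        = (fun z : Ω × ℝ => (S r).value z.2.toNNReal z.1 - H z.2.toNNReal z.1)
          - fun z : Ω × ℝ => (S k).value z.2.toNNReal z.1 - H z.2.toNNReal z.1 := by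
      ext z; simp
    rw [e2, ENNReal.coe_add]
    exact (eLpNorm_sub_le (mV _) (mV _) (by norm_num)).trans (add_le_add (hS r) (hS k))
  -- Borel-Cantelli. Consecutive integrals differ by at most `2 * 8^{-r}` in `L²`, so Doob's
  -- inequality at level `2^{-r}` gives probabilities at most `4^r * (2 * 8^{-r})² = 4 * 16^{-r}`,
  -- which is summable.
  have hBC : ∀ᵐ ω ∂P, ∀ᶠ r in atTop, ¬ ∃ t ≤ T,
      (((2⁻¹ : ℝ≥0) ^ r : ℝ≥0) : ℝ) < |(S r).integral B t ω - (S (r + 1)).integral B t ω| := by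
    refine ae_eventually_notMem (s := fun r => {ω | ∃ t ≤ T,
      (((2⁻¹ : ℝ≥0) ^ r : ℝ≥0) : ℝ) < |(S r).integral B t ω - (S (r + 1)).integral B t ω|}) ?_
    have hb : ∀ r, P {ω | ∃ t ≤ T,
        (((2⁻¹ : ℝ≥0) ^ r : ℝ≥0) : ℝ) < |(S r).integral B t ω - (S (r + 1)).integral B t ω|}
        ≤ ((4 * (16⁻¹ : ℝ≥0) ^ r : ℝ≥0) : ℝ≥0∞) := by
      intro r
      have h := ((S r).sub (S (r + 1))).measure_exists_le hB T ((2⁻¹ : ℝ≥0) ^ r)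
      simp_rw [ElementaryProcess.integral_sub] at h
      have h2 : eLpNorm (((S r).sub (S (r + 1))).integral B T) 2 P
          ≤ ((2 * (8⁻¹ : ℝ≥0) ^ r : ℝ≥0) : ℝ≥0∞) := by
        have : ((S r).sub (S (r + 1))).integral B T
            = fun ω => (S r).integral B T ω - (S (r + 1)).integral B T ω := by
          ext ω; exact ElementaryProcess.integral_sub _ _ _ _
        rw [this]
        refine (hdiff r (r + 1) T le_rfl).trans ?_
        rw [two_mul]
        gcongr ((?_ : ℝ≥0) : ℝ≥0∞)
        gcongr _ + ?_
        exact pow_le_pow_of_le_one zero_le (inv_le_one_of_one_le₀ (by norm_num)) (Nat.le_succ r)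
      have h3 := h.trans (pow_le_pow_left₀ zero_le h2 2)
      calc _ = (((4 : ℝ≥0) ^ r : ℝ≥0) : ℝ≥0∞) * (((((2⁻¹ : ℝ≥0) ^ r : ℝ≥0)) : ℝ≥0∞) ^ 2 *
            P {ω | ∃ t ≤ T, (((2⁻¹ : ℝ≥0) ^ r : ℝ≥0) : ℝ)
              < |(S r).integral B t ω - (S (r + 1)).integral B t ω|}) := by
            rw [← mul_assoc, ← ENNReal.coe_pow, ← ENNReal.coe_mul]
            have : (4 : ℝ≥0) ^ r * ((2⁻¹ : ℝ≥0) ^ r) ^ 2 = 1 := by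
              rw [← pow_mul, mul_comm r 2, pow_mul, ← mul_pow]; norm_num
            rw [this]; simp
        _ ≤ (((4 : ℝ≥0) ^ r : ℝ≥0) : ℝ≥0∞) * ((2 * (8⁻¹ : ℝ≥0) ^ r : ℝ≥0) : ℝ≥0∞) ^ 2 := by
            gcongr
        _ = _ := by
            rw [← ENNReal.coe_pow, ← ENNReal.coe_mul]
            congr 1
            rw [mul_pow, ← pow_mul, mul_comm r 2, pow_mul, mul_left_comm, ← mul_pow]
            norm_num
    refine ne_top_of_le_ne_top ?_ (ENNReal.tsum_le_tsum hb)
    refine ENNReal.tsum_coe_ne_top_iff_summable.2 (Summable.mul_left _ ?_)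
    exact NNReal.summable_geometric (inv_lt_one_of_one_lt₀ (by norm_num))
  set I : ℝ≥0 → Ω → ℝ := fun t ω => limUnder atTop (fun r => (S r).integral B t ω) with hI
  have hunif : ∀ᵐ ω ∂P, TendstoUniformlyOn (fun r t => (S r).integral B t ω)
      (fun t => I t ω) atTop (Set.Icc 0 T) := by
    filter_upwards [hBC] with ω hω
    obtain ⟨r₀, hr₀⟩ := eventually_atTop.1 hω
    push Not at hr₀
    -- The geometric bound does not depend on `t`, so the tail estimate below is uniform on `[0,
    -- T]`.
    have hstep : ∀ r ≥ r₀, ∀ t ∈ Set.Icc 0 T, ∀ n, dist ((S (n + r)).integral B t ω)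
        ((S (n + 1 + r)).integral B t ω) ≤ (2⁻¹ : ℝ) ^ r * (2⁻¹ : ℝ) ^ n := by
      intro r hr t ht n
      have := hr₀ (n + r) (by omega) t ht.2
      rw [Real.dist_eq, show n + 1 + r = n + r + 1 by ring, ← pow_add, add_comm r n]
      simpa using this
    have hlim : ∀ t ∈ Set.Icc 0 T, Tendsto (fun r => (S r).integral B t ω) atTop (𝓝 (I t ω)) := by
      intro t ht
      refine tendsto_nhds_limUnder ?_
      have hc := cauchySeq_of_le_geometric (2⁻¹ : ℝ) ((2⁻¹ : ℝ) ^ r₀) (by norm_num)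
        (hstep r₀ le_rfl t ht)
      obtain ⟨x, hx⟩ := cauchySeq_tendsto_of_complete hc
      exact ⟨x, (tendsto_add_atTop_iff_nat (f := fun r => (S r).integral B t ω) r₀).1 hx⟩
    rw [Metric.tendstoUniformlyOn_iff]
    intro ε hε
    have hg : Tendsto (fun r : ℕ => (2⁻¹ : ℝ) ^ r / (1 - 2⁻¹)) atTop (𝓝 0) := by
      have := (tendsto_pow_atTop_nhds_zero_of_lt_one (r := (2⁻¹ : ℝ)) (by norm_num)
        (by norm_num)).div_const (1 - 2⁻¹ : ℝ)
      simpa using this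
    filter_upwards [eventually_ge_atTop r₀, hg.eventually (gt_mem_nhds hε)] with r hr hrε t ht
    rw [dist_comm]
    refine lt_of_le_of_lt ?_ hrε
    have := dist_le_of_le_geometric_of_tendsto₀ (2⁻¹ : ℝ) ((2⁻¹ : ℝ) ^ r) (by norm_num)
      (hstep r hr t ht) ((tendsto_add_atTop_iff_nat (f := fun r => (S r).integral B t ω) r).2
        (hlim t ht))
    simpa using this
  refine ⟨I, hunif, ?_⟩
  have hptw : ∀ t ≤ T, ∀ᵐ ω ∂P, Tendsto (fun r => (S r).integral B t ω) atTop (𝓝 (I t ω)) := by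
    intro t ht
    filter_upwards [hunif] with ω hω
    exact hω.tendsto_at ⟨zero_le, ht⟩
  have mI : ∀ t ≤ T, AEStronglyMeasurable (I t) P := fun t ht =>
    aestronglyMeasurable_of_tendsto_ae atTop (fun r => mS (S r) t) (hptw t ht)
  have hnorm : ∀ t ≤ T, ∀ r, eLpNorm (fun ω => (S r).integral B t ω - I t ω) 2 P
      ≤ (((8⁻¹ : ℝ≥0) ^ r : ℝ≥0) : ℝ≥0∞) := by
    intro t ht r
    -- Fatou's lemma turns the Cauchy estimate into an estimate of the distance to the almost sure
    -- limit.
    have h1 : eLpNorm (fun ω => (S r).integral B t ω - I t ω) 2 P ≤ liminf (fun k =>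
        eLpNorm (fun ω => (S r).integral B t ω - (S k).integral B t ω) 2 P) atTop := by
      refine Lp.eLpNorm_lim_le_liminf_eLpNorm (fun k => (mS _ t).sub (mS _ t)) _ ?_
      filter_upwards [hptw t ht] with ω hω
      exact tendsto_const_nhds.sub hω
    have h2 : Tendsto (fun k => (((8⁻¹ : ℝ≥0) ^ r + (8⁻¹ : ℝ≥0) ^ k : ℝ≥0) : ℝ≥0∞)) atTop
        (𝓝 (((8⁻¹ : ℝ≥0) ^ r + 0 : ℝ≥0) : ℝ≥0∞)) := by
      rw [ENNReal.tendsto_coe]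
      exact tendsto_const_nhds.add (NNReal.tendsto_pow_atTop_nhds_zero_of_lt_one
        (inv_lt_one_of_one_lt₀ (by norm_num)))
    rw [add_zero] at h2
    rw [← h2.liminf_eq]
    exact h1.trans (liminf_le_liminf (Eventually.of_forall fun k => hdiff r k t ht))
  refine ⟨?_, ?_, S, ?_, ?_⟩
  · have hcont : ∀ᵐ ω ∂P, ∀ r, Continuous (fun t => (S r).integral B t ω) :=
      ae_all_iff.2 fun r => (S r).ae_continuous_integral hB
    filter_upwards [hunif, hcont] with ω h1 h2
    exact h1.continuousOn (Frequently.of_forall fun r => (h2 r).continuousOn)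
  · intro t ht
    have : I t = (S 0).integral B t - fun ω => (S 0).integral B t ω - I t ω := by
      ext ω; simp
    rw [this]
    exact ((S 0).memLp_integral hB t).sub ⟨(mS _ t).sub (mI t ht),
      (hnorm t ht 0).trans_lt ENNReal.coe_lt_top⟩
  · have h0 : Tendsto (fun r : ℕ => ((((8⁻¹ : ℝ≥0) ^ r : ℝ≥0) : ℝ≥0∞)) ^ 2) atTop (𝓝 0) := by
      have : Tendsto (fun r : ℕ => (((8⁻¹ : ℝ≥0) ^ r : ℝ≥0) : ℝ≥0∞)) atTop (𝓝 ((0 : ℝ≥0) : ℝ≥0∞)) :=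
        ENNReal.tendsto_coe.2 (NNReal.tendsto_pow_atTop_nhds_zero_of_lt_one
          (inv_lt_one_of_one_lt₀ (by norm_num)))
      simpa using ENNReal.Tendsto.pow (n := 2) this
    refine tendsto_of_tendsto_of_tendsto_of_le_of_le tendsto_const_nhds h0 (fun _ => zero_le) ?_
    intro r
    simp only
    rw [← eLpNorm_two_prod_sq (F := fun z : Ω × ℝ => (S r).value z.2.toNNReal z.1
      - H z.2.toNNReal z.1) ((S r).measurable_value.aemeasurable.sub hH)]
    exact pow_le_pow_left₀ zero_le (hS r) 2
  · intro t ht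
    have h0 : Tendsto (fun r : ℕ => (((8⁻¹ : ℝ≥0) ^ r : ℝ≥0) : ℝ≥0∞)) atTop
        (𝓝 ((0 : ℝ≥0) : ℝ≥0∞)) :=
      ENNReal.tendsto_coe.2 (NNReal.tendsto_pow_atTop_nhds_zero_of_lt_one
        (inv_lt_one_of_one_lt₀ (by norm_num)))
    exact tendsto_of_tendsto_of_tendsto_of_le_of_le tendsto_const_nhds h0 (fun _ => zero_le)
      (hnorm t ht)

/-- The uniform limit just constructed shows that the `dite` in `itoIntegral` takes its first
branch, and uniqueness identifies the chosen process with that limit. Nothing else about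
`itoIntegral` is needed later. -/
theorem tendstoUniformlyOn_itoIntegral [IsProbabilityMeasure P]
    (hB : IsFilteredBrownianReal 𝓕 P B)
    (hH : AEMeasurable (fun z : Ω × ℝ => H z.2.toNNReal z.1) (P.prod (timeMeasure T)))
    (S : ℕ → ElementaryProcess 𝓕)
    (hS : ∀ r, eLpNorm (fun z : Ω × ℝ => (S r).value z.2.toNNReal z.1 - H z.2.toNNReal z.1) 2
      (P.prod (timeMeasure T)) ≤ (((8⁻¹ : ℝ≥0) ^ r : ℝ≥0) : ℝ≥0∞)) :
    ∀ᵐ ω ∂P, TendstoUniformlyOn (fun r t => (S r).integral B t ω)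
      (fun t => itoIntegral 𝓕 P B T H t ω) atTop (Set.Icc 0 T) ∧
      ContinuousOn (fun t => itoIntegral 𝓕 P B T H t ω) (Set.Icc 0 T) := by
  obtain ⟨I, hI, hIto⟩ := exists_tendstoUniformlyOn_integral hB hH S hS
  have hex : ∃ I, IsItoIntegral 𝓕 P B T H I := ⟨I, hIto⟩
  have hito : IsItoIntegral 𝓕 P B T H (itoIntegral 𝓕 P B T H) := by
    rw [itoIntegral, dif_pos hex]; exact hex.choose_spec
  filter_upwards [hI, hIto.ae_eqOn hB hH hito, hito.continuous_paths] with ω h1 h2 h3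
  exact ⟨h1.congr_right h2, h3⟩

end ItoIntegral

end

/-! ### Approximation of the integrands `F(X)` on uniform grids. -/

noncomputable section

lemma tendsto_zero_of_sq_tendsto_zero {ι : Type*} {l : Filter ι} {u : ι → ℝ≥0∞}
    (h : Tendsto (fun i => u i ^ 2) l (𝓝 0)) : Tendsto u l (𝓝 0) := by
  have h1 : Tendsto (fun i => (u i ^ 2) ^ (1 / 2 : ℝ)) l (𝓝 (0 ^ (1 / 2 : ℝ))) :=
    (ENNReal.continuous_rpow_const.tendsto 0).comp h
  rw [ENNReal.zero_rpow_of_pos (by norm_num)] at h1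
  refine h1.congr fun n => ?_
  rw [← ENNReal.rpow_natCast, ← ENNReal.rpow_mul]
  norm_num

lemma tendsto_eLpNorm_two_of_bounded {α : Type*} {mα : MeasurableSpace α} {μ : Measure α}
    [IsFiniteMeasure μ] {f : ℕ → α → ℝ} (hf : ∀ n, AEStronglyMeasurable (f n) μ) {C : ℝ}
    (hC : ∀ n, ∀ᵐ x ∂μ, |f n x| ≤ C) (h : ∀ᵐ x ∂μ, Tendsto (fun n => f n x) atTop (𝓝 0)) :
    Tendsto (fun n => eLpNorm (f n) 2 μ) atTop (𝓝 0) := by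
  apply tendsto_zero_of_sq_tendsto_zero
  simp_rw [eLpNorm_two_sq]
  have := tendsto_lintegral_of_dominated_convergence' (μ := μ) (F := fun n x => ‖f n x‖ₑ ^ 2)
    (f := fun _ => 0) (fun _ => ENNReal.ofReal C ^ 2) (fun n => (hf n).enorm.pow_const 2) ?_ ?_ ?_
  · simpa using this
  · intro n
    filter_upwards [hC n] with x hx
    gcongr
    rw [Real.enorm_eq_ofReal_abs]
    exact ENNReal.ofReal_le_ofReal hx
  · rw [lintegral_const]
    exact ENNReal.mul_ne_top (by simp) (measure_ne_top _ _)
  · filter_upwards [h] with x hx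
    have h2 := ((continuous_enorm.tendsto (0 : ℝ)).comp hx)
    simp only [enorm_zero] at h2
    simpa using ENNReal.Tendsto.pow (n := 2) h2

/-- The squared norms are summable, so `∑ |f_r|²` is integrable and hence almost everywhere finite;
no subsequence is required. -/
lemma ae_tendsto_zero_of_eLpNorm_le_geometric {α : Type*} {mα : MeasurableSpace α} {μ : Measure α}
    {f : ℕ → α → ℝ} (hf : ∀ n, AEStronglyMeasurable (f n) μ)
    (h : ∀ r, eLpNorm (f r) 2 μ ≤ (((8⁻¹ : ℝ≥0) ^ r : ℝ≥0) : ℝ≥0∞)) :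
    ∀ᵐ x ∂μ, Tendsto (fun n => f n x) atTop (𝓝 0) := by
  have hsum : ∫⁻ x, ∑' r, ‖f r x‖ₑ ^ 2 ∂μ ≠ ∞ := by
    rw [lintegral_tsum fun r => (hf r).enorm.pow_const 2]
    simp_rw [← eLpNorm_two_sq]
    have hb : ∀ r, eLpNorm (f r) 2 μ ^ 2 ≤ (((64⁻¹ : ℝ≥0) ^ r : ℝ≥0) : ℝ≥0∞) := by
      intro r
      refine (pow_le_pow_left₀ zero_le (h r) 2).trans_eq ?_
      rw [← ENNReal.coe_pow]
      congr 1
      rw [← pow_mul, mul_comm r 2, pow_mul]; norm_num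
    refine ne_top_of_le_ne_top ?_ (ENNReal.tsum_le_tsum hb)
    exact ENNReal.tsum_coe_ne_top_iff_summable.2
      (NNReal.summable_geometric (inv_lt_one_of_one_lt₀ (by norm_num)))
  have := ae_lt_top' (AEMeasurable.tsum fun r => (hf r).enorm.pow_const 2) hsum
  filter_upwards [this] with x hx
  have h1 := ENNReal.tendsto_atTop_zero_of_tsum_ne_top hx.ne
  have h2 := tendsto_zero_of_sq_tendsto_zero h1
  rw [tendsto_zero_iff_norm_tendsto_zero]
  have h3 := (ENNReal.tendsto_toReal ENNReal.zero_ne_top).comp h2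
  simpa [Function.comp_def] using h3

section Grid

variable {Ω : Type*} {mΩ : MeasurableSpace Ω} {E : Type*} [TopologicalSpace E]
  [TopologicalSpace.PseudoMetrizableSpace E] [MeasurableSpace E] [BorelSpace E]
  {X : ℝ≥0 → Ω → E} {T : ℝ≥0}

/-- The process `X` stopped at the deterministic time `t` is jointly measurable. -/
lemma measurable_stopped (hXc : ∀ ω, ContinuousOn (fun t => X t ω) (Set.Icc 0 T))
    {m : MeasurableSpace Ω} {t : ℝ≥0} (ht : t ≤ T) (hm : ∀ s ≤ t, Measurable[m] (X s)) :
    Measurable (fun z : ℝ × Ω => X (min z.1.toNNReal t) z.2) := by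
  refine measurable_uncurry_of_continuous_of_measurable
    (u := fun (s : ℝ) ω => X (min s.toNNReal t) ω) (fun ω => ?_) (fun s => hm _ (min_le_right _ _))
  exact (hXc ω).comp_continuous (by fun_prop) fun s => ⟨zero_le, (min_le_right _ _).trans ht⟩

/-- The cells `(t_i, t_{i+1}]` miss time `0`, so this single instant has to be discarded when step
processes are compared with `F(X)`. -/
lemma ae_prod_mem_Ioc (P : Measure Ω) [SFinite P] (T : ℝ≥0) :
    ∀ᵐ z ∂(P.prod (timeMeasure T)), z.2 ∈ Set.Ioc (0 : ℝ) T := by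
  refine Measure.quasiMeasurePreserving_snd.ae (p := fun s => s ∈ Set.Ioc (0 : ℝ) T) ?_
  rw [timeMeasure, restrict_Ioc_eq_restrict_Icc.symm]
  exact ae_restrict_mem measurableSet_Ioc

lemma aemeasurable_comp_process {P : Measure Ω} [SFinite P]
    (hXc : ∀ ω, ContinuousOn (fun t => X t ω) (Set.Icc 0 T)) (hXm : ∀ t ≤ T, Measurable (X t))
    {F : E → ℝ} (hF : Measurable F) :
    AEMeasurable (fun z : Ω × ℝ => F (X z.2.toNNReal z.1)) (P.prod (timeMeasure T)) := by
  refine ⟨fun z => F (X (min z.2.toNNReal T) z.1),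
    hF.comp ((measurable_stopped hXc le_rfl hXm).comp measurable_swap), ?_⟩
  filter_upwards [ae_prod_mem_Ioc P T] with z hz
  rw [min_eq_left (Real.toNNReal_le_iff_le_coe.2 hz.2)]

variable {𝓕 : Filtration ℝ≥0 mΩ}

/-- The elementary process with value `φ (X (t_i))` on `(t_i, t_{i+1}]`, for the uniform grid. -/
def gridElementary (𝓕 : Filtration ℝ≥0 mΩ) (T : ℝ≥0) (X : ℝ≥0 → Ω → E)
    (hX : ∀ t ≤ T, Measurable[𝓕 t] (X t)) (φ : E → ℝ) (hφ : Measurable φ)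
    (hC : ∃ C : ℝ, ∀ x, |φ x| ≤ C) (n : ℕ) : ElementaryProcess 𝓕 where
  n := n
  left i := gridTime T n i
  right i := gridTime T n (i + 1)
  left_le_right i := gridTime_mono T n (Nat.le_succ i)
  coeff i ω := φ (X (gridTime T n i) ω)
  measurable_coeff i := hφ.comp (hX _ (gridTime_le T (Nat.ne_of_gt i.pos) i.2.le))
  bounded_coeff := hC.imp fun _ h _ _ => h _

lemma eq_of_mem_Ioc_gridTime {n i j : ℕ} {s : ℝ≥0}
    (hi : s ∈ Set.Ioc (gridTime T n i) (gridTime T n (i + 1)))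
    (hj : s ∈ Set.Ioc (gridTime T n j) (gridTime T n (j + 1))) : i = j := by
  by_contra h
  rcases Nat.lt_or_gt_of_ne h with h | h
  · exact absurd (hi.2.trans (gridTime_mono T n (Nat.succ_le_of_lt h))) (not_le.2 hj.1)
  · exact absurd (hj.2.trans (gridTime_mono T n (Nat.succ_le_of_lt h))) (not_le.2 hi.1)

lemma sum_indicator_gridTime {n : ℕ} {s : ℝ≥0} (u : ℕ → ℝ) (i : Fin n)
    (hi : s ∈ Set.Ioc (gridTime T n i) (gridTime T n (i + 1))) :
    ∑ j : Fin n, (Set.Ioc (gridTime T n j) (gridTime T n (j + 1))).indicator (fun _ => u j) s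
      = u i := by
  rw [Finset.sum_eq_single i]
  · exact Set.indicator_of_mem hi _
  · intro j _ hji
    refine Set.indicator_of_notMem (fun hj => hji (Fin.ext (eq_of_mem_Ioc_gridTime hj hi))) _
  · simp

lemma gridElementary_value {hX : ∀ t ≤ T, Measurable[𝓕 t] (X t)} {φ : E → ℝ} {hφ : Measurable φ}
    {hC : ∃ C : ℝ, ∀ x, |φ x| ≤ C} {n : ℕ} {s : ℝ≥0} (i : Fin n)
    (hi : s ∈ Set.Ioc (gridTime T n i) (gridTime T n (i + 1))) (ω : Ω) :
    (gridElementary 𝓕 T X hX φ hφ hC n).value s ω = φ (X (gridTime T n i) ω) :=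
  sum_indicator_gridTime (fun j => φ (X (gridTime T n j) ω)) i hi

lemma abs_gridElementary_value_le {hX : ∀ t ≤ T, Measurable[𝓕 t] (X t)} {φ : E → ℝ}
    {hφ : Measurable φ} {hC : ∃ C : ℝ, ∀ x, |φ x| ≤ C} {n : ℕ} (hn : n ≠ 0) {C : ℝ}
    (hC' : ∀ x, |φ x| ≤ C) {s : ℝ≥0} (h0 : 0 < s) (hs : s ≤ T) (ω : Ω) :
    |(gridElementary 𝓕 T X hX φ hφ hC n).value s ω| ≤ C := by
  obtain ⟨i, hi⟩ := exists_mem_Ioc_gridTime hn h0 hs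
  rw [gridElementary_value i hi]
  exact hC' _

/-- Left end points of the grid cells that contain `s` converge to `s`. -/
lemma tendsto_of_mem_Ioc_gridTime {s : ℝ≥0} {n : ℕ → ℕ} (hn : Tendsto n atTop atTop) (i : ℕ → ℕ)
    (hi : ∀ᶠ r in atTop, s ∈ Set.Ioc (gridTime T (n r) (i r)) (gridTime T (n r) (i r + 1))) :
    Tendsto (fun r => gridTime T (n r) (i r)) atTop (𝓝 s) := by
  rw [← NNReal.tendsto_coe]
  have h0 : Tendsto (fun r => (s : ℝ) - T / n r) atTop (𝓝 (s - 0)) :=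
    tendsto_const_nhds.sub (tendsto_const_nhds.div_atTop (tendsto_natCast_atTop_atTop.comp hn))
  rw [sub_zero] at h0
  refine tendsto_of_tendsto_of_tendsto_of_le_of_le' h0 tendsto_const_nhds ?_ ?_
  · filter_upwards [hi] with r hr
    have h1 := gridTime_succ_sub T (n r) (i r)
    have h2 : (s : ℝ) ≤ gridTime T (n r) (i r + 1) := by exact_mod_cast hr.2
    linarith
  · filter_upwards [hi] with r hr
    exact_mod_cast hr.1.le

lemma tendsto_gridElementary_value (hXc : ∀ ω, ContinuousOn (fun t => X t ω) (Set.Icc 0 T))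
    (hX : ∀ t ≤ T, Measurable[𝓕 t] (X t)) {φ : E → ℝ} (hφ : Continuous φ) (hφm : Measurable φ)
    (hC : ∃ C : ℝ, ∀ x, |φ x| ≤ C) {s : ℝ≥0} (h0 : 0 < s) (hs : s ≤ T) (ω : Ω) :
    Tendsto (fun n => (gridElementary 𝓕 T X hX φ hφm hC n).value s ω) atTop
      (𝓝 (φ (X s ω))) := by
  have hex : ∀ n : ℕ, ∃ i : ℕ, n ≠ 0 → ∃ h : i < n,
      s ∈ Set.Ioc (gridTime T n i) (gridTime T n (i + 1)) := by
    intro n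
    by_cases hn : n = 0
    · exact ⟨0, fun h => absurd hn h⟩
    · obtain ⟨i, hi⟩ := exists_mem_Ioc_gridTime hn h0 hs
      exact ⟨i, fun _ => ⟨i.2, hi⟩⟩
  choose i hi using hex
  have ht := tendsto_of_mem_Ioc_gridTime (T := T) (s := s) tendsto_id i (by
    filter_upwards [eventually_ne_atTop 0] with n hn using (hi n hn).2)
  have hlim : Tendsto (fun n => φ (X (gridTime T n (i n)) ω)) atTop (𝓝 (φ (X s ω))) := by
    refine (hφ.tendsto _).comp ((hXc ω s ⟨zero_le, hs⟩).tendsto.comp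
      (tendsto_nhdsWithin_iff.2 ⟨ht, ?_⟩))
    filter_upwards [eventually_ne_atTop 0] with n hn
    exact ⟨zero_le, gridTime_le T hn (hi n hn).1.le⟩
  refine hlim.congr' ?_
  filter_upwards [eventually_ne_atTop 0] with n hn
  exact (gridElementary_value ⟨i n, (hi n hn).1⟩ (hi n hn).2 ω).symm

/-- Functionals of a continuous process are approximated at a geometric rate by elementary
processes on uniform grids. -/
lemma exists_gridElementary_approx {P : Measure Ω} [IsProbabilityMeasure P] {ι : Type*} [Finite ι]
    (hXc : ∀ ω, ContinuousOn (fun t => X t ω) (Set.Icc 0 T))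
    (hX : ∀ t ≤ T, Measurable[𝓕 t] (X t)) {F : ι → E → ℝ} {Φ : ℕ → ι → E → ℝ}
    (hΦ : ∀ k q, Continuous (Φ k q)) {C : ℝ} (hC : ∀ k q x, |Φ k q x| ≤ C)
    (hlim : ∀ q x, Tendsto (fun k => Φ k q x) atTop (𝓝 (F q x))) :
    ∃ n k : ℕ → ℕ, ∀ r, r < n r ∧ ∀ q,
      eLpNorm (fun z : Ω × ℝ => (gridElementary 𝓕 T X hX (Φ (k r) q) (hΦ (k r) q).measurable
          ⟨C, hC (k r) q⟩ (n r)).value z.2.toNNReal z.1 - F q (X z.2.toNNReal z.1)) 2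
        (P.prod (timeMeasure T)) ≤ (((8⁻¹ : ℝ≥0) ^ r : ℝ≥0) : ℝ≥0∞) := by
  have hXm : ∀ t ≤ T, Measurable (X t) := fun t ht => (hX t ht).mono (𝓕.le t) le_rfl
  have hFm : ∀ q, Measurable (F q) := fun q =>
    measurable_of_tendsto_metrizable (fun k => (hΦ k q).measurable) (tendsto_pi_nhds.2 (hlim q))
  have hFC : ∀ q x, |F q x| ≤ C := fun q x =>
    le_of_tendsto' ((hlim q x).abs) fun k => hC k q x
  have mF : ∀ q, AEMeasurable (fun z : Ω × ℝ => F q (X z.2.toNNReal z.1))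
      (P.prod (timeMeasure T)) := fun q => aemeasurable_comp_process hXc hXm (hFm q)
  have mΦ : ∀ k q, AEMeasurable (fun z : Ω × ℝ => Φ k q (X z.2.toNNReal z.1))
      (P.prod (timeMeasure T)) := fun k q =>
    aemeasurable_comp_process hXc hXm (hΦ k q).measurable
  have h1 : ∀ q, Tendsto (fun k => eLpNorm (fun z : Ω × ℝ =>
      Φ k q (X z.2.toNNReal z.1) - F q (X z.2.toNNReal z.1)) 2 (P.prod (timeMeasure T)))
      atTop (𝓝 0) := by
    intro q
    refine tendsto_eLpNorm_two_of_bounded (C := C + C)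
      (fun k => ((mΦ k q).sub (mF q)).aestronglyMeasurable)
      (fun k => ae_of_all _ fun z => (abs_sub _ _).trans (add_le_add (hC _ _ _) (hFC _ _)))
      (ae_of_all _ fun z => ?_)
    simpa using (hlim q (X z.2.toNNReal z.1)).sub_const (F q (X z.2.toNNReal z.1))
  have h2 : ∀ k q, Tendsto (fun n => eLpNorm (fun z : Ω × ℝ =>
      (gridElementary 𝓕 T X hX (Φ k q) (hΦ k q).measurable ⟨C, hC k q⟩ n).value z.2.toNNReal z.1
        - Φ k q (X z.2.toNNReal z.1)) 2 (P.prod (timeMeasure T))) atTop (𝓝 0) := by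
    intro k q
    -- The shift removes the degenerate grid with no cell.
    rw [← tendsto_add_atTop_iff_nat 1]
    refine tendsto_eLpNorm_two_of_bounded (C := C + C)
      (fun n => ((ElementaryProcess.measurable_value _).aemeasurable.sub
        (mΦ k q)).aestronglyMeasurable) (fun n => ?_) ?_
    · filter_upwards [ae_prod_mem_Ioc P T] with z hz
      refine (abs_sub _ _).trans (add_le_add ?_ (hC _ _ _))
      exact abs_gridElementary_value_le n.succ_ne_zero (hC k q) (Real.toNNReal_pos.2 hz.1)
        (Real.toNNReal_le_iff_le_coe.2 hz.2) _
    · filter_upwards [ae_prod_mem_Ioc P T] with z hz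
      have := (tendsto_gridElementary_value hXc hX (hΦ k q) (hΦ k q).measurable ⟨C, hC k q⟩
        (Real.toNNReal_pos.2 hz.1) (Real.toNNReal_le_iff_le_coe.2 hz.2) z.1).sub_const
          (Φ k q (X z.2.toNNReal z.1))
      rw [sub_self] at this
      exact (tendsto_add_atTop_iff_nat 1).2 this
  have hpos : ∀ r : ℕ, (0 : ℝ≥0∞) < (((8⁻¹ : ℝ≥0) ^ r / 2 : ℝ≥0) : ℝ≥0∞) := fun r =>
    ENNReal.coe_pos.2 (by positivity)
  have hsel : ∀ r : ℕ, ∃ n k : ℕ, r < n ∧ ∀ q,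
      eLpNorm (fun z : Ω × ℝ => (gridElementary 𝓕 T X hX (Φ k q) (hΦ k q).measurable
          ⟨C, hC k q⟩ n).value z.2.toNNReal z.1 - F q (X z.2.toNNReal z.1)) 2
        (P.prod (timeMeasure T)) ≤ (((8⁻¹ : ℝ≥0) ^ r : ℝ≥0) : ℝ≥0∞) := by
    intro r
    -- The smoothing index `k` is fixed before the mesh, since the step approximation converges only
    -- for a continuous integrand. Finiteness of `ι` allows the same `k` and `n` for all `q`, so
    -- that all the integrals are later discretised on one grid.
    obtain ⟨k, hk⟩ := (eventually_all.2 fun q => (h1 q).eventually (gt_mem_nhds (hpos r))).exists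
    obtain ⟨n, hn, hrn⟩ := ((eventually_all.2 fun q =>
      (h2 k q).eventually (gt_mem_nhds (hpos r))).and (eventually_gt_atTop r)).exists
    refine ⟨n, k, hrn, fun q => ?_⟩
    have e : (fun z : Ω × ℝ => (gridElementary 𝓕 T X hX (Φ k q) (hΦ k q).measurable
          ⟨C, hC k q⟩ n).value z.2.toNNReal z.1 - F q (X z.2.toNNReal z.1))
        = (fun z : Ω × ℝ => (gridElementary 𝓕 T X hX (Φ k q) (hΦ k q).measurable
          ⟨C, hC k q⟩ n).value z.2.toNNReal z.1 - Φ k q (X z.2.toNNReal z.1))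
          + fun z : Ω × ℝ => Φ k q (X z.2.toNNReal z.1) - F q (X z.2.toNNReal z.1) := by
      ext z; simp
    rw [e]
    refine (eLpNorm_add_le ((ElementaryProcess.measurable_value _).aemeasurable.sub
        (mΦ k q)).aestronglyMeasurable ((mΦ k q).sub (mF q)).aestronglyMeasurable
        (by norm_num)).trans ((add_le_add (hn q).le (hk q).le).trans_eq ?_)
    rw [← ENNReal.coe_add, add_halves]
  choose n k h using hsel
  exact ⟨n, k, h⟩

/-- If `τ` lies in the cell `(t_j, t_{j+1}]`, the condition `t_i < τ` keeps exactly the cells with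
`i ≤ j`, so stopping the sum amounts to evaluating the integral at `ρ = t_{j+1}`, less than one mesh
beyond `τ`. For `τ = 0` no cell survives and `ρ = 0`. -/
lemma gridElementary_integral_stopped {hX : ∀ t ≤ T, Measurable[𝓕 t] (X t)} {φ : E → ℝ}
    {hφ : Measurable φ} {hC : ∃ C : ℝ, ∀ x, |φ x| ≤ C} {n : ℕ} (hn : n ≠ 0) (B : ℝ≥0 → Ω → ℝ)
    (τ : ℝ≥0) (hτ : τ ≤ T) (ω : Ω) :
    ∃ ρ ≤ T, τ ≤ ρ ∧ (ρ : ℝ) ≤ τ + T / n ∧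
      ∑ i : Fin n, (if gridTime T n i < τ then φ (X (gridTime T n i) ω) else 0) *
          (B (gridTime T n (i + 1)) ω - B (gridTime T n i) ω)
        = (gridElementary 𝓕 T X hX φ hφ hC n).integral B ρ ω := by
  rcases eq_zero_or_pos τ with rfl | h0
  · refine ⟨0, zero_le, le_rfl, by simp only [NNReal.coe_zero, zero_add]; positivity, ?_⟩
    simp [ElementaryProcess.integral]
  · obtain ⟨j, hj⟩ := exists_mem_Ioc_gridTime hn h0 hτ
    refine ⟨gridTime T n (j + 1), gridTime_le T hn j.2, hj.2, ?_, ?_⟩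
    · have h1 := gridTime_succ_sub T n j
      have h2 : (gridTime T n j : ℝ) < τ := by exact_mod_cast hj.1
      linarith
    · refine Finset.sum_congr rfl fun i _ => ?_
      change _ = φ (X (gridTime T n i) ω) * (B (min (gridTime T n (i + 1)) (gridTime T n (j + 1))) ω
        - B (min (gridTime T n i) (gridTime T n (j + 1))) ω)
      rcases le_or_gt (i : ℕ) j with hij | hij
      · rw [if_pos ((gridTime_mono T n hij).trans_lt hj.1),
          min_eq_left (gridTime_mono T n (by omega)), min_eq_left (gridTime_mono T n (by omega))]
      · have h1 : gridTime T n (j + 1) ≤ gridTime T n i := gridTime_mono T n hij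
        rw [if_neg (not_lt.2 (hj.2.trans h1)), min_eq_right h1,
          min_eq_right (gridTime_mono T n (by omega))]
        simp

/-- Stopped elementary sums converge to the Itô integral evaluated at a random time. -/
lemma tendsto_stopped_sum_itoIntegral {P : Measure Ω} [IsProbabilityMeasure P]
    {B : ℝ≥0 → Ω → ℝ} (hB : IsFilteredBrownianReal 𝓕 P B)
    (hXc : ∀ ω, ContinuousOn (fun t => X t ω) (Set.Icc 0 T))
    (hX : ∀ t ≤ T, Measurable[𝓕 t] (X t)) {F : E → ℝ} (hF : Measurable F) {φ : ℕ → E → ℝ}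
    (hφ : ∀ r, Measurable (φ r)) (hC : ∀ r, ∃ C : ℝ, ∀ x, |φ r x| ≤ C) {n : ℕ → ℕ}
    (hn : ∀ r, r < n r)
    (happ : ∀ r, eLpNorm (fun z : Ω × ℝ => (gridElementary 𝓕 T X hX (φ r) (hφ r)
          (hC r) (n r)).value z.2.toNNReal z.1 - F (X z.2.toNNReal z.1)) 2
        (P.prod (timeMeasure T)) ≤ (((8⁻¹ : ℝ≥0) ^ r : ℝ≥0) : ℝ≥0∞)) :
    ∀ᵐ ω ∂P, ∀ τ ≤ T, Tendsto (fun r => ∑ i : Fin (n r),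
        (if gridTime T (n r) i < τ then φ r (X (gridTime T (n r) i) ω) else 0) *
          (B (gridTime T (n r) (i + 1)) ω - B (gridTime T (n r) i) ω)) atTop
      (𝓝 (itoIntegral 𝓕 P B T (fun u ω' => F (X u ω')) τ ω)) := by
  have hXm : ∀ t ≤ T, Measurable (X t) := fun t ht => (hX t ht).mono (𝓕.le t) le_rfl
  filter_upwards [tendstoUniformlyOn_itoIntegral hB (H := fun u ω' => F (X u ω'))
    (aemeasurable_comp_process hXc hXm hF) _ happ] with ω hω τ hτ
  have hex := fun r => gridElementary_integral_stopped (hX := hX) (hφ := hφ r) (hC := hC r)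
    (n := n r) (by have := hn r; omega) B τ hτ ω
  choose ρ hρT hτρ hρ hsum using hex
  simp_rw [hsum]
  -- Uniform convergence together with continuity of the limit allows the evaluation point `ρ r` to
  -- move towards `τ`. The null set was fixed before `τ`, so `τ` may depend on `ω` afterwards.
  refine hω.1.tendsto_comp (hω.2 τ ⟨zero_le, hτ⟩)
    (tendsto_nhdsWithin_iff.2 ⟨?_, Eventually.of_forall fun r => ⟨zero_le, hρT r⟩⟩)
  rw [← NNReal.tendsto_coe]
  have hnt : Tendsto n atTop atTop := tendsto_atTop_mono (fun r => (hn r).le) tendsto_id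
  have h0 : Tendsto (fun r => (τ : ℝ) + T / n r) atTop (𝓝 (τ + 0)) :=
    tendsto_const_nhds.add (tendsto_const_nhds.div_atTop (tendsto_natCast_atTop_atTop.comp hnt))
  rw [add_zero] at h0
  exact tendsto_of_tendsto_of_tendsto_of_le_of_le tendsto_const_nhds h0
    (fun r => by exact_mod_cast hτρ r) hρ

end Grid

end

/-! ### Integrating out independent vectors, and the exponential martingale on a grid. -/

noncomputable section

section ConditionalCharFun

variable {Ω : Type*} {mΩ : MeasurableSpace Ω} {P : Measure Ω} [IsProbabilityMeasure P]
  {E : Type*} [NormedAddCommGroup E] [InnerProductSpace ℝ E] [MeasurableSpace E] [BorelSpace E]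
  [SecondCountableTopology E]

/-- Integrating out an independent random vector from a complex exponential. -/
lemma integral_mul_exp_inner_of_indepFun {Y : Ω → ℂ} {g D : Ω → E} (hY : Measurable Y)
    (hg : Measurable g) (hD : AEMeasurable D P) {C : ℝ} (hC : ∀ ω, ‖Y ω‖ ≤ C)
    (h : IndepFun (fun ω => (Y ω, g ω)) D P) :
    ∫ ω, Y ω * Complex.exp (inner ℝ (D ω) (g ω) * Complex.I) ∂P
      = ∫ ω, Y ω * charFun (P.map D) (g ω) ∂P := by
  have hYg : Measurable fun ω => (Y ω, g ω) := hY.prodMk hg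
  have hprod := (indepFun_iff_map_prod_eq_prod_map_map hYg.aemeasurable hD).1 h
  set ψ : (ℂ × E) × E → ℂ := fun p =>
    p.1.1 * Complex.exp (inner ℝ p.2 p.1.2 * Complex.I) with hψ
  have mψ : Measurable ψ := by
    have : Continuous ψ := by fun_prop
    exact this.measurable
  have : IsProbabilityMeasure (P.map D) := Measure.isProbabilityMeasure_map hD
  have : IsProbabilityMeasure (P.map fun ω => (Y ω, g ω)) :=
    Measure.isProbabilityMeasure_map hYg.aemeasurable
  have hpair : AEMeasurable (fun ω => ((Y ω, g ω), D ω)) P := hYg.aemeasurable.prodMk hD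
  have hint : Integrable ψ ((P.map fun ω => (Y ω, g ω)).prod (P.map D)) := by
    rw [← hprod, integrable_map_measure mψ.aestronglyMeasurable hpair]
    refine Integrable.of_bound (mψ.comp_aemeasurable hpair).aestronglyMeasurable C
      (ae_of_all _ fun ω => ?_)
    simpa [hψ, Complex.norm_exp_ofReal_mul_I] using hC ω
  have h1 : ∫ ω, Y ω * Complex.exp (inner ℝ (D ω) (g ω) * Complex.I) ∂P
      = ∫ p, ψ p ∂((P.map fun ω => (Y ω, g ω)).prod (P.map D)) := by
    rw [← hprod, integral_map hpair mψ.aestronglyMeasurable]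
  rw [h1, integral_prod _ hint, integral_map hYg.aemeasurable
    hint.aestronglyMeasurable.integral_prod_right']
  refine integral_congr_ae (ae_of_all _ fun ω => ?_)
  simp only [hψ]
  rw [integral_const_mul, charFun_apply]

end ConditionalCharFun

namespace IsFilteredBrownian

variable {Ω : Type*} {mΩ : MeasurableSpace Ω} {𝓕 : Filtration ℝ≥0 mΩ} {P : Measure Ω} {d : ℕ}
  {W : ℝ≥0 → Ω → EuclideanSpace ℝ (Fin d)}

lemma component (hW : IsFilteredBrownian 𝓕 P W) (j : Fin d) :
    IsFilteredBrownianReal 𝓕 P (fun t ω => W t ω j) where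
  adapted t := (by fun_prop : Measurable fun x : EuclideanSpace ℝ (Fin d) => x j).comp (hW.adapted t)
  isBrownian := hW.isBrownian j
  indep_increments s t hst := by
    refine indep_of_indep_of_le_left (hW.indep_increments s t hst) ?_
    have : (fun ω => W t ω j - W s ω j) = (fun x : EuclideanSpace ℝ (Fin d) => x j) ∘
        fun ω => W t ω - W s ω := by ext ω; simp
    rw [this, ← MeasurableSpace.comap_comp]
    exact MeasurableSpace.comap_mono
      (by fun_prop : Measurable fun x : EuclideanSpace ℝ (Fin d) => x j).comap_le

lemma measurable (hW : IsFilteredBrownian 𝓕 P W) (t : ℝ≥0) : Measurable (W t) :=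
  (hW.adapted t).mono (𝓕.le t) le_rfl

lemma charFun_sub [IsProbabilityMeasure P] (hW : IsFilteredBrownian 𝓕 P W) {s t : ℝ≥0}
    (hst : s ≤ t) (θ : EuclideanSpace ℝ (Fin d)) :
    charFun (P.map fun ω => W t ω - W s ω) θ
      = Complex.exp (-((t - s : ℝ) * ‖θ‖ ^ 2 / 2 : ℝ)) := by
  have hind : iIndepFun (fun i ω => W t ω i - W s ω i) P :=
    hW.indep_components.comp (fun _ (x : ℝ≥0 → ℝ) => x t - x s) (fun _ => by fun_prop)
  have h := (iIndepFun_iff_charFun_pi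
    (fun i => ((hW.component i).measurable_sub s t).aemeasurable)).1 hind θ
  have e : (fun ω => WithLp.toLp 2 fun i => W t ω i - W s ω i) = fun ω => W t ω - W s ω := by
    ext ω i; simp
  rw [e] at h
  rw [h]
  have hc : ∀ i, charFun (P.map fun ω => W t ω i - W s ω i) (θ i)
      = Complex.exp (-((t - s : ℝ) * θ i ^ 2 / 2 : ℝ)) := by
    intro i
    rw [((hW.component i).hasLaw_sub s t).map_eq, charFun_gaussianReal]
    have : (s : ℝ) ≤ t := by exact_mod_cast hst
    congr 1
    simp [Real.dist_eq, abs_of_nonneg (sub_nonneg.2 this)]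
  rw [Finset.prod_congr rfl fun i _ => hc i, ← Complex.exp_sum]
  congr 1
  rw [EuclideanSpace.real_norm_sq_eq]
  push_cast
  rw [Finset.mul_sum, Finset.sum_div, Finset.sum_neg_distrib]

/-- The exponential martingale along a deterministic time grid. -/
lemma integral_exp_sum_inner [IsProbabilityMeasure P] (hW : IsFilteredBrownian 𝓕 P W)
    (t : ℕ → ℝ≥0) (ht : Monotone t) (g : ℕ → Ω → EuclideanSpace ℝ (Fin d)) (n : ℕ)
    (hg : ∀ i < n, Measurable[𝓕 (t i)] (g i)) {C : ℝ} (hC : ∀ i ω, ‖g i ω‖ ≤ C) :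
    ∫ ω, Complex.exp ((∑ i ∈ Finset.range n, inner ℝ (W (t (i + 1)) ω - W (t i) ω) (g i ω) : ℝ)
        * Complex.I + ((∑ i ∈ Finset.range n, (t (i + 1) - t i : ℝ) * ‖g i ω‖ ^ 2) / 2 : ℝ)) ∂P
      = 1 := by
  induction n with
  | zero => simp
  | succ n ih =>
    rw [← ih fun i hi => hg i (hi.trans n.lt_succ_self)]
    have hmg : ∀ i < n, Measurable[𝓕 (t n)] (g i) := fun i hi =>
      (hg i (hi.trans n.lt_succ_self)).mono (𝓕.mono (ht hi.le)) le_rfl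
    have hmgn : Measurable[𝓕 (t n)] (g n) := hg n n.lt_succ_self
    set A : Ω → ℝ := fun ω =>
      ∑ i ∈ Finset.range n, inner ℝ (W (t (i + 1)) ω - W (t i) ω) (g i ω) with hA
    set Q : Ω → ℝ := fun ω => ∑ i ∈ Finset.range n, (t (i + 1) - t i : ℝ) * ‖g i ω‖ ^ 2 with hQ
    have mA : Measurable[𝓕 (t n)] A := by
      refine Finset.measurable_sum _ fun i hi => ?_
      have hi := Finset.mem_range.1 hi
      exact (((hW.adapted _).mono (𝓕.mono (ht (Nat.succ_le_of_lt hi))) le_rfl).sub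
        ((hW.adapted _).mono (𝓕.mono (ht hi.le)) le_rfl)).inner (hmg i hi)
    have mQ : Measurable[𝓕 (t n)] Q := by
      refine Finset.measurable_sum _ fun i hi => ?_
      exact ((measurable_norm.comp (hmg i (Finset.mem_range.1 hi))).pow_const 2).const_mul _
    set δ : ℝ := t (n + 1) - t n with hδ
    have hδ0 : ∀ i, (0 : ℝ) ≤ t (i + 1) - t i := fun i =>
      sub_nonneg.2 (by exact_mod_cast ht (Nat.le_succ i))
    -- The compensator of the last cell is included in `Y`: it depends only on `g n`, so it is known
    -- at time `t n`. The last increment is then integrated out, and its characteristic function at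
    -- `g n` cancels exactly this compensator.
    set Y : Ω → ℂ := fun ω => Complex.exp ((A ω : ℝ) * Complex.I +
      ((Q ω + δ * ‖g n ω‖ ^ 2) / 2 : ℝ)) with hY
    have mY : Measurable[𝓕 (t n)] Y := by
      refine Complex.measurable_exp.comp (((Complex.measurable_ofReal.comp mA).mul_const _).add
        (Complex.measurable_ofReal.comp ?_))
      exact (mQ.add (((measurable_norm.comp hmgn).pow_const 2).const_mul _)).div_const _
    have hYb : ∀ ω, ‖Y ω‖ ≤ Real.exp
        ((∑ i ∈ Finset.range n, (t (i + 1) - t i : ℝ) * C ^ 2 + δ * C ^ 2) / 2) := by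
      intro ω
      rw [hY, Complex.norm_exp]
      simp only [Complex.add_re, Complex.mul_re, Complex.ofReal_re, Complex.I_re, mul_zero,
        Complex.ofReal_im, Complex.I_im, mul_one, sub_self, zero_add]
      have hsq : ∀ i, ‖g i ω‖ ^ 2 ≤ C ^ 2 := fun i =>
        pow_le_pow_left₀ (norm_nonneg _) (hC i ω) 2
      have h1 : Q ω ≤ ∑ i ∈ Finset.range n, (t (i + 1) - t i : ℝ) * C ^ 2 :=
        Finset.sum_le_sum fun i _ => mul_le_mul_of_nonneg_left (hsq i) (hδ0 i)
      have h2 : δ * ‖g n ω‖ ^ 2 ≤ δ * C ^ 2 := mul_le_mul_of_nonneg_left (hsq n) (hδ0 n)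
      gcongr
    have hind : IndepFun (fun ω => (Y ω, g n ω)) (fun ω => W (t (n + 1)) ω - W (t n) ω) P := by
      rw [IndepFun_iff_Indep]
      exact indep_of_indep_of_le_left (hW.indep_increments _ _ (ht (Nat.le_succ n))).symm
        (mY.prodMk hmgn).comap_le
    have h := integral_mul_exp_inner_of_indepFun (mY.mono (𝓕.le _) le_rfl)
      (hmgn.mono (𝓕.le _) le_rfl) ((hW.measurable _).sub (hW.measurable _)).aemeasurable hYb hind
    have h1 : ∀ ω, Complex.exp ((∑ i ∈ Finset.range (n + 1),
        inner ℝ (W (t (i + 1)) ω - W (t i) ω) (g i ω) : ℝ) * Complex.I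
        + ((∑ i ∈ Finset.range (n + 1), (t (i + 1) - t i : ℝ) * ‖g i ω‖ ^ 2) / 2 : ℝ))
        = Y ω * Complex.exp (inner ℝ (W (t (n + 1)) ω - W (t n) ω) (g n ω) * Complex.I) := by
      intro ω
      rw [Finset.sum_range_succ, Finset.sum_range_succ, hY, ← Complex.exp_add]
      congr 1
      simp only [hA, hQ, hδ]
      push_cast
      ring
    simp_rw [h1]
    rw [show (∫ ω, Y ω * Complex.exp (inner ℝ (W (t (n + 1)) ω - W (t n) ω) (g n ω)
      * Complex.I) ∂P) = _ from h]
    refine integral_congr_ae (ae_of_all _ fun ω => ?_)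
    simp only
    rw [show P.map (W (t (n + 1)) - W (t n))
      = P.map (fun ω => W (t (n + 1)) ω - W (t n) ω) from rfl,
      hW.charFun_sub (s := t n) (t := t (n + 1)) (ht (Nat.le_succ n)), hY, ← Complex.exp_add]
    congr 1
    change _ = ((A ω : ℝ) : ℂ) * Complex.I + ((Q ω / 2 : ℝ) : ℂ)
    simp only [hδ]
    push_cast
    ring

end IsFilteredBrownian

end

noncomputable section

/-! ### Time integrals along continuous paths. -/

section Occupation

variable {Ω : Type*} {m : MeasurableSpace Ω} {E : Type*} [TopologicalSpace E]
  [TopologicalSpace.PseudoMetrizableSpace E] [MeasurableSpace E] [BorelSpace E]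
  {X : ℝ≥0 → Ω → E} {T : ℝ≥0} {F : Type*} [NormedAddCommGroup F] [NormedSpace ℝ F]
  [MeasurableSpace F] [BorelSpace F] [SecondCountableTopology F]

/-- Path regularity is available only on `[0, T]`; freezing the path at `u` gives a process defined
for all times without changing the integral. -/
lemma intervalIntegral_comp_eq_stopped (f : E → F) {t u : ℝ≥0} (htu : t ≤ u) (ω : Ω) :
    ∫ s in (0 : ℝ)..t, f (X s.toNNReal ω) = ∫ s in (0 : ℝ)..t, f (X (min s.toNNReal u) ω) := by
  refine intervalIntegral.integral_congr fun s hs => ?_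
  rw [Set.uIcc_of_le t.coe_nonneg] at hs
  rw [min_eq_left ((Real.toNNReal_le_iff_le_coe.2 hs.2).trans htu)]

lemma measurable_intervalIntegral_comp
    (hXc : ∀ ω, ContinuousOn (fun t => X t ω) (Set.Icc 0 T)) {t : ℝ≥0} (ht : t ≤ T)
    (hm : ∀ s ≤ t, Measurable (X s)) {f : E → F} (hf : Measurable f) :
    Measurable (fun ω => ∫ s in (0 : ℝ)..t, f (X s.toNNReal ω)) := by
  simp_rw [intervalIntegral_comp_eq_stopped f (le_refl t),
    intervalIntegral.integral_of_le t.coe_nonneg]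
  have h : StronglyMeasurable (Function.uncurry fun ω (s : ℝ) => f (X (min s.toNNReal t) ω)) :=
    (hf.comp ((measurable_stopped hXc ht hm).comp measurable_swap)).stronglyMeasurable
  exact h.integral_prod_right.measurable

lemma measurable_path_stopped (hXc : ∀ ω, ContinuousOn (fun t => X t ω) (Set.Icc 0 T)) (ω : Ω) :
    Continuous (fun s : ℝ => X (min s.toNNReal T) ω) :=
  (hXc ω).comp_continuous (by fun_prop) fun s => ⟨zero_le, min_le_right _ _⟩

lemma intervalIntegrable_comp_stopped (hXc : ∀ ω, ContinuousOn (fun t => X t ω) (Set.Icc 0 T))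
    {f : E → F} (hf : Measurable f) {C : ℝ} (hC : ∀ x, ‖f x‖ ≤ C) (ω : Ω) (a b : ℝ) :
    IntervalIntegrable (fun s : ℝ => f (X (min s.toNNReal T) ω)) volume a b := by
  rw [intervalIntegrable_iff]
  exact Measure.integrableOn_of_bounded (M := C) (by simp)
    (hf.comp (measurable_path_stopped hXc ω).measurable).aestronglyMeasurable
    (ae_of_all _ fun _ => hC _)

lemma continuous_intervalIntegral_stopped
    (hXc : ∀ ω, ContinuousOn (fun t => X t ω) (Set.Icc 0 T))
    {f : E → F} (hf : Measurable f) {C : ℝ} (hC : ∀ x, ‖f x‖ ≤ C) (ω : Ω) :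
    Continuous (fun t : ℝ≥0 => ∫ s in (0 : ℝ)..t, f (X (min s.toNNReal T) ω)) :=
  (intervalIntegral.continuous_primitive
    (fun a b => intervalIntegrable_comp_stopped hXc hf hC ω a b) 0).comp NNReal.continuous_coe

lemma continuousOn_intervalIntegral_comp
    (hXc : ∀ ω, ContinuousOn (fun t => X t ω) (Set.Icc 0 T))
    {f : E → F} (hf : Measurable f) {C : ℝ} (hC : ∀ x, ‖f x‖ ≤ C) (ω : Ω) :
    ContinuousOn (fun t : ℝ≥0 => ∫ s in (0 : ℝ)..t, f (X s.toNNReal ω)) (Set.Icc 0 T) :=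
  (continuous_intervalIntegral_stopped hXc hf hC ω).continuousOn.congr
    fun _ ht => intervalIntegral_comp_eq_stopped f ht.2 ω

/-- The primitive is continuous in its upper limit and measurable in `ω`, hence jointly measurable,
and a measurable random time may be substituted. -/
lemma measurable_intervalIntegral_comp_random
    (hXc : ∀ ω, ContinuousOn (fun t => X t ω) (Set.Icc 0 T))
    (hm : ∀ s ≤ T, Measurable (X s)) {f : E → F} (hf : Measurable f) {C : ℝ}
    (hC : ∀ x, ‖f x‖ ≤ C) {τ : Ω → ℝ≥0} (hτ : Measurable τ) (hτT : ∀ ω, τ ω ≤ T) :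
    Measurable (fun ω => ∫ s in (0 : ℝ)..τ ω, f (X s.toNNReal ω)) := by
  rw [show (fun ω => ∫ s in (0 : ℝ)..τ ω, f (X s.toNNReal ω))
    = fun ω => ∫ s in (0 : ℝ)..τ ω, f (X (min s.toNNReal T) ω) from
    funext fun ω => intervalIntegral_comp_eq_stopped f (hτT ω) ω]
  have hpt : ∀ t : ℝ≥0, Measurable (fun ω => ∫ s in (0 : ℝ)..t, f (X (min s.toNNReal T) ω)) := by
    intro t
    simp_rw [intervalIntegral.integral_of_le t.coe_nonneg]
    have h : StronglyMeasurable (Function.uncurry fun ω (s : ℝ) => f (X (min s.toNNReal T) ω)) :=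
      (hf.comp ((measurable_stopped hXc le_rfl hm).comp measurable_swap)).stronglyMeasurable
    exact h.integral_prod_right.measurable
  exact (measurable_uncurry_of_continuous_of_measurable
    (u := fun (t : ℝ≥0) ω => ∫ s in (0 : ℝ)..t, f (X (min s.toNNReal T) ω))
    (fun ω => continuous_intervalIntegral_stopped hXc hf hC ω) hpt).comp (hτ.prodMk measurable_id)

end Occupation

/-! ### Hitting times of closed half-lines by continuous processes. -/

section HittingTime

variable {Ω : Type*} {T : ℝ≥0} {N : ℝ≥0 → Ω → ℝ} {c : ℝ}

/-- The set of hitting instants is closed, so its infimum is attained. A value below `T` excludes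
the default value that `hittingBtwn` takes when there is no hit. -/
lemma mem_of_hittingBtwn_lt (hNc : ∀ ω, ContinuousOn (fun t => N t ω) (Set.Icc 0 T)) {ω : Ω}
    (h : hittingBtwn N (Set.Ici c) 0 T ω < T) : c ≤ N (hittingBtwn N (Set.Ici c) 0 T ω) ω := by
  have hex : ∃ j ∈ Set.Icc 0 T, N j ω ∈ Set.Ici c := by
    by_contra hcon
    rw [hittingBtwn, if_neg hcon] at h
    exact lt_irrefl _ h
  have hcl : IsClosed (Set.Icc 0 T ∩ {i | N i ω ∈ Set.Ici c}) :=
    (hNc ω).preimage_isClosed_of_isClosed isClosed_Icc isClosed_Ici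
  rw [hittingBtwn, if_pos hex]
  obtain ⟨j, hj, hj'⟩ := hex
  exact (hcl.csInf_mem ⟨j, hj, hj'⟩ (OrderBot.bddBelow _)).2

lemma lt_hittingBtwn_iff (hNc : ∀ ω, ContinuousOn (fun t => N t ω) (Set.Icc 0 T)) {t : ℝ≥0}
    (ht : t < T) (ω : Ω) :
    t < hittingBtwn N (Set.Ici c) 0 T ω ↔ ∀ s ≤ t, N s ω < c := by
  constructor
  · intro h s hs
    exact not_le.1 (notMem_of_lt_hittingBtwn (hs.trans_lt h) zero_le)
  · intro h
    by_contra hcon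
    have hle := not_lt.1 hcon
    exact absurd (mem_of_hittingBtwn_lt hNc (hle.trans_lt ht)) (not_le.2 (h _ hle))

/-- Before the hitting time the process is below `c`, and left continuity carries the bound to the
hitting time. When that time is `0` there is no earlier instant, hence the hypothesis on `N 0`. -/
lemma apply_hittingBtwn_le (hNc : ∀ ω, ContinuousOn (fun t => N t ω) (Set.Icc 0 T)) (ω : Ω)
    (h0 : N 0 ω ≤ c) : N (hittingBtwn N (Set.Ici c) 0 T ω) ω ≤ c := by
  set τ := hittingBtwn N (Set.Ici c) 0 T ω with hτ
  have hτT : τ ≤ T := hittingBtwn_le ω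
  rcases eq_zero_or_pos τ with h | h
  · rwa [h]
  · have hcont : ContinuousWithinAt (fun t => N t ω) (Set.Ico 0 τ) τ :=
      ((hNc ω) τ ⟨zero_le, hτT⟩).mono fun s hs => ⟨hs.1, hs.2.le.trans hτT⟩
    have hmem : τ ∈ closure (Set.Ico 0 τ) := by
      rw [closure_Ico h.ne]; exact ⟨zero_le, le_rfl⟩
    have := mem_closure_iff_nhdsWithin_neBot.1 hmem
    refine le_of_tendsto hcont ?_
    filter_upwards [self_mem_nhdsWithin] with s hs
    have hlt : s < hittingBtwn N (Set.Ici c) 0 T ω := hs.2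
    exact (not_le.1 fun hh => notMem_of_lt_hittingBtwn hlt zero_le hh).le

/-- Not having hit by time `t` means staying below `c` on the compact interval `[0, t]`, hence below
`c` by a uniform margin, and this can be tested on a countable dense set. The event therefore lies
in the `σ`-algebra at time `t` itself, without right-continuity of the filtration. -/
lemma measurableSet_lt_hittingBtwn {m : MeasurableSpace Ω}
    (hNc : ∀ ω, ContinuousOn (fun t => N t ω) (Set.Icc 0 T)) {t : ℝ≥0} (ht : t < T)
    (hm : ∀ s ≤ t, Measurable (N s)) :
    MeasurableSet {ω | t < hittingBtwn N (Set.Ici c) 0 T ω} := by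
  obtain ⟨D, hDc, hD⟩ := TopologicalSpace.exists_countable_dense (Set.Icc (0 : ℝ≥0) t)
  have hset : {ω | t < hittingBtwn N (Set.Ici c) 0 T ω}
      = ⋃ k : ℕ, ⋂ s ∈ D, {ω | N s ω ≤ c - 1 / (k + 1)} := by
    ext ω
    have hct : ContinuousOn (fun s => N s ω) (Set.Icc 0 t) :=
      (hNc ω).mono (Set.Icc_subset_Icc_right ht.le)
    simp only [Set.mem_ofPred_eq, lt_hittingBtwn_iff hNc ht, Set.mem_iUnion, Set.mem_iInter]
    constructor
    · intro h
      obtain ⟨s₀, hs₀, hmax⟩ := isCompact_Icc.exists_isMaxOn ⟨0, le_rfl, zero_le⟩ hct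
      obtain ⟨k, hk⟩ := exists_nat_one_div_lt (sub_pos.2 (h s₀ hs₀.2))
      refine ⟨k, fun s _ => ?_⟩
      have h1 : N s ω ≤ N s₀ ω := hmax s.2
      linarith
    · rintro ⟨k, hk⟩ s hs
      have hcl : IsClosed {s : Set.Icc (0 : ℝ≥0) t | N s ω ≤ c - 1 / (k + 1)} :=
        isClosed_le hct.domRestrict continuous_const
      have hall : (⟨s, zero_le, hs⟩ : Set.Icc (0 : ℝ≥0) t) ∈
          {s : Set.Icc (0 : ℝ≥0) t | N s ω ≤ c - 1 / (k + 1)} :=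
        hcl.closure_subset_iff.2 hk (hD _)
      have hpos : (0 : ℝ) < 1 / (k + 1) := by positivity
      have : N s ω ≤ c - 1 / (k + 1) := hall
      linarith
  rw [hset]
  exact MeasurableSet.iUnion fun k => MeasurableSet.biInter hDc fun s _ =>
    measurableSet_le (hm s s.2.2) measurable_const

lemma measurable_hittingBtwn {m : MeasurableSpace Ω}
    (hNc : ∀ ω, ContinuousOn (fun t => N t ω) (Set.Icc 0 T)) (hm : ∀ s ≤ T, Measurable (N s)) :
    Measurable (hittingBtwn N (Set.Ici c) 0 T) := by
  refine measurable_of_Ioi fun t => ?_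
  rcases lt_or_ge t T with h | h
  · exact measurableSet_lt_hittingBtwn hNc h fun s hs => hm s (hs.trans h.le)
  · have : hittingBtwn N (Set.Ici c) 0 T ⁻¹' Set.Ioi t = ∅ := by
      ext ω
      simpa using (hittingBtwn_le ω).trans h
    rw [this]
    exact MeasurableSet.empty

end HittingTime

/-! ### Continuity and measurability of matrix functionals. -/

section Matrices

variable {ι : Type*} [Fintype ι] [DecidableEq ι]

lemma continuous_toEuclideanCLM :
    Continuous (fun A : Matrix ι ι ℝ => Matrix.toEuclideanCLM (𝕜 := ℝ) A) :=
  LinearMap.continuous_of_finiteDimensional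
    (Matrix.toEuclideanCLM (n := ι) (𝕜 := ℝ)).toAlgEquiv.toLinearMap

lemma continuous_matrixOpNorm : Continuous (matrixOpNorm (ι := ι)) :=
  continuous_norm.comp continuous_toEuclideanCLM

lemma continuousOn_matrix_sqrt :
    ContinuousOn (CFC.sqrt : Matrix ι ι ℝ → Matrix ι ι ℝ) {A | 0 ≤ A} := by
  open scoped Matrix.Norms.L2Operator in
  exact CFC.continuousOn_sqrt

lemma measurable_of_continuousOn_matrix {Ω : Type*} {m : MeasurableSpace Ω} {F : Type*}
    [TopologicalSpace F] [MeasurableSpace F] [BorelSpace F] {f : Matrix ι ι ℝ → F}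
    {K : Set (Matrix ι ι ℝ)} (hf : ContinuousOn f K) {A : Ω → Matrix ι ι ℝ}
    (hA : ∀ k l, Measurable fun ω => A ω k l) (hK : ∀ ω, A ω ∈ K) :
    Measurable (fun ω => f (A ω)) := by
  -- Continuity holds only on `K`, so the random matrix is factored through the subtype, with
  -- matrices seen as plain functions carrying the product `σ`-algebra.
  let K' : Set (ι → ι → ℝ) := K
  have hA' : Measurable (fun ω => (⟨A ω, hK ω⟩ : K')) :=
    Measurable.subtype_mk (f := fun ω => (A ω : ι → ι → ℝ))
      (measurable_pi_iff.2 fun k => measurable_pi_iff.2 fun l => hA k l)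
  have hc : Continuous (fun B : K' => f B.1) := hf.domRestrict
  exact hc.measurable.comp hA'

end Matrices

end

/-! ### Matrix square roots and positive semidefiniteness. -/

noncomputable section

section PosSemidef

variable {ι : Type*} [Fintype ι] [DecidableEq ι]

lemma Matrix.PosDef.inv_sqrt_mul_sqrt {J : Matrix ι ι ℝ} (hJ : J.PosDef) :
    (CFC.sqrt J)⁻¹ * CFC.sqrt J = 1 := by
  have hu : IsUnit (CFC.sqrt J) := (CFC.isUnit_sqrt_iff J hJ.posSemidef.nonneg).2 hJ.isUnit
  exact Matrix.nonsing_inv_mul _ ((Matrix.isUnit_iff_isUnit_det _).1 hu)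

lemma Matrix.PosDef.sqrt_mul_inv_sqrt {J : Matrix ι ι ℝ} (hJ : J.PosDef) :
    CFC.sqrt J * (CFC.sqrt J)⁻¹ = 1 := by
  have hu : IsUnit (CFC.sqrt J) := (CFC.isUnit_sqrt_iff J hJ.posSemidef.nonneg).2 hJ.isUnit
  exact Matrix.mul_nonsing_inv _ ((Matrix.isUnit_iff_isUnit_det _).1 hu)

lemma isHermitian_sqrt (J : Matrix ι ι ℝ) : (CFC.sqrt J).IsHermitian :=
  (Matrix.nonneg_iff_posSemidef.1 (CFC.sqrt_nonneg J)).isHermitian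

/-- If the normalised matrix has operator norm at most `t`, then `J - t⁻¹ A` is positive
semidefinite. -/
lemma posSemidef_sub_of_matrixOpNorm_le {J A : Matrix ι ι ℝ} (hJ : J.PosDef) (hA : A.IsHermitian)
    {t : ℝ} (ht : 0 < t) (h : matrixOpNorm ((CFC.sqrt J)⁻¹ * A * (CFC.sqrt J)⁻¹) ≤ t) :
    (J - t⁻¹ • A).PosSemidef := by
  set S := CFC.sqrt J with hS
  set R := S⁻¹ * A * S⁻¹ with hR
  have hSH : S.IsHermitian := isHermitian_sqrt J
  have hSS : S * S = J := CFC.sqrt_mul_sqrt_self J hJ.posSemidef.nonneg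
  have hRH : R.IsHermitian := by
    rw [Matrix.IsHermitian, hR, Matrix.conjTranspose_mul, Matrix.conjTranspose_mul,
      Matrix.conjTranspose_nonsing_inv, hSH.eq, hA.eq, Matrix.mul_assoc]
  -- By Cauchy-Schwarz `⟨x, R x⟩ ≤ ‖R‖ ‖x‖² ≤ t ‖x‖²`. Conjugating by `S = J^{1/2}` then turns `1 -
  -- t⁻¹ R` into `J - t⁻¹ A`.
  have hB : (1 - t⁻¹ • R).PosSemidef := by
    refine Matrix.PosSemidef.of_dotProduct_mulVec_nonneg ?_ fun x => ?_
    · refine Matrix.isHermitian_one.sub ?_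
      rw [Matrix.IsHermitian, Matrix.conjTranspose_smul, hRH.eq]; simp
    · have h1 := Matrix.inner_toEuclideanCLM R (WithLp.toLp 2 x) (WithLp.toLp 2 x)
      have h2 : inner ℝ (WithLp.toLp 2 x) (Matrix.toEuclideanCLM (𝕜 := ℝ) R (WithLp.toLp 2 x))
          ≤ t * ‖WithLp.toLp 2 x‖ ^ 2 := by
        refine (real_inner_le_norm _ _).trans ?_
        have h3 := (Matrix.toEuclideanCLM (𝕜 := ℝ) R).le_opNorm (WithLp.toLp 2 x)
        have h4 : ‖Matrix.toEuclideanCLM (𝕜 := ℝ) R‖ ≤ t := h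
        nlinarith [norm_nonneg (WithLp.toLp 2 x), mul_le_mul_of_nonneg_right h4
          (norm_nonneg (WithLp.toLp 2 x))]
      have h5 : ‖WithLp.toLp 2 x‖ ^ 2 = x ⬝ᵥ x := by
        rw [EuclideanSpace.real_norm_sq_eq]
        simp [dotProduct, sq]
      rw [h1, h5] at h2
      simp only [star_trivial, Matrix.sub_mulVec, Matrix.one_mulVec, dotProduct_sub,
        Matrix.smul_mulVec, dotProduct_smul, smul_eq_mul]
      have : t⁻¹ * (x ⬝ᵥ R.mulVec x) ≤ t⁻¹ * (t * (x ⬝ᵥ x)) :=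
        mul_le_mul_of_nonneg_left h2 (inv_pos.2 ht).le
      rw [inv_mul_cancel_left₀ ht.ne'] at this
      linarith
  have e : J - t⁻¹ • A = S.conjTranspose * (1 - t⁻¹ • R) * S := by
    rw [hSH.eq, Matrix.mul_sub, Matrix.sub_mul, Matrix.mul_one, hSS, Matrix.mul_smul,
      Matrix.smul_mul, hR]
    congr 2
    have h1 : S * S⁻¹ = 1 := hJ.sqrt_mul_inv_sqrt
    have h2 : S⁻¹ * S = 1 := hJ.inv_sqrt_mul_sqrt
    calc A = (S * S⁻¹) * A * (S⁻¹ * S) := by rw [h1, h2]; simp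
      _ = _ := by simp only [Matrix.mul_assoc]
  rw [e]
  exact hB.conjTranspose_mul_mul_same S

/-- The quadratic form of a symmetric square root. -/
lemma norm_sq_toEuclideanCLM_sqrt {A : Matrix ι ι ℝ} (hA : A.PosSemidef) (x : EuclideanSpace ℝ ι) :
    ‖Matrix.toEuclideanCLM (𝕜 := ℝ) (CFC.sqrt A) x‖ ^ 2 = x.ofLp ⬝ᵥ A.mulVec x.ofLp := by
  rw [← real_inner_self_eq_norm_sq, ← ContinuousLinearMap.adjoint_inner_right]
  have h1 : ContinuousLinearMap.adjoint (Matrix.toEuclideanCLM (𝕜 := ℝ) (CFC.sqrt A))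
      = Matrix.toEuclideanCLM (𝕜 := ℝ) (CFC.sqrt A) := by
    rw [← ContinuousLinearMap.star_eq_adjoint, ← map_star, Matrix.star_eq_conjTranspose,
      (isHermitian_sqrt A).eq]
  rw [h1, ← ContinuousLinearMap.comp_apply, ← ContinuousLinearMap.mul_def, ← map_mul,
    CFC.sqrt_mul_sqrt_self A hA.nonneg, Matrix.inner_toEuclideanCLM]

lemma inner_toEuclideanCLM_sqrt_left (A : Matrix ι ι ℝ) (x y : EuclideanSpace ℝ ι) :
    inner ℝ (Matrix.toEuclideanCLM (𝕜 := ℝ) (CFC.sqrt A) x) y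
      = inner ℝ x (Matrix.toEuclideanCLM (𝕜 := ℝ) (CFC.sqrt A) y) := by
  rw [← ContinuousLinearMap.adjoint_inner_right, ← ContinuousLinearMap.star_eq_adjoint, ← map_star,
    Matrix.star_eq_conjTranspose, (isHermitian_sqrt A).eq]

end PosSemidef

/-! ### The spatial grid and its cubes. -/

section GridPoints

variable {d : ℕ}

lemma finite_gridPoints (d : ℕ) (a : ℝ) {h : ℝ} (h0 : 0 < h) : Finite (gridPoints d a h) := by
  obtain ⟨M, hM⟩ := exists_nat_gt (a / h)
  have hz : ∀ (x : gridPoints d a h) (i : Fin d), ∃ z : Set.Icc (-(M : ℤ)) M, x.1 i = h * (z : ℤ) := by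
    intro x i
    obtain ⟨⟨z, hz⟩, h1, h2⟩ := x.2 i
    rw [div_lt_iff₀ h0] at hM
    have h3 : (z : ℝ) < M := by
      rw [hz] at h2; by_contra hcon; nlinarith [not_lt.1 hcon]
    have h4 : (-(M : ℝ)) < z := by
      rw [hz] at h1; by_contra hcon; nlinarith [not_lt.1 hcon]
    exact ⟨⟨z, by exact_mod_cast h4.le, by exact_mod_cast h3.le⟩, hz⟩
  choose z hz using hz
  refine Finite.of_injective z fun x y hxy => Subtype.ext ?_
  ext i
  rw [hz, hz, hxy]

/-- In each coordinate the two corners are integer multiples of `h`; a common point forces the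
integers to differ by less than one in both directions. -/
lemma subcube_disjoint {a h : ℝ} (hh : 0 < h) {p q : gridPoints d a h} (hpq : p ≠ q)
    (x : EuclideanSpace ℝ (Fin d)) : ¬ (x ∈ subcube h p.1 ∧ x ∈ subcube h q.1) := by
  rintro ⟨hp, hq⟩
  refine hpq (Subtype.ext ?_)
  ext i
  obtain ⟨⟨z, hz⟩, -⟩ := p.2 i
  obtain ⟨⟨w, hw⟩, -⟩ := q.2 i
  have h1 := hp i
  have h2 := hq i
  rw [hz] at h1 ⊢
  rw [hw] at h2 ⊢
  have hzw : z = w := by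
    have h3 : (z : ℝ) < w + 1 := by
      by_contra hcon; nlinarith [not_lt.1 hcon, h1.1, h2.2]
    have h4 : (w : ℝ) < z + 1 := by
      by_contra hcon; nlinarith [not_lt.1 hcon, h2.1, h1.2]
    have h3' : z < w + 1 := by exact_mod_cast h3
    have h4' : w < z + 1 := by exact_mod_cast h4
    omega
  rw [hzw]

lemma measurableSet_subcube (h : ℝ) (p : EuclideanSpace ℝ (Fin d)) :
    MeasurableSet (subcube h p) := by
  have : subcube h p = ⋂ i, (fun x : EuclideanSpace ℝ (Fin d) => x i) ⁻¹' Set.Ico (p i) (p i + h) := by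
    ext x; simp [subcube]
  rw [this]
  exact MeasurableSet.iInter fun i =>
    (by fun_prop : Measurable fun x : EuclideanSpace ℝ (Fin d) => x i) measurableSet_Ico

end GridPoints

/-! ### Local monomials and their continuous approximations. -/

section Monomials

variable {d s : ℕ}

lemma continuous_monomialVec (α : MultiIndex d s) : Continuous (monomialVec α) := by
  unfold monomialVec
  fun_prop

/-- A trapezoidal approximation of the indicator of `[0, h)`. -/
def trapezoid (h : ℝ) (k : ℕ) (y : ℝ) : ℝ := max 0 (min 1 (min (1 + k * y) (k * (h - y))))

lemma trapezoid_nonneg (h : ℝ) (k : ℕ) (y : ℝ) : 0 ≤ trapezoid h k y := le_max_left _ _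

lemma trapezoid_le_one (h : ℝ) (k : ℕ) (y : ℝ) : trapezoid h k y ≤ 1 :=
  max_le zero_le_one (min_le_left _ _)

lemma continuous_trapezoid (h : ℝ) (k : ℕ) : Continuous (trapezoid h k) := by
  unfold trapezoid
  fun_prop

/-- Both ramps lie to the left of the end points: the rising one reaches `1` at `0`, the falling one
reaches `0` at `h`. The limit is therefore `1` at `0` and `0` at `h`, as the half-open cubes demand.
-/
lemma tendsto_trapezoid (h y : ℝ) :
    Tendsto (fun k => trapezoid h k y) atTop (𝓝 ((Set.Ico 0 h).indicator 1 y)) := by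
  by_cases hy : y ∈ Set.Ico 0 h
  · rw [Set.indicator_of_mem hy]
    refine tendsto_const_nhds.congr' ?_
    obtain ⟨M, hM⟩ := exists_nat_gt (1 / (h - y))
    filter_upwards [eventually_ge_atTop M] with k hk
    have h1 : (1 : ℝ) ≤ k * (h - y) := by
      have hpos : 0 < h - y := sub_pos.2 hy.2
      have : 1 / (h - y) < k := hM.trans_le (by exact_mod_cast hk)
      exact ((div_lt_iff₀ hpos).1 this).le
    have h2 : (1 : ℝ) ≤ 1 + k * y := by
      have : (0 : ℝ) ≤ k * y := mul_nonneg k.cast_nonneg hy.1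
      linarith
    rw [trapezoid, min_eq_left (le_min h2 h1), max_eq_right zero_le_one, Pi.one_apply]
  · rw [Set.indicator_of_notMem hy]
    refine tendsto_const_nhds.congr' ?_
    rw [Set.mem_Ico, not_and_or, not_le, not_lt] at hy
    rcases hy with hy | hy
    · obtain ⟨M, hM⟩ := exists_nat_gt (1 / (-y))
      filter_upwards [eventually_ge_atTop M] with k hk
      have hpos : 0 < -y := neg_pos.2 hy
      have : 1 / (-y) < k := hM.trans_le (by exact_mod_cast hk)
      have h1 := (div_lt_iff₀ hpos).1 this
      refine (max_eq_left ?_).symm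
      exact (min_le_right _ _).trans ((min_le_left _ _).trans (by linarith))
    · filter_upwards with k
      refine (max_eq_left ?_).symm
      exact (min_le_right _ _).trans ((min_le_right _ _).trans
        (mul_nonpos_of_nonneg_of_nonpos k.cast_nonneg (by linarith)))

/-- `x ↦ 1_C(x) 𝐯_α(x - p)` is a boundedly pointwise limit of continuous functions. -/
lemma exists_tendsto_localMonomial {h : ℝ} (p : EuclideanSpace ℝ (Fin d)) (α : MultiIndex d s) :
    ∃ Φ : ℕ → EuclideanSpace ℝ (Fin d) → ℝ, (∀ k, Continuous (Φ k)) ∧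
      (∃ C : ℝ, ∀ k x, |Φ k x| ≤ C) ∧
      ∀ x, Tendsto (fun k => Φ k x) atTop (𝓝 (localMonomial h p α x)) := by
  -- This `C` bounds the monomial on the cube, so clamping the monomial to `[-C, C]` changes nothing
  -- there while making the approximations uniformly bounded.
  set C : ℝ := |∏ i : Fin d, h ^ (α.1 i : ℕ) / ((α.1 i : ℕ).factorial : ℝ)| with hC
  have hC0 : 0 ≤ C := abs_nonneg _
  refine ⟨fun k x => (∏ i, trapezoid h k (x i - p i)) *
    max (-C) (min C (monomialVec α (x - p))), fun k => ?_, ⟨C, fun k x => ?_⟩, fun x => ?_⟩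
  · refine Continuous.mul ?_ ?_
    · exact continuous_finsetProd _ fun i _ => (continuous_trapezoid h k).comp (by fun_prop)
    · have := (continuous_monomialVec α).comp (continuous_id.sub (continuous_const (y := p)))
      exact continuous_const.max (continuous_const.min this)
  · rw [abs_mul]
    have h1 : |∏ i, trapezoid h k (x i - p i)| ≤ 1 := by
      rw [abs_of_nonneg (Finset.prod_nonneg fun i _ => trapezoid_nonneg _ _ _)]
      exact Finset.prod_le_one (fun i _ => trapezoid_nonneg _ _ _) fun i _ => trapezoid_le_one _ _ _
    have h2 : |max (-C) (min C (monomialVec α (x - p)))| ≤ C :=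
      abs_le.2 ⟨le_max_left _ _, max_le (by linarith) (min_le_left _ _)⟩
    calc _ ≤ 1 * C := mul_le_mul h1 h2 (abs_nonneg _) zero_le_one
      _ = C := one_mul C
  · have hlim : Tendsto (fun k => (∏ i, trapezoid h k (x i - p i)) *
        max (-C) (min C (monomialVec α (x - p)))) atTop
        (𝓝 ((∏ i, (Set.Ico 0 h).indicator 1 (x i - p i)) *
        max (-C) (min C (monomialVec α (x - p))))) :=
      (tendsto_finsetProd _ fun i _ => tendsto_trapezoid h _).mul_const _
    convert hlim using 2
    by_cases hx : x ∈ subcube h p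
    · rw [localMonomial, Set.indicator_of_mem hx]
      have hmem : ∀ i, x i - p i ∈ Set.Ico 0 h := fun i =>
        ⟨sub_nonneg.2 (hx i).1, by linarith [(hx i).2]⟩
      have hb : |monomialVec α (x - p)| ≤ C := by
        rw [hC, monomialVec, Finset.abs_prod, Finset.abs_prod]
        refine Finset.prod_le_prod (fun i _ => abs_nonneg _) fun i _ => ?_
        rw [abs_div, abs_div, abs_pow, abs_pow]
        have : |(x - p) i| ≤ |h| := by
          rw [PiLp.sub_apply, abs_of_nonneg (hmem i).1]
          exact (hmem i).2.le.trans (le_abs_self h)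
        gcongr
      rw [Finset.prod_eq_one fun i _ => by rw [Set.indicator_of_mem (hmem i)]; rfl, one_mul,
        min_eq_right (abs_le.1 hb).2, max_eq_right (abs_le.1 hb).1]
    · rw [localMonomial, Set.indicator_of_notMem hx]
      have : ∃ i, x i - p i ∉ Set.Ico 0 h := by
        by_contra hcon
        push Not at hcon
        exact hx fun i => ⟨sub_nonneg.1 (hcon i).1, by linarith [(hcon i).2]⟩
      obtain ⟨i, hi⟩ := this
      rw [Finset.prod_eq_zero (Finset.mem_univ i) (Set.indicator_of_notMem hi _), zero_mul]

lemma measurable_localMonomial (h : ℝ) (p : EuclideanSpace ℝ (Fin d)) (α : MultiIndex d s) :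
    Measurable (localMonomial h p α) :=
  ((continuous_monomialVec α).comp (continuous_id.sub continuous_const)).measurable.indicator
    (measurableSet_subcube h p)

lemma exists_abs_localMonomial_le (h : ℝ) (p : EuclideanSpace ℝ (Fin d)) (α : MultiIndex d s) :
    ∃ C : ℝ, ∀ x, |localMonomial h p α x| ≤ C := by
  obtain ⟨Φ, -, ⟨C, hC⟩, hlim⟩ := exists_tendsto_localMonomial (h := h) p α
  exact ⟨C, fun x => le_of_tendsto' (hlim x).abs fun k => hC k x⟩

lemma localMonomial_mul_localMonomial_of_ne {a h : ℝ} (hh : 0 < h) {p q : gridPoints d a h}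
    (hpq : p ≠ q) (α α' : MultiIndex d s) (x : EuclideanSpace ℝ (Fin d)) :
    localMonomial h p.1 α x * localMonomial h q.1 α' x = 0 := by
  have := subcube_disjoint hh hpq x
  by_cases hx : x ∈ subcube h p.1
  · have hx' : x ∉ subcube h q.1 := fun hx' => this ⟨hx, hx'⟩
    simp [localMonomial, hx']
  · simp [localMonomial, hx]

/-- Since `1_C² = 1_C`, the entries of the occupation matrix are brackets of the score integrals. -/
lemma empInfoMatrix_apply {Ω : Type*} (h : ℝ) (X : ℝ≥0 → Ω → EuclideanSpace ℝ (Fin d))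
    (p : EuclideanSpace ℝ (Fin d)) (t : ℝ≥0) (ω : Ω) (k l : MultiIndex d s) :
    empInfoMatrix s h X p t ω k l = ∫ u in (0 : ℝ)..t,
      localMonomial h p k (X u.toNNReal ω) * localMonomial h p l (X u.toNNReal ω) := by
  simp only [empInfoMatrix, Matrix.of_apply, localMonomial]
  congr 1
  ext u
  by_cases hx : X u.toNNReal ω ∈ subcube h p <;> simp [hx]

end Monomials

end

/-! ### Positive definiteness of the information matrix. -/

noncomputable section

section InfoMatrix

variable {d s : ℕ}

/-- Monomials are linearly independent as functions on any open cube. -/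
lemma eq_zero_of_sum_monomialVec_eq_zero {h : ℝ} (hh : 0 < h) (c : MultiIndex d s → ℝ)
    (hc : ∀ y : EuclideanSpace ℝ (Fin d), (∀ i, y i ∈ Set.Ioo 0 h) →
      ∑ α, c α * monomialVec α y = 0) : c = 0 := by
  classical
  set e : MultiIndex d s → (Fin d →₀ ℕ) := fun α =>
    Finsupp.equivFunOnFinite.symm fun i => (α.1 i : ℕ) with he
  have he_inj : Function.Injective e := by
    intro α β hαβ
    refine Subtype.ext (funext fun i => Fin.ext ?_)
    have := DFunLike.congr_fun hαβ i
    simpa [he] using this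
  set p : MvPolynomial (Fin d) ℝ := ∑ α, MvPolynomial.monomial (e α)
    (c α * ∏ i, (((α.1 i : ℕ).factorial : ℝ))⁻¹) with hp
  have hp0 : p = 0 := by
    -- A polynomial that vanishes on a product of infinite sets is zero.
    refine MvPolynomial.funext_set (fun _ => Set.Ioo 0 h) (fun _ => Set.Ioo_infinite hh) ?_
    intro x hx
    rw [map_zero, ← hc (WithLp.toLp 2 x) (fun i => hx i (Set.mem_univ i)), hp, map_sum]
    refine Finset.sum_congr rfl fun α _ => ?_
    rw [MvPolynomial.eval_monomial, Finsupp.prod_fintype _ _ (fun _ => pow_zero _), monomialVec,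
      mul_assoc, ← Finset.prod_mul_distrib]
    congr 1
    refine Finset.prod_congr rfl fun i _ => ?_
    simp [he, div_eq_inv_mul]
  ext α
  have h1 : MvPolynomial.coeff (e α) p = c α * ∏ i, (((α.1 i : ℕ).factorial : ℝ))⁻¹ := by
    rw [hp, MvPolynomial.coeff_sum, Finset.sum_eq_single α]
    · simp
    · intro β _ hβ
      rw [MvPolynomial.coeff_monomial, if_neg (fun hh => hβ (he_inj hh))]
    · simp
  rw [hp0, MvPolynomial.coeff_zero] at h1
  have h2 : (∏ i, (((α.1 i : ℕ).factorial : ℝ))⁻¹) ≠ 0 :=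
    Finset.prod_ne_zero_iff.2 fun i _ => inv_ne_zero (by positivity)
  exact (mul_eq_zero.1 h1.symm).resolve_right h2

lemma integrableOn_subcube {f : EuclideanSpace ℝ (Fin d) → ℝ} (hf : Continuous f) (h : ℝ)
    (p : EuclideanSpace ℝ (Fin d)) : IntegrableOn f (subcube h p) := by
  have hK : IsCompact ((WithLp.toLp 2 : (Fin d → ℝ) → EuclideanSpace ℝ (Fin d)) ''
      Set.Icc p.ofLp (fun i => p i + h)) :=
    isCompact_Icc.image (PiLp.continuous_toLp 2 _)
  refine (hf.continuousOn.integrableOn_compact hK).mono_set fun x hx => ?_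
  exact ⟨x.ofLp, ⟨fun i => (hx i).1, fun i => (hx i).2.le⟩, rfl⟩

lemma isOpen_openCube (h : ℝ) (p : EuclideanSpace ℝ (Fin d)) :
    IsOpen {x : EuclideanSpace ℝ (Fin d) | ∀ i, p i < x i ∧ x i < p i + h} := by
  simp only [Set.ofPred_forall]
  refine isOpen_iInter_of_finite fun i => ?_
  have hi : Continuous fun x : EuclideanSpace ℝ (Fin d) => x i := by fun_prop
  exact (isOpen_lt continuous_const hi).inter (isOpen_lt hi continuous_const)

/-- The quadratic form at `c` is `∫_C (∑ c_α 𝐯_α)² μ`. If it vanishes, the polynomial is zero almost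
everywhere on the open cube because `μ > 0`, then everywhere there by continuity, so `c = 0`. -/
lemma posDef_infoMatrix {h : ℝ} (hh : 0 < h) {μ : EuclideanSpace ℝ (Fin d) → ℝ}
    (hμ : Continuous μ) (hpos : ∀ x, 0 < μ x) (p : EuclideanSpace ℝ (Fin d)) :
    (infoMatrix s h μ p).PosDef := by
  have hv : ∀ α : MultiIndex d s, Continuous fun x => monomialVec α (x - p) := fun α =>
    (continuous_monomialVec α).comp (continuous_id.sub continuous_const)
  refine Matrix.PosDef.of_dotProduct_mulVec_pos ?_ fun c hc => ?_
  · ext k l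
    simp only [infoMatrix, Matrix.conjTranspose_apply, Matrix.of_apply, star_trivial]
    congr 1
    ext x
    ring
  · set g : EuclideanSpace ℝ (Fin d) → ℝ := fun x => ∑ α, c α * monomialVec α (x - p) with hg
    have hgc : Continuous g := continuous_finsetSum _ fun α _ => continuous_const.mul (hv α)
    have hfc : Continuous fun x => g x ^ 2 * μ x := (hgc.pow 2).mul hμ
    have hq : star c ⬝ᵥ (infoMatrix s h μ p).mulVec c = ∫ x in subcube h p, g x ^ 2 * μ x := by
      have e : ∀ x, g x ^ 2 * μ x = ∑ k, ∑ l,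
          c k * (monomialVec k (x - p) * monomialVec l (x - p) * μ x * c l) := by
        intro x
        rw [hg, sq, Finset.sum_mul_sum, Finset.sum_mul]
        refine Finset.sum_congr rfl fun k _ => ?_
        rw [Finset.sum_mul]
        exact Finset.sum_congr rfl fun l _ => by ring
      have hi : ∀ k l : MultiIndex d s, IntegrableOn (fun x =>
          monomialVec k (x - p) * monomialVec l (x - p) * μ x) (subcube h p) := fun k l =>
        integrableOn_subcube (((hv k).mul (hv l)).mul hμ) h p
      simp_rw [e]
      rw [integral_finsetSum _ fun k _ => integrable_finsetSum _ fun l _ =>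
        ((hi k l).mul_const _).const_mul _]
      simp only [dotProduct, Matrix.mulVec, star_trivial, Finset.mul_sum]
      refine Finset.sum_congr rfl fun k _ => ?_
      rw [integral_finsetSum _ fun l _ => ((hi k l).mul_const _).const_mul _]
      refine Finset.sum_congr rfl fun l _ => ?_
      rw [integral_const_mul, integral_mul_const]
      rfl
    have hnn : ∀ x, 0 ≤ g x ^ 2 * μ x := fun x => mul_nonneg (sq_nonneg _) (hpos x).le
    rw [hq]
    refine lt_of_le_of_ne (integral_nonneg hnn) fun h0 => hc ?_
    have hae := (setIntegral_eq_zero_iff_of_nonneg_ae (ae_of_all _ hnn)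
      (integrableOn_subcube hfc h p)).1 h0.symm
    set U := {x : EuclideanSpace ℝ (Fin d) | ∀ i, p i < x i ∧ x i < p i + h} with hU
    have hUsub : U ⊆ subcube h p := fun x hx i => ⟨(hx i).1.le, (hx i).2⟩
    have hae' : (fun x => g x ^ 2 * μ x) =ᵐ[volume.restrict U] 0 :=
      ae_restrict_of_ae_restrict_of_subset hUsub hae
    have heq := Measure.eqOn_open_of_ae_eq hae' (isOpen_openCube h p) hfc.continuousOn
      continuousOn_const
    refine eq_zero_of_sum_monomialVec_eq_zero hh c fun y hy => ?_
    have hmem : y + p ∈ U := fun i => by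
      have := hy i
      simp only [PiLp.add_apply]
      exact ⟨by linarith [this.1], by linarith [this.2]⟩
    have h1 : g (y + p) ^ 2 * μ (y + p) = 0 := heq hmem
    have h2 := (mul_eq_zero.1 h1).resolve_right (hpos _).ne'
    simpa [hg] using pow_eq_zero_iff two_ne_zero |>.1 h2

lemma continuous_invariantDensity {V : EuclideanSpace ℝ (Fin d) → ℝ} (hV : Continuous V) :
    Continuous (invariantDensity V) := by
  unfold invariantDensity
  fun_prop

/-- The invariant density is positive as soon as it is the density of a probability law. -/
lemma invariantDensity_pos {Ω : Type*} {mΩ : MeasurableSpace Ω} {P : Measure Ω}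
    [IsProbabilityMeasure P] {V : EuclideanSpace ℝ (Fin d) → ℝ}
    {X₀ : Ω → EuclideanSpace ℝ (Fin d)}
    (hlaw : HasLaw X₀ (volume.withDensity fun x => ENNReal.ofReal (invariantDensity V x)) P)
    (x : EuclideanSpace ℝ (Fin d)) : 0 < invariantDensity V x := by
  -- The normalising factor vanishes exactly when the Bochner integral is `0`, its default value if
  -- `exp (-2 V)` were not integrable. The density would then be identically zero and could not be
  -- that of a probability law.
  refine mul_pos (lt_of_le_of_ne (inv_nonneg.2 (integral_nonneg fun u => (Real.exp_pos _).le))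
    fun h0 => ?_) (Real.exp_pos _)
  have h1 : IsProbabilityMeasure (P.map X₀) := Measure.isProbabilityMeasure_map hlaw.aemeasurable
  rw [hlaw.map_eq] at h1
  have h2 : (volume.withDensity fun x => ENNReal.ofReal (invariantDensity V x)) = 0 := by
    have : (fun x => ENNReal.ofReal (invariantDensity V x)) = fun _ => 0 := by
      ext x; rw [invariantDensity, ← h0]; simp
    rw [this]
    simp
  rw [h2] at h1
  exact IsProbabilityMeasure.ne_zero (0 : Measure (EuclideanSpace ℝ (Fin d))) rfl

end InfoMatrix

end

/-! ### Passage to the limit in the exponential identities, and convergence of brackets. -/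

noncomputable section

section Limits

variable {Ω : Type*} {mΩ : MeasurableSpace Ω} {P : Measure Ω} [IsProbabilityMeasure P]

/-- Passing to the limit in an exponential martingale identity. -/
lemma integral_exp_eq_one_of_tendsto {A B : ℕ → Ω → ℝ} {N Q : Ω → ℝ}
    (hA : ∀ r, AEMeasurable (A r) P) (hB : ∀ r, AEMeasurable (B r) P) {C : ℝ}
    (hC : ∀ r ω, B r ω ≤ C) (hAN : ∀ᵐ ω ∂P, Tendsto (fun r => A r ω) atTop (𝓝 (N ω)))
    (hBQ : ∀ᵐ ω ∂P, Tendsto (fun r => B r ω) atTop (𝓝 (Q ω)))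
    (h1 : ∀ r, ∫ ω, Complex.exp ((A r ω : ℝ) * Complex.I + (B r ω / 2 : ℝ)) ∂P = 1) :
    ∫ ω, Complex.exp ((N ω : ℝ) * Complex.I + (Q ω / 2 : ℝ)) ∂P = 1 := by
  have hlim : Tendsto (fun r => ∫ ω, Complex.exp ((A r ω : ℝ) * Complex.I + (B r ω / 2 : ℝ)) ∂P)
      atTop (𝓝 (∫ ω, Complex.exp ((N ω : ℝ) * Complex.I + (Q ω / 2 : ℝ)) ∂P)) := by
    -- The modulus of the integrand is `exp (B r / 2)`, so an upper bound on the brackets suffices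
    -- for domination.
    refine tendsto_integral_of_dominated_convergence (fun _ => Real.exp (C / 2)) (fun r => ?_)
      (integrable_const _) (fun r => ae_of_all _ fun ω => ?_) ?_
    · exact (Complex.measurable_exp.comp_aemeasurable
        (((Complex.measurable_ofReal.comp_aemeasurable (hA r)).mul_const _).add
        (Complex.measurable_ofReal.comp_aemeasurable ((hB r).div_const _)))).aestronglyMeasurable
    · rw [Complex.norm_exp]
      have := hC r ω
      simp
      linarith
    · filter_upwards [hAN, hBQ] with ω h1 h2
      have h3 := (Complex.continuous_ofReal.tendsto _).comp h1
      have h4 := (Complex.continuous_ofReal.tendsto _).comp (h2.div_const 2)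
      exact (Complex.continuous_exp.tendsto _).comp ((h3.mul_const Complex.I).add h4)
  simp_rw [h1] at hlim
  exact tendsto_nhds_unique hlim tendsto_const_nhds

end Limits

section Independent

variable {Ω : Type*} {m mΩ : MeasurableSpace Ω} {P : Measure Ω} [IsProbabilityMeasure P]

/-- Integrating out a random vector independent of a `σ`-algebra `m`, for functionals that are
almost sure limits of versions of `m`-measurable ones. -/
lemma integral_exp_mul_exp_inner_of_tendsto {E : Type*} [NormedAddCommGroup E]
    [InnerProductSpace ℝ E] [MeasurableSpace E] [BorelSpace E] [SecondCountableTopology E]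
    (hm : m ≤ mΩ) {A A' : ℕ → Ω → ℝ} {N : Ω → ℝ} {v D : Ω → E}
    (hA' : ∀ r, Measurable[m] (A' r)) (hAA' : ∀ r, A r =ᵐ[P] A' r)
    (hAN : ∀ᵐ ω ∂P, Tendsto (fun r => A r ω) atTop (𝓝 (N ω)))
    (hv : Measurable[m] v) (hD : AEMeasurable D P)
    (hind : Indep m (MeasurableSpace.comap D inferInstance) P) :
    ∫ ω, Complex.exp ((N ω : ℝ) * Complex.I) * Complex.exp (inner ℝ (D ω) (v ω) * Complex.I) ∂P
      = ∫ ω, Complex.exp ((N ω : ℝ) * Complex.I) * charFun (P.map D) (v ω) ∂P := by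
  have : IsProbabilityMeasure (P.map D) := Measure.isProbabilityMeasure_map hD
  have hAN' : ∀ᵐ ω ∂P, Tendsto (fun r => A' r ω) atTop (𝓝 (N ω)) := by
    filter_upwards [hAN, ae_all_iff.2 hAA'] with ω h1 h2
    exact h1.congr h2
  have mA' := fun r => (hA' r).mono hm le_rfl
  have mv := hv.mono hm le_rfl
  have hstep : ∀ r, ∫ ω, Complex.exp ((A' r ω : ℝ) * Complex.I) *
        Complex.exp (inner ℝ (D ω) (v ω) * Complex.I) ∂P
      = ∫ ω, Complex.exp ((A' r ω : ℝ) * Complex.I) * charFun (P.map D) (v ω) ∂P := by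
    intro r
    have mY : Measurable[m] fun ω => Complex.exp ((A' r ω : ℝ) * Complex.I) :=
      Complex.measurable_exp.comp ((Complex.measurable_ofReal.comp (hA' r)).mul_const _)
    refine integral_mul_exp_inner_of_indepFun (C := 1) (mY.mono hm le_rfl) mv hD
      (fun ω => by rw [Complex.norm_exp_ofReal_mul_I]) ?_
    rw [IndepFun_iff_Indep]
    exact indep_of_indep_of_le_left hind (mY.prodMk hv).comap_le
  have mexp : ∀ r, AEStronglyMeasurable (fun ω => Complex.exp ((A' r ω : ℝ) * Complex.I)) P :=
    fun r => (Complex.measurable_exp.comp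
      ((Complex.measurable_ofReal.comp (mA' r)).mul_const _)).aestronglyMeasurable
  have hlim : ∀ᵐ ω ∂P, Tendsto (fun r => Complex.exp ((A' r ω : ℝ) * Complex.I)) atTop
      (𝓝 (Complex.exp ((N ω : ℝ) * Complex.I))) := by
    filter_upwards [hAN'] with ω h
    exact (Complex.continuous_exp.tendsto _).comp
      (((Complex.continuous_ofReal.tendsto _).comp h).mul_const _)
  have h1 : Tendsto (fun r => ∫ ω, Complex.exp ((A' r ω : ℝ) * Complex.I) *
        Complex.exp (inner ℝ (D ω) (v ω) * Complex.I) ∂P) atTop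
      (𝓝 (∫ ω, Complex.exp ((N ω : ℝ) * Complex.I) *
        Complex.exp (inner ℝ (D ω) (v ω) * Complex.I) ∂P)) := by
    refine tendsto_integral_of_dominated_convergence (fun _ => 1) (fun r => ?_)
      (integrable_const _) (fun r => ae_of_all _ fun ω => ?_) ?_
    · refine (mexp r).mul (Complex.measurable_exp.comp_aemeasurable
        ((Complex.measurable_ofReal.comp_aemeasurable ?_).mul_const _)).aestronglyMeasurable
      exact hD.inner mv.aemeasurable
    · rw [norm_mul, Complex.norm_exp_ofReal_mul_I, Complex.norm_exp_ofReal_mul_I, one_mul]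
    · filter_upwards [hlim] with ω h
      exact h.mul_const _
  have h2 : Tendsto (fun r => ∫ ω, Complex.exp ((A' r ω : ℝ) * Complex.I) *
        charFun (P.map D) (v ω) ∂P) atTop
      (𝓝 (∫ ω, Complex.exp ((N ω : ℝ) * Complex.I) * charFun (P.map D) (v ω) ∂P)) := by
    refine tendsto_integral_of_dominated_convergence (fun _ => 1) (fun r => ?_)
      (integrable_const _) (fun r => ae_of_all _ fun ω => ?_) ?_
    · exact (mexp r).mul (measurable_charFun.comp mv).aestronglyMeasurable
    · rw [norm_mul, Complex.norm_exp_ofReal_mul_I, one_mul]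
      exact norm_charFun_le_one _
    · filter_upwards [hlim] with ω h
      exact h.mul_const _
  simp_rw [hstep] at h1
  exact tendsto_nhds_unique h1 h2

end Independent

section Bracket

variable {Ω : Type*} {mΩ : MeasurableSpace Ω} {E : Type*} [TopologicalSpace E]
  [TopologicalSpace.PseudoMetrizableSpace E] [MeasurableSpace E] [BorelSpace E]
  {X : ℝ≥0 → Ω → E} {T : ℝ≥0} {𝓕 : Filtration ℝ≥0 mΩ}

lemma integral_sum_indicator_gridTime {n : ℕ} (hn : n ≠ 0) (u : ℕ → ℝ) :
    ∫ s in Set.Ioc (0 : ℝ) T, ∑ i : Fin n,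
        (Set.Ioc (gridTime T n i) (gridTime T n (i + 1))).indicator (fun _ => u i) s.toNNReal
      = ∑ i ∈ Finset.range n, ((T : ℝ) / n) * u i := by
  have e : ∀ s : ℝ, ∀ i : Fin n, s ∈ Set.Ioc (0 : ℝ) T →
      (Set.Ioc (gridTime T n i) (gridTime T n (i + 1))).indicator (fun _ => u i) s.toNNReal
      = (Set.Ioc (gridTime T n i : ℝ) (gridTime T n (i + 1))).indicator (fun _ => u i) s := by
    intro s i hs
    lift s to ℝ≥0 using hs.1.le
    simp [Set.indicator, Set.mem_Ioc]
  have hsub : ∀ i : Fin n, Set.Ioc (gridTime T n i : ℝ) (gridTime T n (i + 1))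
      ⊆ Set.Ioc (0 : ℝ) T :=
    fun i => Set.Ioc_subset_Ioc (NNReal.coe_nonneg _)
      (by exact_mod_cast gridTime_le T hn i.2)
  rw [setIntegral_congr_fun measurableSet_Ioc fun s hs => Finset.sum_congr rfl fun i _ => e s i hs,
    integral_finsetSum _ fun i _ =>
      (IsFilteredBrownianReal.integrable_indicator_Ioc _ _ _).integrableOn,
    ← Fin.sum_univ_eq_sum_range (fun i => ((T : ℝ) / n) * u i)]
  refine Finset.sum_congr rfl fun i _ => ?_
  rw [setIntegral_indicator measurableSet_Ioc, Set.inter_eq_self_of_subset_right (hsub i),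
    setIntegral_const]
  have h1 : (gridTime T n i : ℝ) ≤ gridTime T n (i + 1) := by
    exact_mod_cast gridTime_mono T n (Nat.le_succ i)
  rw [Measure.real, Real.volume_Ioc, ENNReal.toReal_ofReal (sub_nonneg.2 h1), gridTime_succ_sub,
    smul_eq_mul]

/-- Convergence of the stopped Riemann sums of products. -/
lemma ae_tendsto_sum_stopped_mul {P : Measure Ω} [IsProbabilityMeasure P]
    (hXc : ∀ ω, ContinuousOn (fun t => X t ω) (Set.Icc 0 T))
    (hX : ∀ t ≤ T, Measurable[𝓕 t] (X t)) {ι : Type*} [Finite ι] {F : ι → E → ℝ}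
    (hF : ∀ q, Measurable (F q)) {φ : ℕ → ι → E → ℝ} (hφ : ∀ r q, Measurable (φ r q)) {C : ℝ}
    (hC : ∀ r q x, |φ r q x| ≤ C) {n : ℕ → ℕ} (hn : ∀ r, r < n r)
    (happ : ∀ r q, eLpNorm (fun z : Ω × ℝ => (gridElementary 𝓕 T X hX (φ r q) (hφ r q)
          ⟨C, hC r q⟩ (n r)).value z.2.toNNReal z.1 - F q (X z.2.toNNReal z.1)) 2
        (P.prod (timeMeasure T)) ≤ (((8⁻¹ : ℝ≥0) ^ r : ℝ≥0) : ℝ≥0∞)) :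
    ∀ᵐ ω ∂P, ∀ q q', ∀ τ ≤ T, ∀ τ' ≤ T, Tendsto (fun r => ∑ i ∈ Finset.range (n r),
        ((T : ℝ) / n r) *
        ((if gridTime T (n r) i < τ then φ r q (X (gridTime T (n r) i) ω) else 0) *
          (if gridTime T (n r) i < τ' then φ r q' (X (gridTime T (n r) i) ω) else 0))) atTop
      (𝓝 (∫ s in (0 : ℝ)..(min τ τ' : ℝ≥0), F q (X s.toNNReal ω) * F q' (X s.toNNReal ω))) := by
  have hXm : ∀ t ≤ T, Measurable (X t) := fun t ht => (hX t ht).mono (𝓕.le t) le_rfl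
  have h1 : ∀ᵐ ω ∂P, ∀ᵐ s ∂(timeMeasure T), ∀ q,
      Tendsto (fun r => (gridElementary 𝓕 T X hX (φ r q) (hφ r q)
          ⟨C, hC r q⟩ (n r)).value s.toNNReal ω) atTop (𝓝 (F q (X s.toNNReal ω))) := by
    -- The geometric `L²` rate gives convergence almost everywhere on the product, hence for almost
    -- every `ω` at almost every time. This null set does not involve `τ` and `τ'`.
    refine Measure.ae_ae_of_ae_prod (p := fun z : Ω × ℝ => ∀ q,
      Tendsto (fun r => (gridElementary 𝓕 T X hX (φ r q) (hφ r q)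
          ⟨C, hC r q⟩ (n r)).value z.2.toNNReal z.1) atTop (𝓝 (F q (X z.2.toNNReal z.1)))) ?_
    rw [ae_all_iff]
    intro q
    filter_upwards [ae_tendsto_zero_of_eLpNorm_le_geometric (fun r =>
      ((ElementaryProcess.measurable_value _).aemeasurable.sub
        (aemeasurable_comp_process hXc hXm (hF q))).aestronglyMeasurable)
      (fun r => happ r q)] with z hz
    exact tendsto_sub_nhds_zero_iff.1 hz
  have hn0 : ∀ r, n r ≠ 0 := fun r => Nat.ne_of_gt (Nat.zero_lt_of_lt (hn r))
  have hnt : Tendsto n atTop atTop := tendsto_atTop_mono (fun r => (hn r).le) tendsto_id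
  filter_upwards [h1] with ω hω q q' τ hτ τ' hτ'
  set u : ℕ → ℕ → ℝ := fun r i =>
    (if gridTime T (n r) i < τ then φ r q (X (gridTime T (n r) i) ω) else 0) *
      (if gridTime T (n r) i < τ' then φ r q' (X (gridTime T (n r) i) ω) else 0) with hu
  set U : ℕ → ℝ → ℝ := fun r s => ∑ i : Fin (n r),
    (Set.Ioc (gridTime T (n r) i) (gridTime T (n r) (i + 1))).indicator
      (fun _ => u r i) s.toNNReal with hU
  have hsum : ∀ r, ∑ i ∈ Finset.range (n r), ((T : ℝ) / n r) * u r i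
      = ∫ s in Set.Ioc (0 : ℝ) T, U r s := fun r =>
    (integral_sum_indicator_gridTime (hn0 r) (u r)).symm
  have hlimit : ∫ s in (0 : ℝ)..(min τ τ' : ℝ≥0), F q (X s.toNNReal ω) * F q' (X s.toNNReal ω)
      = ∫ s in Set.Ioc (0 : ℝ) T, (Set.Ioc (0 : ℝ) (min τ τ' : ℝ≥0)).indicator
        (fun s => F q (X s.toNNReal ω) * F q' (X s.toNNReal ω)) s := by
    rw [setIntegral_indicator measurableSet_Ioc, Set.inter_eq_self_of_subset_right
      (Set.Ioc_subset_Ioc le_rfl (by exact_mod_cast (min_le_left _ _).trans hτ)),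
      intervalIntegral.integral_of_le (NNReal.coe_nonneg _)]
  refine Tendsto.congr (fun r => (hsum r).symm) ?_
  rw [hlimit]
  have hub : ∀ r i, |u r i| ≤ C * C := by
    intro r i
    have hC0 : 0 ≤ C := (abs_nonneg _).trans (hC 0 q (X 0 ω))
    rw [hu, abs_mul]
    have hite : ∀ (τ : ℝ≥0) q, |if gridTime T (n r) i < τ then
        φ r q (X (gridTime T (n r) i) ω) else 0| ≤ C := by
      intro τ q
      split_ifs
      · exact hC _ _ _
      · simpa using hC0
    exact mul_le_mul (hite _ _) (hite _ _) (abs_nonneg _) hC0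
  refine tendsto_integral_of_dominated_convergence (fun _ => C * C) (fun r => ?_)
    (integrable_const _) (fun r => ?_) ?_
  · refine (Finset.measurable_sum _ fun i _ => ?_).aestronglyMeasurable
    exact (measurable_const.indicator measurableSet_Ioc).comp measurable_real_toNNReal
  · filter_upwards [ae_restrict_mem measurableSet_Ioc] with s hs
    obtain ⟨i, hi⟩ := exists_mem_Ioc_gridTime (hn0 r) (Real.toNNReal_pos.2 hs.1)
      (Real.toNNReal_le_iff_le_coe.2 hs.2)
    have hUs : U r s = u r i := sum_indicator_gridTime (u r) i hi
    rw [Real.norm_eq_abs, hUs]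
    exact hub _ _
  · have h2 : ∀ᵐ s ∂(volume.restrict (Set.Ioc (0 : ℝ) T)), ∀ q,
        Tendsto (fun r => (gridElementary 𝓕 T X hX (φ r q) (hφ r q)
          ⟨C, hC r q⟩ (n r)).value s.toNNReal ω) atTop (𝓝 (F q (X s.toNNReal ω))) := by
      rw [restrict_Ioc_eq_restrict_Icc]; exact hω
    filter_upwards [h2, ae_restrict_mem measurableSet_Ioc] with s hs hsT
    have hs0 : 0 < s.toNNReal := Real.toNNReal_pos.2 hsT.1
    have hsT' : s.toNNReal ≤ T := Real.toNNReal_le_iff_le_coe.2 hsT.2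
    choose i hi using fun r => exists_mem_Ioc_gridTime (hn0 r) hs0 hsT'
    have hti := tendsto_of_mem_Ioc_gridTime (T := T) hnt (fun r => (i r : ℕ))
      (Eventually.of_forall hi)
    have hUs : ∀ r, U r s = u r (i r) := fun r => sum_indicator_gridTime (u r) (i r) (hi r)
    simp_rw [hUs]
    have hval : ∀ q, Tendsto (fun r => φ r q (X (gridTime T (n r) (i r)) ω)) atTop
        (𝓝 (F q (X s.toNNReal ω))) := fun q =>
      (hs q).congr fun r => gridElementary_value (i r) (hi r) ω
    -- For `s ≤ min τ τ'` the left end of the cell of `s` lies strictly before both times, and both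
    -- conditions hold. Otherwise these left ends converge to `s > min τ τ'`, so one condition
    -- eventually fails.
    by_cases hsm : s.toNNReal ≤ min τ τ'
    · rw [Set.indicator_of_mem (show s ∈ Set.Ioc (0 : ℝ) (min τ τ' : ℝ≥0) from
        ⟨hsT.1, Real.toNNReal_le_iff_le_coe.1 hsm⟩)]
      refine ((hval q).mul (hval q')).congr fun r => ?_
      rw [hu]
      simp only
      rw [if_pos ((hi r).1.trans_le (hsm.trans (min_le_left _ _))),
        if_pos ((hi r).1.trans_le (hsm.trans (min_le_right _ _)))]
    · rw [Set.indicator_of_notMem fun hmem => hsm (Real.toNNReal_le_iff_le_coe.2 hmem.2)]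
      refine tendsto_const_nhds.congr' ?_
      filter_upwards [hti.eventually (lt_mem_nhds (not_le.1 hsm))] with r hr
      rw [hu]
      simp only
      rcases min_lt_iff.1 hr with h | h
      · rw [if_neg (not_lt.2 h.le), zero_mul]
      · rw [if_neg (not_lt.2 h.le) (c := gridTime T (n r) (i r) < τ'), mul_zero]

end Bracket

end

/-! ### From the joint characteristic function to independent Gaussian vectors. -/

noncomputable section

section GaussianFamily

variable {Ω : Type*} {mΩ : MeasurableSpace Ω} {P : Measure Ω} [IsProbabilityMeasure P]

/-- A finite family of random vectors whose joint characteristic function is the product of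
centred Gaussian ones is independent, and each member is Gaussian. -/
lemma iIndepFun_and_hasLaw_of_integral_exp {ι κ : Type*} [Fintype ι] [DecidableEq ι] [Fintype κ]
    [DecidableEq κ] {η : ι → Ω → EuclideanSpace ℝ κ} (hη : ∀ q, AEMeasurable (η q) P)
    {J : ι → Matrix κ κ ℝ} (hJ : ∀ q, (J q).PosSemidef)
    (hchar : ∀ x : ι → EuclideanSpace ℝ κ,
      ∫ ω, Complex.exp ((∑ q, inner ℝ (η q ω) (x q) : ℝ) * Complex.I) ∂P
        = Complex.exp (-((∑ q, (x q).ofLp ⬝ᵥ (J q).mulVec (x q).ofLp : ℝ) : ℂ) / 2)) :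
    iIndepFun η P ∧ ∀ q, HasLaw (η q) (multivariateGaussian 0 (J q)) P := by
  have hsingle : ∀ q (y : EuclideanSpace ℝ κ), charFun (P.map (η q)) y
      = Complex.exp (-((y.ofLp ⬝ᵥ (J q).mulVec y.ofLp : ℝ) : ℂ) / 2) := by
    intro q y
    have h := hchar (Pi.single q y)
    rw [charFun_apply, integral_map (hη q) (by fun_prop)]
    have e1 : ∀ ω, ∑ q', inner ℝ (η q' ω) (Pi.single (M := fun _ => EuclideanSpace ℝ κ) q y q')
        = inner ℝ (η q ω) y := by
      intro ω
      rw [Finset.sum_eq_single q (fun q' _ hq' => by rw [Pi.single_eq_of_ne hq', inner_zero_right])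
        (fun h => absurd (Finset.mem_univ q) h), Pi.single_eq_same]
    have e2 : ∑ q', (Pi.single (M := fun _ => EuclideanSpace ℝ κ) q y q').ofLp ⬝ᵥ
        (J q').mulVec (Pi.single (M := fun _ => EuclideanSpace ℝ κ) q y q').ofLp
        = y.ofLp ⬝ᵥ (J q).mulVec y.ofLp := by
      rw [Finset.sum_eq_single q (fun q' _ hq' => by
        rw [Pi.single_eq_of_ne hq', WithLp.ofLp_zero, zero_dotProduct])
        (fun h => absurd (Finset.mem_univ q) h), Pi.single_eq_same]
    simp_rw [e1] at h
    rw [e2] at h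
    exact h
  constructor
  · rw [iIndepFun_iff_charFun_pi hη]
    intro t
    simp_rw [hsingle]
    rw [charFun_apply, integral_map]
    · have h := hchar t.ofLp
      have e : ∀ ω, inner ℝ (WithLp.toLp 2 fun q => η q ω) t = ∑ q, inner ℝ (η q ω) (t q) :=
        fun ω => PiLp.inner_apply _ _
      simp_rw [e]
      rw [h, ← Complex.exp_sum]
      congr 1
      rw [Complex.ofReal_sum, ← Finset.sum_neg_distrib, Finset.sum_div]
    · exact (WithLp.measurable_toLp 2 _).comp_aemeasurable (aemeasurable_pi_lambda _ hη)
    · fun_prop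
  · intro q
    refine ⟨hη q, ?_⟩
    have : IsProbabilityMeasure (P.map (η q)) := Measure.isProbabilityMeasure_map (hη q)
    refine Measure.ext_of_charFun (funext fun y => ?_)
    rw [hsingle, charFun_multivariateGaussian (hJ q), inner_zero_right]
    congr 1
    simp
    ring

end GaussianFamily

/-! ### The characteristic functional of stopped Itô integrals. -/

section StoppedIntegral

variable {Ω : Type*} {m mΩ : MeasurableSpace Ω} {P : Measure Ω} [IsProbabilityMeasure P]
  {E : Type*} [TopologicalSpace E]
  [TopologicalSpace.PseudoMetrizableSpace E] [MeasurableSpace E] [BorelSpace E]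
  {X : ℝ≥0 → Ω → E} {T : ℝ≥0} {𝓕 : Filtration ℝ≥0 mΩ} {d : ℕ}
  {W : ℝ≥0 → Ω → EuclideanSpace ℝ (Fin d)} {ι : Type*} [Fintype ι]

/-- The Itô integral of `F(X)` evaluated at a random time is measurable. -/
lemma aemeasurable_itoIntegral_stopped {B : ℝ≥0 → Ω → ℝ} (hB : IsFilteredBrownianReal 𝓕 P B)
    (hXc : ∀ ω, ContinuousOn (fun t => X t ω) (Set.Icc 0 T))
    (hX : ∀ t ≤ T, Measurable[𝓕 t] (X t)) {F : E → ℝ} (hF : Measurable F)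
    {Φ : ℕ → E → ℝ} (hΦ : ∀ k, Continuous (Φ k)) {C : ℝ} (hC : ∀ k x, |Φ k x| ≤ C)
    (hlim : ∀ x, Tendsto (fun k => Φ k x) atTop (𝓝 (F x)))
    {τ : Ω → ℝ≥0} (hτ : Measurable τ) (hτT : ∀ ω, τ ω ≤ T) :
    AEMeasurable (fun ω => itoIntegral 𝓕 P B T (fun u ω' => F (X u ω')) (τ ω) ω) P := by
  obtain ⟨n, k, hnk⟩ := exists_gridElementary_approx (P := P) (ι := Unit) hXc hX
    (F := fun _ => F) (Φ := fun k _ => Φ k) (fun k _ => hΦ k) (fun k _ => hC k) (fun _ => hlim)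
  have hlim' := tendsto_stopped_sum_itoIntegral hB hXc hX hF (φ := fun r => Φ (k r))
    (fun r => (hΦ _).measurable) (fun r => ⟨C, hC _⟩) (fun r => (hnk r).1)
    (fun r => (hnk r).2 ())
  refine aemeasurable_of_tendsto_metrizable_ae atTop (fun r => ?_)
    (hlim'.mono fun ω h => h (τ ω) (hτT ω))
  have hn0 : n r ≠ 0 := Nat.ne_of_gt (Nat.zero_lt_of_lt (hnk r).1)
  refine (Finset.measurable_sum _ fun i _ => Measurable.mul ?_ (hB.measurable_sub _ _)).aemeasurable
  exact Measurable.ite (measurableSet_lt measurable_const hτ)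
    ((hΦ _).measurable.comp ((hX _ (gridTime_le T hn0 i.2.le)).mono (𝓕.le _) le_rfl))
    measurable_const

/-- The joint characteristic functional of stopped Itô integrals `∫_0^{τ_q} F_q(X) dW^j` and of an
independent Gaussian vector that completes their bracket to a constant. -/
lemma integral_exp_stopped_itoIntegral (hm : m ≤ mΩ) (hT : 0 < T)
    (hW : IsFilteredBrownian 𝓕 P W)
    (hXc : ∀ ω, ContinuousOn (fun t => X t ω) (Set.Icc 0 T))
    (hX : ∀ t ≤ T, Measurable[𝓕 t] (X t)) (hXm : ∀ t ≤ T, Measurable[m] (X t))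
    {W' : ℝ≥0 → Ω → EuclideanSpace ℝ (Fin d)} (hW' : ∀ t ≤ T, Measurable[m] (W' t))
    (hWW' : ∀ᵐ ω ∂P, ∀ t ≤ T, W t ω = W' t ω)
    {F : ι → E → ℝ} (hF : ∀ q, Measurable (F q)) {Φ : ℕ → ι → E → ℝ}
    (hΦ : ∀ k q, Continuous (Φ k q)) {C : ℝ} (hC : ∀ k q x, |Φ k q x| ≤ C)
    (hlim : ∀ q x, Tendsto (fun k => Φ k q x) atTop (𝓝 (F q x)))
    {τ : ι → Ω → ℝ≥0} (hτT : ∀ q ω, τ q ω ≤ T)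
    (hτ : ∀ q, ∀ t < T, MeasurableSet[𝓕 t] {ω | t < τ q ω}) (hτm : ∀ q, Measurable[m] (τ q))
    (x : Fin d → ι → ℝ)
    {G : Type*} [NormedAddCommGroup G] [InnerProductSpace ℝ G] [MeasurableSpace G] [BorelSpace G]
    [SecondCountableTopology G] {v D : Ω → G} (hv : Measurable[m] v) (hD : AEMeasurable D P)
    (hDchar : ∀ y, charFun (P.map D) y = Complex.exp (-(‖y‖ ^ 2 : ℝ) / 2))
    (hind : Indep m (MeasurableSpace.comap D inferInstance) P) {c : ℝ}
    (hc : ∀ ω, ∑ j, ∑ q, ∑ q', x j q * x j q' * (∫ s in (0 : ℝ)..(min (τ q ω) (τ q' ω) : ℝ≥0),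
      F q (X s.toNNReal ω) * F q' (X s.toNNReal ω)) + ‖v ω‖ ^ 2 = c) :
    ∫ ω, Complex.exp ((∑ j, ∑ q, x j q * itoIntegral 𝓕 P (fun t ω' => W t ω' j) T
        (fun u ω' => F q (X u ω')) (τ q ω) ω : ℝ) * Complex.I) *
        Complex.exp (inner ℝ (D ω) (v ω) * Complex.I) ∂P = Complex.exp (-c / 2) := by
  obtain ⟨n, k, hnk⟩ := exists_gridElementary_approx (P := P) hXc hX hΦ hC hlim
  have hn0 : ∀ r, n r ≠ 0 := fun r => Nat.ne_of_gt (Nat.zero_lt_of_lt (hnk r).1)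
  -- The index type may be empty, in which case nothing forces `C` to be nonnegative.
  have hC0 : ∀ q : ι, 0 ≤ C := by
    intro q
    obtain ⟨ω⟩ : Nonempty Ω := P.nonempty_of_neZero
    exact (abs_nonneg _).trans (hC 0 q (X 0 ω))
  set ψ : ℕ → ι → ℕ → Ω → ℝ := fun r q i ω =>
    if gridTime T (n r) i < τ q ω then Φ (k r) q (X (gridTime T (n r) i) ω) else 0 with hψ
  have hψC : ∀ r q i ω, |ψ r q i ω| ≤ C := by
    intro r q i ω
    simp only [hψ]
    split_ifs
    · exact hC _ _ _
    · simpa using hC0 q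
  -- The stopped coefficients are needed with two measurabilities: with respect to `m`, for the
  -- independence from `D`, and with respect to the filtration at the left end of the cell (`hψF`),
  -- for the exponential martingale. The latter uses that left ends are strictly before `T`.
  have hψm : ∀ r q i, i < n r → Measurable[m] (ψ r q i) := fun r q i hi =>
    Measurable.ite (measurableSet_lt measurable_const (hτm q))
      ((hΦ _ _).measurable.comp (hXm _ (gridTime_le T (hn0 r) hi.le))) measurable_const
  have hlt : ∀ r i, i < n r → gridTime T (n r) i < T := by
    intro r i hi
    have h1 := gridTime_succ_sub T (n r) i
    have h2 : (gridTime T (n r) (i + 1) : ℝ) ≤ T := by exact_mod_cast gridTime_le T (hn0 r) hi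
    have h3 : (0 : ℝ) < T / n r :=
      div_pos (by exact_mod_cast hT) (by exact_mod_cast Nat.pos_of_ne_zero (hn0 r))
    rw [← NNReal.coe_lt_coe]
    linarith
  have hψF : ∀ r q i, i < n r → Measurable[𝓕 (gridTime T (n r) i)] (ψ r q i) := fun r q i hi =>
    Measurable.ite (hτ q _ (hlt r i hi))
      ((hΦ _ _).measurable.comp (hX _ (gridTime_le T (hn0 r) hi.le))) measurable_const
  -- All the stopped integrals are gathered into one integral against the vector `W`. The squared
  -- norm of `g` is a sum over coordinates, so no cross term between different components of `W`
  -- appears in the bracket.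
  set g : ℕ → ℕ → Ω → EuclideanSpace ℝ (Fin d) := fun r i ω =>
    WithLp.toLp 2 fun j => ∑ q, x j q * ψ r q i ω with hg
  have hgm : ∀ r i (m' : MeasurableSpace Ω), (∀ q, Measurable[m'] (ψ r q i)) →
      Measurable[m'] (g r i) := fun r i m' h =>
    (WithLp.measurable_toLp 2 _).comp (measurable_pi_lambda _ fun j =>
      Finset.measurable_sum _ fun q _ => (h q).const_mul _)
  set K : ℝ := ∑ j, (∑ q, |x j q| * C) ^ 2 with hK
  have hgK : ∀ r i ω, ‖g r i ω‖ ^ 2 ≤ K := by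
    intro r i ω
    rw [EuclideanSpace.real_norm_sq_eq]
    refine Finset.sum_le_sum fun j _ => ?_
    rw [← sq_abs]
    refine pow_le_pow_left₀ (abs_nonneg _) ((Finset.abs_sum_le_sum_abs _ _).trans
      (Finset.sum_le_sum fun q _ => ?_)) 2
    rw [abs_mul]
    exact mul_le_mul_of_nonneg_left (hψC _ _ _ _) (abs_nonneg _)
  set A : ℕ → Ω → ℝ := fun r ω => ∑ i ∈ Finset.range (n r),
    inner ℝ (W (gridTime T (n r) (i + 1)) ω - W (gridTime T (n r) i) ω) (g r i ω) with hA
  -- `W` agrees with an `m`-measurable process only almost surely; `A'` is the `m`-measurable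
  -- version of `A`.
  set A' : ℕ → Ω → ℝ := fun r ω => ∑ i ∈ Finset.range (n r),
    inner ℝ (W' (gridTime T (n r) (i + 1)) ω - W' (gridTime T (n r) i) ω) (g r i ω) with hA'
  set B : ℕ → Ω → ℝ := fun r ω => ∑ i ∈ Finset.range (n r),
    ((gridTime T (n r) (i + 1) : ℝ) - gridTime T (n r) i) * ‖g r i ω‖ ^ 2 with hB
  set N : Ω → ℝ := fun ω => ∑ j, ∑ q, x j q * itoIntegral 𝓕 P (fun t ω' => W t ω' j) T
        (fun u ω' => F q (X u ω')) (τ q ω) ω with hN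
  set Q : Ω → ℝ := fun ω => ∑ j, ∑ q, ∑ q', x j q * x j q' *
    (∫ s in (0 : ℝ)..(min (τ q ω) (τ q' ω) : ℝ≥0),
      F q (X s.toNNReal ω) * F q' (X s.toNNReal ω)) with hQ
  have hA'm : ∀ r, Measurable[m] (A' r) := fun r => Finset.measurable_sum _ fun i hi =>
    have hi := Finset.mem_range.1 hi
    ((hW' _ (gridTime_le T (hn0 r) hi)).sub (hW' _ (gridTime_le T (hn0 r) hi.le))).inner
      (hgm r i m fun q => hψm r q i hi)
  have hAA' : ∀ r, A r =ᵐ[P] A' r := by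
    intro r
    filter_upwards [hWW'] with ω hω
    refine Finset.sum_congr rfl fun i hi => ?_
    have hi := Finset.mem_range.1 hi
    rw [hω _ (gridTime_le T (hn0 r) hi), hω _ (gridTime_le T (hn0 r) hi.le)]
  have hBm : ∀ r, AEMeasurable (B r) P := fun r => (Finset.measurable_sum _ fun i hi =>
    ((measurable_norm.comp (hgm r i mΩ fun q =>
      (hψm r q i (Finset.mem_range.1 hi)).mono hm le_rfl)).pow_const 2).const_mul _).aemeasurable
  have hBK : ∀ r ω, B r ω ≤ T * K := by
    intro r ω
    have : B r ω ≤ ∑ i ∈ Finset.range (n r), ((T : ℝ) / n r) * K := by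
      refine Finset.sum_le_sum fun i _ => ?_
      rw [gridTime_succ_sub]
      exact mul_le_mul_of_nonneg_left (hgK _ _ _) (by positivity)
    refine this.trans (le_of_eq ?_)
    have : (n r : ℝ) ≠ 0 := by exact_mod_cast hn0 r
    rw [Finset.sum_const, Finset.card_range, nsmul_eq_mul]
    field_simp
  have hAN : ∀ᵐ ω ∂P, Tendsto (fun r => A r ω) atTop (𝓝 (N ω)) := by
    have h1 : ∀ᵐ ω ∂P, ∀ j q, Tendsto (fun r => ∑ i ∈ Finset.range (n r), ψ r q i ω *
        (W (gridTime T (n r) (i + 1)) ω j - W (gridTime T (n r) i) ω j)) atTop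
        (𝓝 (itoIntegral 𝓕 P (fun t ω' => W t ω' j) T (fun u ω' => F q (X u ω')) (τ q ω) ω)) := by
      simp_rw [ae_all_iff]
      intro j q
      filter_upwards [tendsto_stopped_sum_itoIntegral (hW.component j) hXc hX (hF q)
        (φ := fun r => Φ (k r) q) (fun r => (hΦ _ _).measurable) (fun r => ⟨C, hC _ _⟩)
        (fun r => (hnk r).1) (fun r => (hnk r).2 q)] with ω h
      refine (h (τ q ω) (hτT q ω)).congr fun r => ?_
      exact Fin.sum_univ_eq_sum_range (fun i => ψ r q i ω *
        (W (gridTime T (n r) (i + 1)) ω j - W (gridTime T (n r) i) ω j)) (n r)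
    filter_upwards [h1] with ω h
    refine (tendsto_finsetSum _ fun j _ => tendsto_finsetSum _ fun q _ =>
      (h j q).const_mul (x j q)).congr fun r => ?_
    simp only [hA, hg, PiLp.inner_apply]
    refine Eq.trans (Finset.sum_congr rfl fun j _ => ?_) Finset.sum_comm
    simp_rw [Finset.mul_sum]
    rw [Finset.sum_comm]
    refine Finset.sum_congr rfl fun i _ => ?_
    rw [Real.inner_apply, Finset.mul_sum]
    refine Finset.sum_congr rfl fun q _ => ?_
    rw [PiLp.sub_apply]
    ring
  have hBQ : ∀ᵐ ω ∂P, Tendsto (fun r => B r ω) atTop (𝓝 (Q ω)) := by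
    filter_upwards [ae_tendsto_sum_stopped_mul hXc hX hF (φ := fun r => Φ (k r))
      (fun r q => (hΦ _ _).measurable) (fun r => hC _)
        (fun r => (hnk r).1) (fun r => (hnk r).2)] with ω h
    refine (tendsto_finsetSum _ fun j _ => tendsto_finsetSum _ fun q _ =>
      tendsto_finsetSum _ fun q' _ => (h q q' (τ q ω) (hτT q ω) (τ q' ω) (hτT q' ω)).const_mul
        (x j q * x j q')).congr fun r => ?_
    simp only [hB, hg, EuclideanSpace.real_norm_sq_eq, gridTime_succ_sub]
    simp_rw [Finset.mul_sum]
    refine Eq.trans (Finset.sum_congr rfl fun j _ => ?_) Finset.sum_comm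
    simp_rw [sq, Finset.sum_mul_sum, Finset.mul_sum]
    refine Eq.trans (Finset.sum_congr rfl fun q _ => Finset.sum_comm) ?_
    refine Finset.sum_comm.trans (Finset.sum_congr rfl fun i _ => Finset.sum_congr rfl fun q _ =>
      Finset.sum_congr rfl fun q' _ => ?_)
    ring
  have h1 : ∀ r, ∫ ω, Complex.exp ((A r ω : ℝ) * Complex.I + (B r ω / 2 : ℝ)) ∂P = 1 := fun r =>
    hW.integral_exp_sum_inner (gridTime T (n r)) (gridTime_mono T (n r)) (g r) (n r)
      (fun i hi => hgm r i _ fun q => hψF r q i hi) (C := √K)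
      fun i ω => Real.le_sqrt_of_sq_le (hgK r i ω)
  have h2 := integral_exp_eq_one_of_tendsto
    (fun r => ((hA'm r).mono hm le_rfl).aemeasurable.congr (hAA' r).symm) hBm hBK hAN hBQ h1
  -- Integrating out `D` leaves the factor `exp (-‖v‖² / 2)`, which by `hc` equals `exp (-c / 2) *
  -- exp (Q / 2)`; the exponential identity `h2` finishes.
  rw [integral_exp_mul_exp_inner_of_tendsto hm hA'm hAA' hAN hv hD hind]
  simp_rw [hDchar]
  calc ∫ ω, Complex.exp ((N ω : ℝ) * Complex.I) * Complex.exp (-(‖v ω‖ ^ 2 : ℝ) / 2) ∂P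
      = ∫ ω, Complex.exp (-c / 2) * Complex.exp ((N ω : ℝ) * Complex.I + (Q ω / 2 : ℝ)) ∂P := by
        refine integral_congr_ae (ae_of_all _ fun ω => ?_)
        simp only
        rw [← Complex.exp_add, ← Complex.exp_add, ← hc ω]
        congr 1
        simp only [hQ]
        push_cast
        ring
    _ = Complex.exp (-c / 2) := by rw [integral_const_mul, h2, mul_one]

end StoppedIntegral

end

/-! ### The stopping times and the completing covariance. -/

noncomputable section

section InfoTime

variable {Ω : Type*} {d : ℕ} {X : ℝ≥0 → Ω → EuclideanSpace ℝ (Fin d)} {T : ℝ≥0}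

lemma measurable_empInfoMatrix_apply {m : MeasurableSpace Ω} {s : ℕ} (h : ℝ)
    (p : EuclideanSpace ℝ (Fin d)) (hXc : ∀ ω, ContinuousOn (fun t => X t ω) (Set.Icc 0 T))
    {t : ℝ≥0} (ht : t ≤ T) (hX : ∀ u ≤ t, Measurable (X u)) (k l : MultiIndex d s) :
    Measurable fun ω => empInfoMatrix s h X p t ω k l := by
  simp_rw [empInfoMatrix_apply]
  exact measurable_intervalIntegral_comp hXc ht hX
    ((measurable_localMonomial h p k).mul (measurable_localMonomial h p l))

lemma exists_norm_localMonomial_mul_le {s : ℕ} (h : ℝ) (p : EuclideanSpace ℝ (Fin d))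
    (k l : MultiIndex d s) :
    ∃ C, ∀ x, ‖localMonomial h p k x * localMonomial h p l x‖ ≤ C := by
  obtain ⟨C, hC⟩ := exists_abs_localMonomial_le h p k
  obtain ⟨C', hC'⟩ := exists_abs_localMonomial_le h p l
  refine ⟨C * C', fun x => ?_⟩
  rw [norm_mul]
  exact mul_le_mul (hC x) (hC' x) (norm_nonneg _) ((abs_nonneg _).trans (hC x))

lemma continuousOn_empInfoMatrix (s : ℕ) (h : ℝ) (p : EuclideanSpace ℝ (Fin d))
    (hXc : ∀ ω, ContinuousOn (fun t => X t ω) (Set.Icc 0 T)) (ω : Ω) :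
    ContinuousOn (fun t => empInfoMatrix s h X p t ω) (Set.Icc 0 T) := by
  refine continuousOn_pi.2 fun k => continuousOn_pi.2 fun l => ?_
  simp_rw [empInfoMatrix_apply]
  obtain ⟨C, hC⟩ := exists_norm_localMonomial_mul_le h p k l
  exact continuousOn_intervalIntegral_comp hXc
    ((measurable_localMonomial h p k).mul (measurable_localMonomial h p l)) hC ω

lemma empInfoMatrix_isHermitian (s : ℕ) (h : ℝ) (p : EuclideanSpace ℝ (Fin d)) (t : ℝ≥0) (ω : Ω) :
    (empInfoMatrix s h X p t ω).IsHermitian := by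
  ext k l
  rw [Matrix.conjTranspose_apply, star_trivial, empInfoMatrix_apply, empInfoMatrix_apply]
  simp_rw [mul_comm]

lemma continuous_matrixOpNorm_mul_mul {ι : Type*} [Fintype ι] [DecidableEq ι]
    (R : Matrix ι ι ℝ) : Continuous fun A : Matrix ι ι ℝ => matrixOpNorm (R * A * R) :=
  continuous_matrixOpNorm.comp (by fun_prop)

lemma continuousOn_matrixOpNorm_empInfoMatrix {s : ℕ} (h : ℝ) (p : EuclideanSpace ℝ (Fin d))
    (hXc : ∀ ω, ContinuousOn (fun t => X t ω) (Set.Icc 0 T))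
    (R : Matrix (MultiIndex d s) (MultiIndex d s) ℝ) (ω : Ω) :
    ContinuousOn (fun t => matrixOpNorm (R * empInfoMatrix s h X p t ω * R)) (Set.Icc 0 T) :=
  (continuous_matrixOpNorm_mul_mul R).comp_continuousOn (continuousOn_empInfoMatrix s h p hXc ω)

lemma measurable_matrixOpNorm_empInfoMatrix {m : MeasurableSpace Ω} {s : ℕ} (h : ℝ)
    (p : EuclideanSpace ℝ (Fin d)) (hXc : ∀ ω, ContinuousOn (fun t => X t ω) (Set.Icc 0 T))
    (R : Matrix (MultiIndex d s) (MultiIndex d s) ℝ)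
    {t : ℝ≥0} (ht : t ≤ T) (hX : ∀ u ≤ t, Measurable (X u)) :
    Measurable fun ω => matrixOpNorm (R * empInfoMatrix s h X p t ω * R) :=
  measurable_of_continuousOn_matrix (K := Set.univ)
    (continuous_matrixOpNorm_mul_mul R).continuousOn
    (fun k l => measurable_empInfoMatrix_apply h p hXc ht hX k l) (fun _ => Set.mem_univ _)

variable {s : ℕ} (h : ℝ) (p : EuclideanSpace ℝ (Fin d))
  (J : Matrix (MultiIndex d s) (MultiIndex d s) ℝ)

lemma infoTime_le (ω : Ω) : infoTime T J (empInfoMatrix s h X p) ω ≤ T := hittingBtwn_le ω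

lemma measurableSet_lt_infoTime {m : MeasurableSpace Ω}
    (hXc : ∀ ω, ContinuousOn (fun t => X t ω) (Set.Icc 0 T)) {t : ℝ≥0} (ht : t < T)
    (hX : ∀ u ≤ t, Measurable (X u)) :
    MeasurableSet {ω | t < infoTime T J (empInfoMatrix s h X p) ω} :=
  measurableSet_lt_hittingBtwn (fun ω => continuousOn_matrixOpNorm_empInfoMatrix h p hXc _ ω) ht
    fun _ hu => measurable_matrixOpNorm_empInfoMatrix h p hXc _ (hu.trans ht.le)
      fun v hv => hX v (hv.trans hu)

lemma measurable_infoTime {m : MeasurableSpace Ω}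
    (hXc : ∀ ω, ContinuousOn (fun t => X t ω) (Set.Icc 0 T)) (hX : ∀ u ≤ T, Measurable (X u)) :
    Measurable (infoTime T J (empInfoMatrix s h X p)) :=
  measurable_hittingBtwn (fun ω => continuousOn_matrixOpNorm_empInfoMatrix h p hXc _ ω)
    fun _ hu => measurable_matrixOpNorm_empInfoMatrix h p hXc _ hu fun v hv => hX v (hv.trans hu)

/-- The occupation matrix starts at zero and is continuous in time, so its normalised norm has not
exceeded `T` at the stopping time. Hence the `CFC.sqrt` in `modifiedScore` is a genuine square root.
-/
lemma posSemidef_sub_empInfoMatrix_infoTime (hT : 0 < T) (hJ : J.PosDef)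
    (hXc : ∀ ω, ContinuousOn (fun t => X t ω) (Set.Icc 0 T)) (ω : Ω) :
    (J - (T : ℝ)⁻¹ • empInfoMatrix s h X p (infoTime T J (empInfoMatrix s h X p) ω)
      ω).PosSemidef := by
  refine posSemidef_sub_of_matrixOpNorm_le hJ (empInfoMatrix_isHermitian s h p _ ω)
    (by exact_mod_cast hT) (apply_hittingBtwn_le
      (fun ω => continuousOn_matrixOpNorm_empInfoMatrix h p hXc _ ω) ω ?_)
  have : empInfoMatrix s h X p 0 ω = 0 := by
    ext k l
    rw [empInfoMatrix_apply]
    simp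
  rw [this]
  simp [matrixOpNorm]

lemma measurable_sqrt_sub_empInfoMatrix_infoTime {m : MeasurableSpace Ω} (hT : 0 < T)
    (hJ : J.PosDef) (hXc : ∀ ω, ContinuousOn (fun t => X t ω) (Set.Icc 0 T))
    (hX : ∀ u ≤ T, Measurable (X u)) :
    Measurable fun ω => Matrix.toEuclideanCLM (𝕜 := ℝ) (CFC.sqrt (J - (T : ℝ)⁻¹ •
      empInfoMatrix s h X p (infoTime T J (empInfoMatrix s h X p) ω) ω)) := by
  refine measurable_of_continuousOn_matrix
    (f := fun A => Matrix.toEuclideanCLM (𝕜 := ℝ) (CFC.sqrt A)) (K := {A | 0 ≤ A})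
    (continuous_toEuclideanCLM.comp_continuousOn continuousOn_matrix_sqrt) (fun k l => ?_)
    fun ω => Matrix.nonneg_iff_posSemidef.2
      (posSemidef_sub_empInfoMatrix_infoTime h p J hT hJ hXc ω)
  obtain ⟨C, hC⟩ := exists_norm_localMonomial_mul_le h p k l
  simp_rw [Matrix.sub_apply, Matrix.smul_apply, smul_eq_mul, empInfoMatrix_apply]
  exact measurable_const.sub ((measurable_intervalIntegral_comp_random hXc hX
    ((measurable_localMonomial h p k).mul (measurable_localMonomial h p l)) hC
    (measurable_infoTime h p J hXc hX) (infoTime_le h p J)).const_mul _)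

end InfoTime

/-! ### The joint law of the modified scores. -/

section Main

variable {Ω : Type*} {mΩ : MeasurableSpace Ω} {P : Measure Ω} [IsProbabilityMeasure P]
  {𝓕 : Filtration ℝ≥0 mΩ} {d s : ℕ} {T : ℝ≥0} {a h : ℝ}
  {b : EuclideanSpace ℝ (Fin d) → EuclideanSpace ℝ (Fin d)}
  {μ : EuclideanSpace ℝ (Fin d) → ℝ} {W X : ℝ≥0 → Ω → EuclideanSpace ℝ (Fin d)}
  {ε : gridPoints d a h × Fin d → Ω → EuclideanSpace ℝ (MultiIndex d s)}

lemma aemeasurable_modifiedScore (hT : 0 < T) (hX : IsDiffusion 𝓕 P T b μ W X)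
    (hJ : ∀ p, (infoMatrix s h μ p).PosDef) (q : gridPoints d a h × Fin d)
    (hε : AEMeasurable (ε q) P) :
    AEMeasurable (modifiedScore 𝓕 P T s a h μ W X ε q) P := by
  have hXm : ∀ t ≤ T, Measurable (X t) := fun t ht => (hX.adapted t ht).mono (𝓕.le t) le_rfl
  have hτ : Measurable (infoTime T (infoMatrix s h μ q.1) (empInfoMatrix s h X q.1)) :=
    measurable_infoTime (d := d) h q.1 (infoMatrix s h μ q.1) hX.continuous_paths hXm
  have hscore : AEMeasurable (fun ω => scoreProcess 𝓕 P T s h (fun t ω' => W t ω' q.2) X q.1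
      (infoTime T (infoMatrix s h μ q.1) (empInfoMatrix s h X q.1) ω) ω) P := by
    refine (WithLp.measurable_toLp 2 _).comp_aemeasurable (aemeasurable_pi_lambda _ fun k => ?_)
    obtain ⟨Φ, hΦ, ⟨C, hC⟩, hlim⟩ :=
      exists_tendsto_localMonomial (h := h) (q.1 : EuclideanSpace ℝ (Fin d)) k
    exact aemeasurable_itoIntegral_stopped (hX.brownian.component q.2) hX.continuous_paths
      hX.adapted (measurable_localMonomial (d := d) h q.1 k) hΦ hC hlim hτ
      (infoTime_le (d := d) h q.1 (infoMatrix s h μ q.1))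
  have hR := measurable_sqrt_sub_empInfoMatrix_infoTime (d := d) h q.1 (infoMatrix s h μ q.1) hT
    (hJ q.1) hX.continuous_paths hXm
  have hRε := ContinuousLinearMap.measurable_apply₂.comp_aemeasurable (hR.aemeasurable.prodMk hε)
  exact ((measurable_const_smul (√(T : ℝ))⁻¹).comp_aemeasurable hscore).add hRε

/-- The brackets of the stopped score processes over distinct subcubes vanish. -/
lemma sum_bracket_localMonomial [Fintype (gridPoints d a h)] (hh : 0 < h)
    (σ : gridPoints d a h → ℝ≥0) (y : gridPoints d a h → MultiIndex d s → ℝ) (ω : Ω) :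
    ∑ q : gridPoints d a h × MultiIndex d s, ∑ q' : gridPoints d a h × MultiIndex d s,
      y q.1 q.2 * y q'.1 q'.2 * (∫ u in (0 : ℝ)..(min (σ q.1) (σ q'.1) : ℝ≥0),
        localMonomial h q.1 q.2 (X u.toNNReal ω) * localMonomial h q'.1 q'.2 (X u.toNNReal ω))
    = ∑ p : gridPoints d a h, y p ⬝ᵥ (empInfoMatrix s h X p (σ p) ω).mulVec (y p) := by
  simp_rw [Fintype.sum_prod_type]
  refine Finset.sum_congr rfl fun p _ => ?_
  simp_rw [dotProduct, Matrix.mulVec, dotProduct, Finset.mul_sum]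
  refine Finset.sum_congr rfl fun k _ => ?_
  rw [Finset.sum_eq_single p]
  · refine Finset.sum_congr rfl fun l _ => ?_
    rw [min_self, empInfoMatrix_apply]
    ring
  · intro p' _ hp'
    refine Finset.sum_eq_zero fun l _ => ?_
    simp_rw [localMonomial_mul_localMonomial_of_ne hh hp'.symm]
    simp
  · exact fun hp => absurd (Finset.mem_univ p) hp

/-- Stacking all the `ε` in one Euclidean product space gives a single standard Gaussian vector, so
they can be integrated out in one step. -/
lemma charFun_map_toLp_of_stdGaussian [Fintype (gridPoints d a h)]
    (hε_law : ∀ q, HasLaw (ε q) (stdGaussian (EuclideanSpace ℝ (MultiIndex d s))) P)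
    (hε_indep : iIndepFun ε P)
    (y : PiLp 2 fun _ : gridPoints d a h × Fin d => EuclideanSpace ℝ (MultiIndex d s)) :
    charFun (P.map fun ω => WithLp.toLp 2 fun q => ε q ω) y
      = Complex.exp (-(‖y‖ ^ 2 : ℝ) / 2) := by
  rw [(iIndepFun_iff_charFun_pi fun q => (hε_law q).aemeasurable).1 hε_indep y]
  simp_rw [(hε_law _).map_eq, charFun_stdGaussian]
  rw [← Complex.exp_sum, PiLp.norm_sq_eq_of_L2]
  congr 1
  push_cast
  rw [← Finset.sum_neg_distrib, Finset.sum_div]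

lemma integral_exp_sum_inner_modifiedScore [Fintype (gridPoints d a h)] (hT : 0 < T) (hh : 0 < h)
    (hb : Measurable b) (hX : IsDiffusion 𝓕 P T b μ W X)
    (hJ : ∀ p, (infoMatrix s h μ p).PosDef)
    (hε_law : ∀ q, HasLaw (ε q) (stdGaussian (EuclideanSpace ℝ (MultiIndex d s))) P)
    (hε_indep : iIndepFun ε P)
    (hεX : IndepFun (fun ω (t : Set.Icc (0 : ℝ≥0) T) => X t ω) (fun ω q => ε q ω) P)
    (y : gridPoints d a h × Fin d → EuclideanSpace ℝ (MultiIndex d s)) :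
    ∫ ω, Complex.exp ((∑ q, inner ℝ (modifiedScore 𝓕 P T s a h μ W X ε q ω) (y q) : ℝ) *
        Complex.I) ∂P
      = Complex.exp (-((∑ q, (y q).ofLp ⬝ᵥ (infoMatrix s h μ q.1).mulVec (y q).ofLp : ℝ) : ℂ) / 2)
        := by
  have hXc := hX.continuous_paths
  have hXΩ : ∀ t ≤ T, Measurable (X t) := fun t ht => (hX.adapted t ht).mono (𝓕.le t) le_rfl
  have hXmap : Measurable fun ω (t : Set.Icc (0 : ℝ≥0) T) => X t ω :=
    measurable_pi_lambda _ fun t => hXΩ t t.2.2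
  -- The `ε` are independent of `X`, and not by assumption of `𝓕` or `W`, so everything is expressed
  -- through `σ(X)`; `hW'` recovers `W` from `X` by the equation.
  let m : MeasurableSpace Ω :=
    MeasurableSpace.comap (fun ω (t : Set.Icc (0 : ℝ≥0) T) => X t ω) inferInstance
  have hm : m ≤ mΩ := hXmap.comap_le
  have hXm : ∀ t ≤ T, Measurable[m] (X t) := fun t ht => by
    have h1 : Measurable[m] fun ω (t : Set.Icc (0 : ℝ≥0) T) => X t ω := comap_measurable _
    exact measurable_pi_iff.1 h1 ⟨t, zero_le, ht⟩
  set D : Ω → PiLp 2 fun _ : gridPoints d a h × Fin d => EuclideanSpace ℝ (MultiIndex d s) :=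
    fun ω => WithLp.toLp 2 fun q => ε q ω with hDdef
  have hD : AEMeasurable D P := (WithLp.measurable_toLp 2 _).comp_aemeasurable
    (aemeasurable_pi_lambda _ fun q => (hε_law q).aemeasurable)
  have hind : Indep m (MeasurableSpace.comap D inferInstance) P := by
    refine indep_of_indep_of_le_right ((IndepFun_iff_Indep _ _ _).1 hεX) ?_
    exact ((WithLp.measurable_toLp 2 _).comp (comap_measurable _)).comap_le
  set τ : gridPoints d a h → Ω → ℝ≥0 := fun p =>
    infoTime T (infoMatrix s h μ p) (empInfoMatrix s h X p) with hτ
  set R : gridPoints d a h → Ω →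
      (EuclideanSpace ℝ (MultiIndex d s) →L[ℝ] EuclideanSpace ℝ (MultiIndex d s)) := fun p ω =>
    Matrix.toEuclideanCLM (𝕜 := ℝ) (CFC.sqrt (infoMatrix s h μ p - (T : ℝ)⁻¹ •
      empInfoMatrix s h X p (τ p ω) ω)) with hR
  set v : Ω → PiLp 2 fun _ : gridPoints d a h × Fin d => EuclideanSpace ℝ (MultiIndex d s) :=
    fun ω => WithLp.toLp 2 fun q => R q.1 ω (y q) with hv
  have hvm : Measurable[m] v := (WithLp.measurable_toLp 2 _).comp (measurable_pi_lambda _ fun q =>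
    (measurable_sqrt_sub_empInfoMatrix_infoTime (d := d) h q.1 (infoMatrix s h μ q.1) hT (hJ _) hXc
      hXm).apply_continuousLinearMap _)
  choose Φ hΦ hΦC hlim using fun q : gridPoints d a h × MultiIndex d s =>
    exists_tendsto_localMonomial (h := h) (q.1 : EuclideanSpace ℝ (Fin d)) q.2
  choose C₀ hC₀ using hΦC
  have hC : ∀ k q x, |Φ q k x| ≤ ∑ q, |C₀ q| := fun k q x =>
    ((hC₀ q k x).trans (le_abs_self _)).trans
    (Finset.single_le_sum (f := fun q => |C₀ q|) (fun _ _ => abs_nonneg _) (Finset.mem_univ q))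
  have hW' : ∀ t ≤ T, Measurable[m] fun ω =>
      X t ω - X 0 ω - ∫ u in (0 : ℝ)..t, b (X u.toNNReal ω) := fun t ht =>
    ((hXm t ht).sub (hXm 0 (zero_le))).sub
      (measurable_intervalIntegral_comp hXc ht (fun u hu => hXm u (hu.trans ht)) hb)
  have hsqrt : (√(T : ℝ))⁻¹ * (√(T : ℝ))⁻¹ = (T : ℝ)⁻¹ := by
    rw [← mul_inv, Real.mul_self_sqrt T.coe_nonneg]
  -- The random terms cancel: the bracket contributes `T⁻¹ yᵀ Ĵ y` for each cube and each `j`, and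
  -- `‖v‖²` contributes `yᵀ (J - T⁻¹ Ĵ) y`, both at the same stopping time.
  have hc : ∀ ω, ∑ j, ∑ q : gridPoints d a h × MultiIndex d s,
      ∑ q' : gridPoints d a h × MultiIndex d s,
      ((√(T : ℝ))⁻¹ * y (q.1, j) q.2) * ((√(T : ℝ))⁻¹ * y (q'.1, j) q'.2) *
      (∫ u in (0 : ℝ)..(min (τ q.1 ω) (τ q'.1 ω) : ℝ≥0),
        localMonomial h q.1 q.2 (X u.toNNReal ω) * localMonomial h q'.1 q'.2 (X u.toNNReal ω))
      + ‖v ω‖ ^ 2 = ∑ q, (y q).ofLp ⬝ᵥ (infoMatrix s h μ q.1).mulVec (y q).ofLp := by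
    intro ω
    have e : ∀ j, _ := fun j => sum_bracket_localMonomial (X := X) hh (fun p => τ p ω)
      (fun p k => (√(T : ℝ))⁻¹ * y (p, j) k) ω
    simp_rw [e]
    rw [PiLp.norm_sq_eq_of_L2, Fintype.sum_prod_type_right, Fintype.sum_prod_type_right,
      ← Finset.sum_add_distrib]
    refine Finset.sum_congr rfl fun j _ => ?_
    rw [← Finset.sum_add_distrib]
    refine Finset.sum_congr rfl fun p _ => ?_
    have h1 := norm_sq_toEuclideanCLM_sqrt (posSemidef_sub_empInfoMatrix_infoTime (X := X) h p
      (infoMatrix s h μ p) hT (hJ _) hXc ω) (y (p, j))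
    have h2 : (fun k => (√(T : ℝ))⁻¹ * y (p, j) k) = (√(T : ℝ))⁻¹ • (y (p, j)).ofLp := rfl
    rw [h2, Matrix.mulVec_smul, smul_dotProduct, dotProduct_smul, smul_smul, hsqrt]
    have h3 : ‖v ω (p, j)‖ ^ 2 = _ := h1
    rw [h3, Matrix.sub_mulVec, dotProduct_sub, Matrix.smul_mulVec, dotProduct_smul]
    exact add_sub_cancel _ _
  have key := integral_exp_stopped_itoIntegral (ι := gridPoints d a h × MultiIndex d s) hm hT
    hX.brownian hXc hX.adapted hXm hW'
    (hX.equation.mono fun ω hω t ht => by rw [hω t ht]; abel)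
    (F := fun q => localMonomial h q.1 q.2) (fun q => measurable_localMonomial (d := d) h q.1 q.2)
    (Φ := fun k q => Φ q k) (fun k q => hΦ q k) hC hlim (τ := fun q => τ q.1)
    (fun q ω => infoTime_le (d := d) h q.1 (infoMatrix s h μ q.1) ω)
    (fun q t ht => measurableSet_lt_infoTime (d := d) h q.1 (infoMatrix s h μ q.1) hXc ht fun u hu =>
      (hX.adapted u (hu.trans ht.le)).mono (𝓕.mono hu) le_rfl)
    (fun q => measurable_infoTime (d := d) h q.1 (infoMatrix s h μ q.1) hXc hXm) (fun j q => (√(T : ℝ))⁻¹ * y (q.1, j) q.2)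
    hvm hD (charFun_map_toLp_of_stdGaussian hε_law hε_indep) hind hc
  rw [← key]
  refine integral_congr_ae (ae_of_all _ fun ω => ?_)
  simp only
  rw [← Complex.exp_add, ← add_mul, ← Complex.ofReal_add]
  congr 3
  have e1 : ∀ q, inner ℝ (modifiedScore 𝓕 P T s a h μ W X ε q ω) (y q)
      = ∑ k, (√(T : ℝ))⁻¹ * y q k * itoIntegral 𝓕 P (fun t ω' => W t ω' q.2) T
        (fun u ω' => localMonomial h q.1 k (X u ω')) (τ q.1 ω) ω + inner ℝ (D ω q) (v ω q) := by
    intro q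
    have : modifiedScore 𝓕 P T s a h μ W X ε q ω = (√(T : ℝ))⁻¹ • scoreProcess 𝓕 P T s h
      (fun t ω' => W t ω' q.2) X q.1 (τ q.1 ω) ω + R q.1 ω (ε q ω) := rfl
    rw [this, inner_add_left, inner_toEuclideanCLM_sqrt_left, inner_smul_left, PiLp.inner_apply,
      Finset.mul_sum]
    congr 1
    refine Finset.sum_congr rfl fun k _ => ?_
    rw [Real.inner_apply, scoreProcess]
    simp only [conj_trivial]
    ring
  simp_rw [e1]
  rw [Finset.sum_add_distrib, PiLp.inner_apply, Fintype.sum_prod_type_right]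
  simp_rw [Fintype.sum_prod_type]

end Main

theorem proposition2 {Ω : Type*} {mΩ : MeasurableSpace Ω} (P : Measure Ω) [IsProbabilityMeasure P]
    (𝓕 : Filtration ℝ≥0 mΩ) {d : ℕ} (β L M₁ M₂ : ℝ) (hβ : 0 < β) (hL : 0 < L)
    (hM₁ : 0 < M₁) (hM₂ : 0 < M₂) (T : ℝ≥0) (hT : 0 < T)
    (a h : ℝ) (ha : 0 < a) (hh : 0 < h) (hah : ∃ N : ℕ, a / h = N)
    (V : EuclideanSpace ℝ (Fin d) → ℝ)
    (b : EuclideanSpace ℝ (Fin d) → EuclideanSpace ℝ (Fin d))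
    (hb : MemDriftClass β L M₁ M₂ V b)
    (W X : ℝ≥0 → Ω → EuclideanSpace ℝ (Fin d))
    (hX : IsDiffusion 𝓕 P T b (invariantDensity V) W X)
    (ε : gridPoints d a h × Fin d → Ω → EuclideanSpace ℝ (MultiIndex d (strictFloor β)))
    (hε_law : ∀ q, HasLaw (ε q) (stdGaussian (EuclideanSpace ℝ (MultiIndex d (strictFloor β)))) P)
    (hε_indep : iIndepFun ε P)
    (hεX : IndepFun (fun ω (t : Set.Icc (0 : ℝ≥0) T) => X t ω) (fun ω q => ε q ω) P) :
    iIndepFun (modifiedScore 𝓕 P T (strictFloor β) a h (invariantDensity V) W X ε) P ∧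
    ∀ q : gridPoints d a h × Fin d,
      HasGaussianLaw
        (modifiedScore 𝓕 P T (strictFloor β) a h (invariantDensity V) W X ε q) P ∧
      (∫ ω, modifiedScore 𝓕 P T (strictFloor β) a h (invariantDensity V) W X ε q ω ∂P) = 0 ∧
      ∀ k l : MultiIndex d (strictFloor β),
        cov[fun ω => modifiedScore 𝓕 P T (strictFloor β) a h (invariantDensity V) W X ε q ω k,
            fun ω => modifiedScore 𝓕 P T (strictFloor β) a h (invariantDensity V) W X ε q ω l; P]
          = infoMatrix (strictFloor β) h (invariantDensity V) q.1 k l := by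
  classical
  have := finite_gridPoints d a hh
  cases nonempty_fintype (gridPoints d a h)
  have hJ : ∀ p, (infoMatrix (strictFloor β) h (invariantDensity V) p).PosDef :=
    posDef_infoMatrix hh (continuous_invariantDensity hb.contDiff_potential.continuous)
      (invariantDensity_pos hX.initial_law)
  -- Measurability of the drift makes `∫ b(X)`, and with it the reconstructed Brownian motion,
  -- measurable with respect to `σ(X)`.
  have hbm : Measurable b := (WithLp.measurable_toLp 2 _).comp
    (measurable_pi_lambda _ fun i => (hb.holder i).contDiff.continuous.measurable)
  obtain ⟨h1, h2⟩ := iIndepFun_and_hasLaw_of_integral_exp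
    (fun q => aemeasurable_modifiedScore hT hX hJ q (hε_law q).aemeasurable)
    (fun q => (hJ q.1).posSemidef)
    (integral_exp_sum_inner_modifiedScore hT hh hbm hX hJ hε_law hε_indep hεX)
  refine ⟨h1, fun q => ⟨(h2 q).hasGaussianLaw, ?_, fun k l => ?_⟩⟩
  · rw [(h2 q).integral_eq]
    exact integral_id_multivariateGaussian
  · rw [← covariance_eval_multivariateGaussian (μ := 0) (hJ q.1).posSemidef, ← (h2 q).map_eq,
      covariance_map_fun (by fun_prop) (by fun_prop) (h2 q).aemeasurable]

end
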